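/- Let $Q$ be the quiver with one vertex and two loops $a,b$, and let $A=\mathbb{C}Q/\langle Q_2\rangle$ be the quotient of its path algebra by the two-sided ideal generated by the paths of length two. Let $HH^n(A)$ be the Hochschild cohomology groups of $A$. The Gerstenhaber bracket makes $HH^1(A)$ a Lie algebra and each $HH^n(A)$ a Lie module over $HH^1(A)$. For $t\ge 0$ let $V(t)=\mathrm{Sym}^t(\mathbb{C}^2)$; it is irreducible over $sl_2(\mathbb{C})$ and has dimension $t+1$. For $n\ge 1$ put $h(n)=\max\{l : n+1-2l\ge 0\}$, and for $0\le l\le h(n)$ define $$q(n,l)=\binom{n-1}{l}-\binom{n-1}{l-3}\ \ (n\ge 2),\qquad q(1,0)=q(1,1)=1,$$ where $\binom{m}{j}=0$ for $j<0$. There is an isomorphism of Lie algebras $\varphi: HH^1(A)\to sl_2(\mathbb{C})\times\mathbb{C}$ such that, if $\varphi([D])=(X,c)$ for a derivation $D$ of $A$, then $D$ acts on the images of the two loops in $A$ (in a fixed order) by the matrix $X+c\cdot 1$. Let $I=\varphi^{-1}(0,1)$. For every $n\ge 1$ there is an isomorphism of Lie modules over $HH^1(A)\cong sl_2(\mathbb{C})\times\mathbb{C}$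 $$HH^n(A)\;\cong\;\bigoplus_{l=0}^{h(n)}V(n+1-2l)^{q(n,l)}\otimes\mathbb{C},$$ where $sl_2(\mathbb{C})$ acts on the factors $V(n+1-2l)$ and trivially on $\mathbb{C}$, while the central factor $\mathbb{C}$ of $sl_2(\mathbb{C})\times\mathbb{C}$ acts trivially on $V(n+1-2l)$ and $I$ acts on the one-dimensional module $\mathbb{C}$ by the scalar $1-n$. In particular $I$ acts on $HH^n(A)$ by $1-n$. -/

import Mathlib

noncomputable section

namespace Hochschild

open Function

variable (k A : Type*) [Field k] [Ring A] [Algebra k A]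

/-- The space `Cⁿ(A, A) = Hom_k(A^{⊗ n}, A)` of Hochschild cochains, as multilinear maps. -/
def Cochain (n : ℕ) : Type _ := MultilinearMap k (fun _ : Fin n => A) A

instance (n : ℕ) : AddCommGroup (Cochain k A n) :=
  inferInstanceAs (AddCommGroup (MultilinearMap k (fun _ : Fin n => A) A))

instance (n : ℕ) : Module k (Cochain k A n) :=
  inferInstanceAs (Module k (MultilinearMap k (fun _ : Fin n => A) A))

instance (n : ℕ) : FunLike (Cochain k A n) (Fin n → A) A :=
  inferInstanceAs (FunLike (MultilinearMap k (fun _ : Fin n => A) A) (Fin n → A) A)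

variable {k A}

namespace Cochain

variable {n : ℕ}

@[ext] lemma ext {f g : Cochain k A n} (h : ∀ x, f x = g x) : f = g := DFunLike.ext f g h

@[simp] lemma zero_apply (x : Fin n → A) : (0 : Cochain k A n) x = 0 := rfl

@[simp] lemma add_apply (f g : Cochain k A n) (x : Fin n → A) : (f + g) x = f x + g x := rfl

@[simp] lemma sub_apply (f g : Cochain k A n) (x : Fin n → A) : (f - g) x = f x - g x := rfl

@[simp] lemma neg_apply (f : Cochain k A n) (x : Fin n → A) : (-f) x = -f x := rfl

@[simp] lemma smul_apply (c : k) (f : Cochain k A n) (x : Fin n → A) : (c • f) x = c • f x := rfl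

@[simp] lemma sum_apply {ι : Type*} (s : Finset ι) (f : ι → Cochain k A n) (x : Fin n → A) :
    (∑ i ∈ s, f i) x = ∑ i ∈ s, f i x :=
  map_sum (⟨⟨fun f => f x, rfl⟩, fun _ _ => rfl⟩ : Cochain k A n →+ A) f s

lemma map_update_add (f : Cochain k A n) (x : Fin n → A) (i : Fin n) (v w : A) :
    f (update x i (v + w)) = f (update x i v) + f (update x i w) :=
  MultilinearMap.map_update_add f x i v w

lemma map_update_smul (f : Cochain k A n) (x : Fin n → A) (i : Fin n) (c : k) (v : A) :
    f (update x i (c • v)) = c • f (update x i v) :=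
  MultilinearMap.map_update_smul f x i c v


/-- A function that is linear in each variable, as a cochain. -/
def ofFun (F : (Fin n → A) → A)
    (h : ∀ x i, IsLinearMap k fun v => F (update x i v)) : Cochain k A n where
  toFun := F
  map_update_add' := by
    intro _ x i v w
    convert (h x i).map_add v w
  map_update_smul' := by
    intro _ x i c v
    convert (h x i).map_smul c v

@[simp] lemma ofFun_apply (F : (Fin n → A) → A)
    (h : ∀ x i, IsLinearMap k fun v => F (update x i v)) (x : Fin n → A) :
    ofFun F h x = F x := rfl

end Cochain

lemma isLinearMap_update {n : ℕ} (f : Cochain k A n) (x : Fin n → A) (i : Fin n) :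
    IsLinearMap k fun v => f (update x i v) :=
  ⟨fun v w => f.map_update_add x i v w, fun c v => f.map_update_smul x i c v⟩

lemma contractNth_update {n : ℕ} (j : Fin n) (x : Fin (n + 1) → A) (i : Fin (n + 1)) (v : A) :
    Fin.contractNth j.castSucc (· * ·) (update x i v) =
      if i = j.castSucc then
        update (Fin.contractNth j.castSucc (· * ·) x) j (v * x j.succ)
      else if i = j.succ then
        update (Fin.contractNth j.castSucc (· * ·) x) j (x j.castSucc * v)
      else update (Fin.contractNth j.castSucc (· * ·) x) (j.predAbove i) v := by
  ext l
  split_ifs with h1 h2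
  · subst h1
    rcases lt_trichotomy (l : ℕ) j with h | h | h
    · have : l ≠ j := by rintro rfl; omega
      simp [Fin.contractNth, h, this]
    · have : l = j := Fin.ext h
      subst this
      have : l.succ ≠ l.castSucc := by simp [Fin.ext_iff]
      simp [Fin.contractNth, this]
    · have : l ≠ j := by rintro rfl; omega
      have h3 : l.succ ≠ j.castSucc := by simp [Fin.ext_iff]; omega
      simp [Fin.contractNth, this, h3, Nat.not_lt_of_gt h, Nat.ne_of_gt h]
  · subst h2
    rcases lt_trichotomy (l : ℕ) j with h | h | h
    · have : l ≠ j := by rintro rfl; omega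
      have h3 : l.castSucc ≠ j.succ := by simp [Fin.ext_iff]; omega
      simp [Fin.contractNth, h, this, h3]
    · have : l = j := Fin.ext h
      subst this
      have : l.castSucc ≠ l.succ := by simp [Fin.ext_iff]
      simp [Fin.contractNth, this]
    · have : l ≠ j := by rintro rfl; omega
      simp [Fin.contractNth, this, Nat.not_lt_of_gt h, Nat.ne_of_gt h]
  · have h1' : (i : ℕ) ≠ j := fun h => h1 (Fin.ext h)
    have h2' : (i : ℕ) ≠ j + 1 := fun h => h2 (Fin.ext h)
    have hp : ((j.predAbove i : Fin n) : ℕ) = if (j : ℕ) < i then (i : ℕ) - 1 else i := by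
      unfold Fin.predAbove
      split_ifs with h3 h4 h4
      · simp
      · exact absurd (by simpa [Fin.lt_def] using h3) h4
      · exact absurd (by simpa [Fin.lt_def] using h4) h3
      · simp
    simp only [Fin.contractNth, update_apply, Fin.ext_iff, hp, Fin.val_castSucc, Fin.val_succ]
    split_ifs <;> first | rfl | omega

variable (k A) in
/-- The Hochschild differential `δ : Cⁿ(A, A) → Cⁿ⁺¹(A, A)`,
`δf(x₀,…,xₙ) = x₀ f(x₁,…,xₙ) + ∑_{j<n} (-1)^{j+1} f(…, xⱼ xⱼ₊₁, …) + (-1)^{n+1} f(x₀,…,xₙ₋₁) xₙ`.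
For `n = 0` this is `δ(a)(x) = x a - a x`. -/
def d (n : ℕ) : Cochain k A n →ₗ[k] Cochain k A (n + 1) where
  toFun f := Cochain.ofFun (fun x =>
      x 0 * f (Fin.tail x)
        + ∑ j : Fin n, (-1 : k) ^ ((j : ℕ) + 1) • f (Fin.contractNth j.castSucc (· * ·) x)
        + (-1 : k) ^ (n + 1) • (f (Fin.init x) * x (Fin.last n))) (by
    intro x i
    have h1 : IsLinearMap k fun v => (update x i v) 0 * f (Fin.tail (update x i v)) := by
      refine Fin.cases ?_ (fun i => ?_) i
      · simp only [update_self, Fin.tail_update_zero]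
        exact ⟨fun v w => add_mul _ _ _, fun c v => smul_mul_assoc _ _ _⟩
      · have : (0 : Fin (n + 1)) ≠ i.succ := (Fin.succ_ne_zero i).symm
        simp only [ne_eq, this, not_false_eq_true, update_of_ne, Fin.tail_update_succ]
        exact ⟨fun v w => by rw [f.map_update_add, mul_add],
          fun c v => by rw [f.map_update_smul, mul_smul_comm]⟩
    have h2 : ∀ j : Fin n, IsLinearMap k fun v =>
        f (Fin.contractNth j.castSucc (· * ·) (update x i v)) := by
      intro j
      simp only [contractNth_update]
      split_ifs
      · exact ⟨fun v w => by rw [add_mul, f.map_update_add],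
          fun c v => by rw [smul_mul_assoc, f.map_update_smul]⟩
      · exact ⟨fun v w => by rw [mul_add, f.map_update_add],
          fun c v => by rw [mul_smul_comm, f.map_update_smul]⟩
      · exact isLinearMap_update _ _ _
    have h3 : IsLinearMap k fun v =>
        f (Fin.init (update x i v)) * (update x i v) (Fin.last n) := by
      refine Fin.lastCases ?_ (fun i => ?_) i
      · simp only [update_self, Fin.init_update_last]
        exact ⟨fun v w => mul_add _ _ _, fun c v => mul_smul_comm _ _ _⟩
      · have : Fin.last n ≠ i.castSucc := (Fin.castSucc_ne_last i).symm
        simp only [ne_eq, this, not_false_eq_true, update_of_ne, Fin.init_update_castSucc]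
        exact ⟨fun v w => by rw [f.map_update_add, add_mul],
          fun c v => by rw [f.map_update_smul, smul_mul_assoc]⟩
    refine ⟨fun v w => ?_, fun c v => ?_⟩
    · simp only [h1.map_add, (h2 _).map_add, h3.map_add, smul_add, Finset.sum_add_distrib]
      abel
    · simp only [h1.map_smul, (h2 _).map_smul, h3.map_smul, smul_add, Finset.smul_sum,
        smul_comm c])
  map_add' f g := by
    ext x
    simp only [Cochain.ofFun_apply, Cochain.add_apply, mul_add, smul_add,
      Finset.sum_add_distrib, add_mul]
    abel
  map_smul' c f := by
    ext x
    simp only [Cochain.ofFun_apply, Cochain.smul_apply, smul_add,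
      mul_smul_comm, smul_mul_assoc, Finset.smul_sum, smul_comm c, RingHom.id_apply]

lemma d_apply {n : ℕ} (f : Cochain k A n) (x : Fin (n + 1) → A) :
    d k A n f x = x 0 * f (Fin.tail x)
        + ∑ j : Fin n, (-1 : k) ^ ((j : ℕ) + 1) • f (Fin.contractNth j.castSucc (· * ·) x)
        + (-1 : k) ^ (n + 1) • (f (Fin.init x) * x (Fin.last n)) := rfl

variable (k A) in
/-- The Hochschild cocycles of degree `n`. -/
def Z (n : ℕ) : Submodule k (Cochain k A n) := LinearMap.ker (d k A n)

variable (k A) in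
/-- The Hochschild coboundaries of degree `n`. -/
def B : (n : ℕ) → Submodule k (Cochain k A n)
  | 0 => ⊥
  | n + 1 => LinearMap.range (d k A n)

variable (k A) in
/-- The Hochschild cohomology group `HHⁿ(A) = HHⁿ(A, A)`. -/
def HH (n : ℕ) : Type _ := Z k A n ⧸ (B k A n).submoduleOf (Z k A n)

instance (n : ℕ) : AddCommGroup (HH k A n) :=
  inferInstanceAs (AddCommGroup (Z k A n ⧸ (B k A n).submoduleOf (Z k A n)))

instance (n : ℕ) : Module k (HH k A n) :=
  inferInstanceAs (Module k (Z k A n ⧸ (B k A n).submoduleOf (Z k A n)))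

variable (k A) in
/-- The Hochschild cohomology group `HHⁿ(A) = HHⁿ(A, A)`. -/
def HH.mk (n : ℕ) : Z k A n →ₗ[k] HH k A n := ((B k A n).submoduleOf (Z k A n)).mkQ

/-- The arguments `(x₀, …, xᵢ₋₁, g(xᵢ, …, xᵢ₊ₘ₋₁), xᵢ₊ₘ, …)` that `f` receives in `f ∘ᵢ g`
(with `i` counted from `0`). -/
def insArgs {n m p : ℕ} (h : p + 1 = n + m) (g : Cochain k A m) (i : Fin n) (x : Fin p → A) :
    Fin n → A := fun j =>
  if hj : j < i then x ⟨j, by have := i.2; omega⟩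
  else if hj' : j = i then g fun l => x ⟨i + l, by have := i.2; have := l.2; omega⟩
  else x ⟨j + m - 1, by have := j.2; have := i.2; omega⟩

/-- The insertion `f ∘ᵢ g ∈ C^{n+m-1}(A, A)`. -/
def ins {n m p : ℕ} (h : p + 1 = n + m) (f : Cochain k A n) (g : Cochain k A m) (i : Fin n) :
    Cochain k A p :=
  Cochain.ofFun (fun x => f (insArgs h g i x)) (by
    intro x j
    have key : ∃ (l : Fin n) (L : A →ₗ[k] A), ∀ v,
        insArgs h g i (update x j v) = update (insArgs h g i x) l (L v) := by
      have hi := i.2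
      have hjp := j.2
      by_cases h1 : (j : ℕ) < i
      · refine ⟨⟨j, by omega⟩, LinearMap.id, fun v => ?_⟩
        ext l
        have hl := l.2
        by_cases hlj : l = ⟨j, by omega⟩
        · have e1 : (l : ℕ) = j := congrArg Fin.val hlj
          have h3 : l < i := show (l : ℕ) < i by omega
          rw [← hlj]
          simp only [insArgs, h3, dite_true, update_self, LinearMap.id_coe, id_eq]
          rw [show (⟨(l : ℕ), by omega⟩ : Fin p) = j from Fin.ext e1]
          simp
        · rw [update_of_ne hlj]
          have h2 : (l : ℕ) ≠ j := fun h => hlj (Fin.ext h)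
          unfold insArgs
          split_ifs with h3 h4
          · rw [update_of_ne]; simp [Fin.ext_iff]; omega
          · congr 1; ext q; rw [update_of_ne]; simp [Fin.ext_iff]; omega
          · have h3' : ¬ (l : ℕ) < i := h3
            have h4' : ¬ (l : ℕ) = i := fun h => h4 (Fin.ext h)
            rw [update_of_ne]; simp [Fin.ext_iff]; omega
      · by_cases h2 : (j : ℕ) < i + m
        · set q : Fin m := ⟨j - i, by omega⟩ with hq
          refine ⟨i, ⟨⟨fun v => g (update (fun l => x ⟨i + l, by omega⟩) q v), ?_⟩, ?_⟩, fun v => ?_⟩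
          · intro v w; exact g.map_update_add _ _ _ _
          · intro v w; exact g.map_update_smul _ _ _ _
          ext l
          have hl := l.2
          by_cases hlj : l = i
          · obtain rfl : i = l := hlj.symm
            simp only [insArgs, lt_self_iff_false, dite_false, dite_true, update_self,
              LinearMap.coe_mk, AddHom.coe_mk]
            congr 1; ext r
            by_cases hr : r = q
            · subst hr
              simp only [update_self]
              rw [show (⟨(i : ℕ) + (q : ℕ), by omega⟩ : Fin p) = j from Fin.ext (by simp [hq]; omega)]
              simp
            · have : (r : ℕ) ≠ j - i := fun h => hr (Fin.ext h)
              rw [update_of_ne hr, update_of_ne]; simp [Fin.ext_iff]; omega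
          · rw [update_of_ne hlj]
            unfold insArgs
            have h4' : ¬ (l : ℕ) = i := fun h => hlj (Fin.ext h)
            split_ifs with h3
            · have h3' : (l : ℕ) < i := h3
              rw [update_of_ne]; simp [Fin.ext_iff]; omega
            · have h3' : ¬ (l : ℕ) < i := h3
              rw [update_of_ne]; simp [Fin.ext_iff]; omega
        · refine ⟨⟨j + 1 - m, by omega⟩, LinearMap.id, fun v => ?_⟩
          ext l
          have hl := l.2
          by_cases hlj : l = ⟨j + 1 - m, by omega⟩
          · have e1 : (l : ℕ) = j + 1 - m := congrArg Fin.val hlj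
            have h3 : ¬ l < i := fun h' => by have : (l : ℕ) < i := h'; omega
            have h4 : ¬ l = i := by simp [Fin.ext_iff]; omega
            rw [← hlj]
            simp only [insArgs, h3, h4, dite_false, update_self, LinearMap.id_coe, id_eq]
            rw [show (⟨(l : ℕ) + m - 1, by omega⟩ : Fin p) = j from Fin.ext (by simp; omega)]
            simp
          · rw [update_of_ne hlj]
            have e1 : (l : ℕ) ≠ j + 1 - m := fun h => hlj (Fin.ext h)
            unfold insArgs
            split_ifs with h3 h4
            · have h3' : (l : ℕ) < i := h3
              rw [update_of_ne]; simp [Fin.ext_iff]; omega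
            · congr 1; ext q; have := q.2; rw [update_of_ne]; simp [Fin.ext_iff]; omega
            · have h3' : ¬ (l : ℕ) < i := h3
              have h4' : ¬ (l : ℕ) = i := fun h => h4 (Fin.ext h)
              rw [update_of_ne]; simp [Fin.ext_iff]; omega
    obtain ⟨l, L, hL⟩ := key
    simp only [hL]
    exact ⟨fun v w => by rw [map_add, f.map_update_add],
      fun c v => by rw [map_smul, f.map_update_smul]⟩)

/-- `f ∘ g = ∑ᵢ (-1)^{i (m-1)} f ∘ᵢ g`, `i` counted from `0`; the exponent `m + 1` has the
parity of `m - 1`. -/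
def circ {n m p : ℕ} (h : p + 1 = n + m) (f : Cochain k A n) (g : Cochain k A m) :
    Cochain k A p :=
  ∑ i : Fin n, (-1 : k) ^ ((i : ℕ) * (m + 1)) • ins h f g i

/-- The Gerstenhaber bracket `[f, g] = f ∘ g - (-1)^{(n-1)(m-1)} g ∘ f` in `C^{n+m-1}(A, A)`. -/
def gbracket {n m p : ℕ} (h : p + 1 = n + m) (f : Cochain k A n) (g : Cochain k A m) :
    Cochain k A p :=
  circ h f g - (-1 : k) ^ ((n + 1) * (m + 1)) • circ (h.trans (add_comm n m)) g f

/-- The Gerstenhaber bracket `[D, f]` with a `1`-cochain, written out. -/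
lemma gbracket_one_apply {n : ℕ} (D : Cochain k A 1) (f : Cochain k A n) (x : Fin n → A) :
    gbracket (add_comm n 1) D f x =
      D (fun _ => f x) - ∑ i, f (update x i (D fun _ => x i)) := by
  unfold gbracket circ
  simp only [Cochain.sub_apply, Cochain.smul_apply, Cochain.sum_apply]
  congr 1
  · simp only [Finset.univ_unique, Fin.default_eq_zero, Fin.isValue, Fin.val_eq_zero, zero_mul,
      pow_zero, one_smul, Finset.sum_singleton]
    show D (insArgs _ f 0 x) = _
    congr 1; ext j
    have : j = 0 := Subsingleton.elim _ _
    subst this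
    simp [insArgs]
  · have h1 : (-1 : k) ^ ((1 + 1) * (n + 1)) = 1 := Even.neg_one_pow (by simp)
    rw [h1, one_smul]
    refine Finset.sum_congr rfl fun i _ => ?_
    have h2 : (-1 : k) ^ ((i : ℕ) * (1 + 1)) = 1 := Even.neg_one_pow (by simp)
    rw [h2, one_smul]
    show f (insArgs _ D i x) = _
    congr 1; ext j
    unfold insArgs
    split_ifs with h3 h4
    · rw [update_of_ne (ne_of_lt h3)]
    · subst h4; simp
    · rw [update_of_ne h4]; rfl


variable (k A) in
/-- The bracket `[D, f]` with a `1`-cochain as a bilinear map. -/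
def act (n : ℕ) : Cochain k A 1 →ₗ[k] Cochain k A n →ₗ[k] Cochain k A n :=
  LinearMap.mk₂ k (fun D f => gbracket (add_comm n 1) D f)
    (fun D D' f => by
      ext x
      simp only [gbracket_one_apply, Cochain.add_apply, Cochain.map_update_add,
        Finset.sum_add_distrib]
      abel)
    (fun c D f => by
      ext x
      simp only [gbracket_one_apply, Cochain.smul_apply, Cochain.map_update_smul,
        Finset.smul_sum, smul_sub])
    (fun D f g => by
      ext x
      have := Cochain.map_update_add D (fun _ => f x) 0 (f x) (g x)
      simp only [Function.update_eq_const_of_subsingleton] at this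
      simp only [gbracket_one_apply, Cochain.add_apply, Finset.sum_add_distrib]
      have e : D (fun _ => f x + g x) = D (fun _ => f x) + D (fun _ => g x) := this
      rw [e]; abel)
    (fun c D f => by
      ext x
      have := Cochain.map_update_smul D (fun _ => f x) 0 c (f x)
      simp only [Function.update_eq_const_of_subsingleton] at this
      have e : D (fun _ => c • f x) = c • D (fun _ => f x) := this
      simp only [gbracket_one_apply, Cochain.smul_apply, e, Finset.smul_sum, smul_sub])

lemma act_apply {n : ℕ} (D : Cochain k A 1) (f : Cochain k A n) (x : Fin n → A) :
    act k A n D f x = D (fun _ => f x) - ∑ i, f (update x i (D fun _ => x i)) :=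
  gbracket_one_apply D f x

lemma one_add (D : Cochain k A 1) (v w : A) :
    D (fun _ => v + w) = D (fun _ => v) + D (fun _ => w) := by
  have := Cochain.map_update_add D (fun _ => v) 0 v w
  simp only [Function.update_eq_const_of_subsingleton] at this
  exact this

lemma one_smul' (D : Cochain k A 1) (c : k) (v : A) :
    D (fun _ => c • v) = c • D (fun _ => v) := by
  have := Cochain.map_update_smul D (fun _ => v) 0 c v
  simp only [Function.update_eq_const_of_subsingleton] at this
  exact this

/-- A `1`-cochain as a linear map. -/
def toLin (D : Cochain k A 1) : A →ₗ[k] A where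
  toFun v := D fun _ => v
  map_add' := one_add D
  map_smul' := one_smul' D

lemma act_apply' {n : ℕ} (D : Cochain k A 1) (f : Cochain k A n) (x : Fin n → A) :
    act k A n D f x = toLin D (f x) - ∑ i, f (update x i (toLin D (x i))) :=
  act_apply D f x

lemma act_one (D D' : Cochain k A 1) (v : A) :
    toLin (act k A 1 D D') v = toLin D (toLin D' v) - toLin D' (toLin D v) := by
  change act k A 1 D D' (fun _ => v) = _
  rw [act_apply']
  simp only [Finset.univ_unique, Finset.sum_singleton,
    Function.update_eq_const_of_subsingleton]
  rfl

lemma act_self (D : Cochain k A 1) : act k A 1 D D = 0 := by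
  ext x
  have hx : x = fun _ => x 0 := by ext i; rw [Subsingleton.elim i 0]
  rw [hx]
  change toLin (act k A 1 D D) (x 0) = 0
  rw [act_one, sub_self]

lemma act_leibniz {n : ℕ} (D D' : Cochain k A 1) (f : Cochain k A n) :
    act k A n D (act k A n D' f) =
      act k A n (act k A 1 D D') f + act k A n D' (act k A n D f) := by
  ext x
  simp only [act_apply', Cochain.add_apply, map_sub, map_sum, act_one]
  have sub : ∀ i : Fin n, ∀ v w : A, f (update x i (v - w)) =
      f (update x i v) - f (update x i w) := by
    intro i v w
    rw [eq_sub_iff_add_eq, ← Cochain.map_update_add, sub_add_cancel]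
  simp only [sub, Finset.sum_sub_distrib]
  have key : ∀ E E' : A →ₗ[k] A,
      ∑ i, ∑ j, f (update (update x i (E (x i))) j (E' (update x i (E (x i)) j))) =
      ∑ i, f (update x i (E' (E (x i)))) +
      ∑ i, ∑ j ∈ Finset.univ.erase i, f (update (update x i (E (x i))) j (E' (x j))) := by
    intro E E'
    rw [← Finset.sum_add_distrib]
    refine Finset.sum_congr rfl fun i _ => ?_
    rw [← Finset.add_sum_erase _ _ (Finset.mem_univ i)]
    congr 1
    · simp
    · refine Finset.sum_congr rfl fun j hj => ?_
      rw [update_of_ne (Finset.ne_of_mem_erase hj)]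
  have comm : ∑ i, ∑ j ∈ Finset.univ.erase i,
        f (update (update x i (toLin D (x i))) j (toLin D' (x j))) =
      ∑ i, ∑ j ∈ Finset.univ.erase i,
        f (update (update x i (toLin D' (x i))) j (toLin D (x j))) := by
    have : ∀ F : Fin n → Fin n → A, ∑ i, ∑ j ∈ Finset.univ.erase i, F i j =
        ∑ i, ∑ j, if j ≠ i then F i j else 0 := by
      intro F
      refine Finset.sum_congr rfl fun i _ => ?_
      rw [← Finset.sum_filter]
      refine Finset.sum_congr ?_ fun _ _ => rfl
      ext; simp
    rw [this, this, Finset.sum_comm]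
    refine Finset.sum_congr rfl fun i _ => Finset.sum_congr rfl fun j _ => ?_
    by_cases h : i = j
    · simp [h]
    · rw [if_pos h, if_pos (Ne.symm h), update_comm (Ne.symm h)]
  rw [key, key, comm]
  abel

/-- Cocycles of degree one are derivations. -/
lemma toLin_mul {D : Cochain k A 1} (hD : D ∈ Z k A 1) (v w : A) :
    toLin D (v * w) = v * toLin D w + toLin D v * w := by
  have h : d k A 1 D ![v, w] = 0 := by
    have : d k A 1 D = 0 := hD
    rw [this]; rfl
  rw [d_apply] at h
  have e1 : Fin.tail ![v, w] = fun _ => w := by ext i; fin_cases i; rfl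
  have e2 : Fin.init ![v, w] = fun _ => v := by ext i; fin_cases i; rfl
  have e3 : Fin.contractNth (Fin.castSucc 0) (· * ·) ![v, w] = fun _ => v * w := by
    ext i; fin_cases i; rfl
  have e4 : (![v, w] : Fin 2 → A) (Fin.last 1) = w := rfl
  simp only [Finset.univ_unique, Fin.default_eq_zero, Finset.sum_singleton] at h
  rw [e1, e2, e3, e4] at h
  simp at h
  change v * D (fun _ => w) + - D (fun _ => v * w) + D (fun _ => v) * w = 0 at h
  change D (fun _ => v * w) = v * D (fun _ => w) + D (fun _ => v) * w
  rw [← sub_eq_zero, ← neg_eq_zero, ← h]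
  abel

lemma d_act {n : ℕ} {D : Cochain k A 1} (hD : D ∈ Z k A 1) (f : Cochain k A n) :
    d k A n (act k A n D f) = act k A (n + 1) D (d k A n f) := by
  ext x
  rw [act_apply', d_apply, d_apply]
  simp only [d_apply, act_apply', map_add, map_sum, map_smul, toLin_mul hD,
    Finset.sum_add_distrib, ← Finset.smul_sum]
  set E := toLin D
  have h1 : ∑ i, (update x i (E (x i))) 0 * f (Fin.tail (update x i (E (x i)))) =
      E (x 0) * f (Fin.tail x) +
        x 0 * ∑ i, f (update (Fin.tail x) i (E (Fin.tail x i))) := by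
    rw [Fin.sum_univ_succ, Finset.mul_sum]
    refine congrArg₂ _ ?_ ?_
    · simp
    · refine Finset.sum_congr rfl fun i _ => ?_
      rw [update_of_ne (Fin.succ_ne_zero i).symm, Fin.tail_update_succ]
      rfl
  have h3 : ∑ i, f (Fin.init (update x i (E (x i)))) * (update x i (E (x i))) (Fin.last n) =
      (∑ i, f (update (Fin.init x) i (E (Fin.init x i)))) * x (Fin.last n) +
        f (Fin.init x) * E (x (Fin.last n)) := by
    rw [Fin.sum_univ_castSucc, Finset.sum_mul]
    congr 1
    · refine Finset.sum_congr rfl fun i _ => ?_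
      rw [update_of_ne (Fin.castSucc_ne_last i).symm, Fin.init_update_castSucc]
      rfl
    · simp
  have h2 : ∀ j : Fin n,
      ∑ i, f (Fin.contractNth j.castSucc (· * ·) (update x i (E (x i)))) =
      ∑ i, f (update (Fin.contractNth j.castSucc (· * ·) x) i
        (E (Fin.contractNth j.castSucc (· * ·) x i))) := by
    intro j
    set y := Fin.contractNth j.castSucc (· * ·) x with hy
    have hyj : y j = x j.castSucc * x j.succ :=
      Fin.contractNth_apply_of_eq _ _ _ _ rfl
    rw [Fin.sum_univ_succAbove _ j.castSucc, ← Finset.add_sum_erase _ _ (Finset.mem_univ j),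
      ← Finset.add_sum_erase Finset.univ (fun i => f (update y i (E (y i)))) (Finset.mem_univ j),
      ← add_assoc]
    congr 1
    · rw [contractNth_update, if_pos rfl, Fin.succAbove_castSucc_self, contractNth_update,
        if_neg (by simp [Fin.ext_iff]), if_pos rfl, ← Cochain.map_update_add, hyj,
        toLin_mul hD, add_comm]
    · refine Finset.sum_congr rfl fun i hi => ?_
      have hij : i ≠ j := Finset.ne_of_mem_erase hi
      rw [contractNth_update, if_neg (Fin.succAbove_ne _ _), if_neg, ← hy]
      · have e : j.predAbove (j.castSucc.succAbove i) = i := Fin.predAbove_succAbove j i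
        have e2 : y i = x (j.castSucc.succAbove i) :=
          Fin.contractNth_apply_of_ne _ _ _ _ (fun h => hij (Fin.ext h.symm))
        rw [e, e2]
      · rw [← Fin.succAbove_castSucc_self j]
        exact fun h => hij (Fin.succAbove_right_injective h)
  have h2' : ∑ i, ∑ j : Fin n, (-1 : k) ^ ((j : ℕ) + 1) •
        f (Fin.contractNth j.castSucc (· * ·) (update x i (E (x i)))) =
      ∑ j : Fin n, (-1 : k) ^ ((j : ℕ) + 1) •
      ∑ i, f (update (Fin.contractNth j.castSucc (· * ·) x) i
        (E (Fin.contractNth j.castSucc (· * ·) x i))) := by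
    rw [Finset.sum_comm]
    refine Finset.sum_congr rfl fun j _ => ?_
    rw [← h2 j, Finset.smul_sum]
  rw [h1, h2', h3]
  simp only [mul_sub, sub_mul, smul_sub, smul_add, Finset.sum_sub_distrib]
  abel

/-! Insertions of a fixed element, used to see that inner derivations act by zero. -/

section Homotopy

open Finset

/-- insertion of `a` at position `i` in a sequence -/
def sIns (a : A) (i : ℕ) (X : ℕ → A) : ℕ → A := fun l =>
  if l < i then X l else if l = i then a else X (l - 1)

/-- contraction of positions `j`, `j + 1` of a sequence -/
def sCon (j : ℕ) (X : ℕ → A) : ℕ → A := fun l =>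
  if l < j then X l else if l = j then X l * X (l + 1) else X (l + 1)

/-- the faces of the Hochschild differential, for a function of the first `N` entries -/
def sFace (N : ℕ) (F : (ℕ → A) → A) (j : ℕ) (X : ℕ → A) : A :=
  if j = 0 then X 0 * F (fun l => X (l + 1))
  else if j = N + 1 then F X * X N
  else F (sCon (j - 1) X)

lemma neg_one_pow_smul_succ (j : ℕ) (a : A) : (-1 : k) ^ (j + 1) • a = - ((-1 : k) ^ j • a) := by
  rw [pow_succ, mul_neg_one, neg_smul]

lemma d_seq {n : ℕ} (f : Cochain k A n) (X : ℕ → A) :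
    d k A n f (fun l => X l) =
      ∑ j ∈ range (n + 2), (-1 : k) ^ j • sFace n (fun Y => f fun l => Y l) j X := by
  rw [sum_range_succ, sum_range_succ', d_apply, Finset.sum_range]
  rw [add_comm (X _ * _) (∑ _, _)]
  congr 1
  · congr 1
    · refine Finset.sum_congr rfl fun j _ => ?_
      have h1 : ¬ ((j : ℕ) + 1 = n + 1) := by have := j.2; omega
      simp only [sFace, h1, Nat.succ_ne_zero, if_false, Nat.add_sub_cancel]
      congr 2
    · simp [sFace]
      rfl
  · simp [sFace]
    rfl

lemma double_sum (N : ℕ) (G H : ℕ → ℕ → A) (P Q : ℕ → A)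
    (h1 : ∀ i j, j < i → i ≤ N → G i j = H (i - 1) j)
    (h2 : ∀ i j, i + 1 < j → j ≤ N + 1 → G i j = H i (j - 1))
    (h3 : ∀ i, i ≤ N → G i i = P i) (h4 : ∀ i, i ≤ N → G i (i + 1) = Q i) :
    ∑ i ∈ range (N + 1), ∑ j ∈ range (N + 2), (-1 : k) ^ (i + j) • G i j =
      ∑ i ∈ range (N + 1), (P i - Q i) -
        ∑ i ∈ range N, ∑ j ∈ range (N + 1), (-1 : k) ^ (i + j) • H i j := by
  have e : ∀ i ∈ range (N + 1), ∀ j ∈ range (N + 2), (-1 : k) ^ (i + j) • G i j =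
      (if j < i then (-1 : k) ^ (i + j) • H (i - 1) j else 0) +
      (if i + 1 < j then (-1 : k) ^ (i + j) • H i (j - 1) else 0) +
      ((if j = i then P i else 0) - (if j = i + 1 then Q i else 0)) := by
    intro i hi j hj
    rw [mem_range] at hi hj
    rcases lt_trichotomy j i with h | h | h
    · rw [if_pos h, if_neg (by omega), if_neg (by omega), if_neg (by omega),
        h1 i j h (by omega)]; simp
    · subst h
      rw [if_neg (by omega), if_neg (by omega), if_pos rfl, if_neg (by omega), h3 j (by omega),
        Even.neg_one_pow ⟨j, rfl⟩]; simp
    · by_cases h' : j = i + 1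
      · subst h'
        rw [if_neg (by omega), if_neg (by omega), if_neg (by omega), if_pos rfl, h4 i (by omega),
          Odd.neg_one_pow ⟨i, by ring⟩]; simp
      · rw [if_neg (by omega), if_pos (by omega), if_neg (by omega), if_neg h',
          h2 i j (by omega) (by omega)]; simp
  rw [Finset.sum_congr rfl fun i hi => Finset.sum_congr rfl (e i hi)]
  simp only [Finset.sum_add_distrib, Finset.sum_sub_distrib]
  have a1 : ∑ i ∈ range (N + 1), ∑ j ∈ range (N + 2),
      (if j < i then (-1 : k) ^ (i + j) • H (i - 1) j else 0) =
      - ∑ i ∈ range N, ∑ j ∈ range (N + 1),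
        (if j ≤ i then (-1 : k) ^ (i + j) • H i j else 0) := by
    rw [sum_range_succ', ← Finset.sum_neg_distrib]
    simp only [Nat.not_lt_zero, if_false, sum_const_zero, add_zero]
    refine Finset.sum_congr rfl fun i hi => ?_
    rw [mem_range] at hi
    rw [sum_range_succ, if_neg (by omega), add_zero, ← Finset.sum_neg_distrib]
    refine Finset.sum_congr rfl fun j hj => ?_
    simp only [Nat.lt_succ_iff, Nat.add_sub_cancel]
    split_ifs
    · rw [add_right_comm, neg_one_pow_smul_succ]
    · simp
  have a2 : ∑ i ∈ range (N + 1), ∑ j ∈ range (N + 2),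
      (if i + 1 < j then (-1 : k) ^ (i + j) • H i (j - 1) else 0) =
      - ∑ i ∈ range N, ∑ j ∈ range (N + 1),
        (if j ≤ i then 0 else (-1 : k) ^ (i + j) • H i j) := by
    rw [sum_range_succ, ← Finset.sum_neg_distrib]
    rw [Finset.sum_eq_zero (s := range (N + 2)) fun j hj => by
      rw [mem_range] at hj; rw [if_neg (by omega)], add_zero]
    refine Finset.sum_congr rfl fun i hi => ?_
    rw [sum_range_succ', if_neg (by omega), add_zero, ← Finset.sum_neg_distrib]
    refine Finset.sum_congr rfl fun j hj => ?_
    simp only [Nat.add_sub_cancel]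
    by_cases h : j ≤ i
    · rw [if_neg (by omega), if_pos h, neg_zero]
    · rw [if_pos (by omega), if_neg h, ← add_assoc, neg_one_pow_smul_succ]
  have a3 : ∑ i ∈ range (N + 1), ∑ j ∈ range (N + 2), (if j = i then P i else 0) =
      ∑ i ∈ range (N + 1), P i := by
    refine Finset.sum_congr rfl fun i hi => ?_
    rw [mem_range] at hi
    rw [Finset.sum_ite_eq' (range (N + 2)) i, if_pos (by rw [mem_range]; omega)]
  have a4 : ∑ i ∈ range (N + 1), ∑ j ∈ range (N + 2), (if j = i + 1 then Q i else 0) =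
      ∑ i ∈ range (N + 1), Q i := by
    refine Finset.sum_congr rfl fun i hi => ?_
    rw [mem_range] at hi
    rw [Finset.sum_ite_eq' (range (N + 2)) (i + 1), if_pos (by rw [mem_range]; omega)]
  have a5 : ∑ i ∈ range N, ∑ j ∈ range (N + 1), (-1 : k) ^ (i + j) • H i j =
      ∑ i ∈ range N, ∑ j ∈ range (N + 1),
        (if j ≤ i then (-1 : k) ^ (i + j) • H i j else 0) +
      ∑ i ∈ range N, ∑ j ∈ range (N + 1),
        (if j ≤ i then 0 else (-1 : k) ^ (i + j) • H i j) := by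
    rw [← Finset.sum_add_distrib]
    refine Finset.sum_congr rfl fun i _ => ?_
    rw [← Finset.sum_add_distrib]
    refine Finset.sum_congr rfl fun j _ => ?_
    split_ifs <;> simp
  rw [a1, a2, a3, a4, a5]
  abel

/-- insertion of `a` at position `i` in a tuple -/
def tIns {n : ℕ} (a : A) (i : ℕ) (x : Fin n → A) : Fin (n + 1) → A := fun l =>
  if h : (l : ℕ) < i ∧ (l : ℕ) < n then x ⟨l, h.2⟩ else if (l : ℕ) = i then a
  else if h' : (l : ℕ) - 1 < n then x ⟨l - 1, h'⟩ else 0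

lemma tIns_seq {n : ℕ} (a : A) (i : ℕ) (hi : i ≤ n) (X : ℕ → A) (l : Fin (n + 1)) :
    tIns a i (fun l : Fin n => X l) l = sIns a i X l := by
  have := l.2
  unfold tIns sIns
  split_ifs <;> first | rfl | omega

lemma tIns_update {n : ℕ} (a : A) (i : ℕ) (hi : i ≤ n) (x : Fin n → A) (j : Fin n) :
    ∃ l : Fin (n + 1), ∀ v, tIns a i (update x j v) = update (tIns a i x) l v := by
  have hj := j.2
  refine ⟨⟨if (j : ℕ) < i then j else j + 1, by split_ifs <;> omega⟩, fun v => ?_⟩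
  ext l
  have hl := l.2
  simp only [tIns, update_apply, Fin.ext_iff]
  split_ifs <;> first | rfl | omega

variable (a : A)

/-- the contraction of a cochain with an element -/
def contr {n : ℕ} (f : Cochain k A (n + 1)) : Cochain k A n :=
  Cochain.ofFun (fun x => ∑ i ∈ range (n + 1), (-1 : k) ^ i • f (tIns a i x)) (by
    intro x j
    refine ⟨fun v w => ?_, fun c v => ?_⟩
    · rw [← Finset.sum_add_distrib]
      refine Finset.sum_congr rfl fun i hi => ?_
      rw [mem_range] at hi
      obtain ⟨l, h⟩ := tIns_update a i (by omega) x j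
      rw [h, h, h, Cochain.map_update_add, smul_add]
    · rw [Finset.smul_sum]
      refine Finset.sum_congr rfl fun i hi => ?_
      rw [mem_range] at hi
      obtain ⟨l, h⟩ := tIns_update a i (by omega) x j
      rw [h, h, Cochain.map_update_smul, smul_comm])

lemma contr_seq {n : ℕ} (f : Cochain k A (n + 1)) (X : ℕ → A) :
    contr a f (fun l => X l) =
      ∑ i ∈ range (n + 1), (-1 : k) ^ i • f (fun l => sIns a i X l) := by
  change ∑ i ∈ range (n + 1), (-1 : k) ^ i • f (tIns a i fun l : Fin n => X l) = _
  refine Finset.sum_congr rfl fun i hi => ?_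
  rw [mem_range] at hi
  congr 2
  ext l
  exact tIns_seq a i (by omega) X l

lemma homotopy {n : ℕ} (f : Cochain k A (n + 1)) (hf : f ∈ Z k A (n + 1))
    (D : Cochain k A 1) (hD : ∀ v, toLin D v = v * a - a * v) :
    act k A (n + 1) D f = - d k A n (contr a f) := by
  ext x
  obtain ⟨X, rfl⟩ : ∃ X : ℕ → A, x = fun l : Fin (n + 1) => X l :=
    ⟨fun l => if h : l < n + 1 then x ⟨l, h⟩ else 0, by
      ext l; change x l = dite _ _ _; rw [dif_pos l.2]⟩
  set F : (ℕ → A) → A := fun Y => f fun l => Y l with hFdef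
  have hF : ∀ Y Y' : ℕ → A, (∀ l, l < n + 1 → Y l = Y' l) → F Y = F Y' := by
    intro Y Y' h
    exact congrArg f (funext fun l => h l l.2)
  have hFa : ∀ (Y : ℕ → A) (i : ℕ) (v w : A), i < n + 1 →
      F (update Y i (v - w)) = F (update Y i v) - F (update Y i w) := by
    intro Y i v w hi
    have e : ∀ u, F (update Y i u) = f (update (fun l : Fin (n + 1) => Y l) ⟨i, hi⟩ u) := by
      intro u
      refine congrArg f (funext fun l => ?_)
      simp only [update_apply, Fin.ext_iff]
    rw [e, e, e, eq_sub_iff_add_eq, ← Cochain.map_update_add, sub_add_cancel]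
  set P : ℕ → A := fun i => if i = 0 then a * F X else F (update X (i - 1) (X (i - 1) * a)) with hP
  set Q : ℕ → A := fun i => if i = n + 1 then F X * a else F (update X i (a * X i)) with hQ
  have main := double_sum (k := k) (n + 1) (fun i j => sFace (n + 1) F j (sIns a i X))
    (fun i j => sFace n (fun Y => F (sIns a i Y)) j X) P Q ?_ ?_ ?_ ?_
  · have z : ∀ i, ∑ j ∈ range (n + 1 + 2), (-1 : k) ^ (i + j) •
        sFace (n + 1) F j (sIns a i X) = 0 := by
      intro i
      simp only [pow_add, mul_smul, ← Finset.smul_sum]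
      rw [← d_seq f (sIns a i X)]
      have : d k A (n + 1) f = 0 := hf
      rw [this]; simp
    have w : ∑ i ∈ range (n + 1), ∑ j ∈ range (n + 1 + 1), (-1 : k) ^ (i + j) •
        sFace n (fun Y => F (sIns a i Y)) j X = d k A n (contr a f) (fun l => X l) := by
      rw [d_seq, Finset.sum_comm]
      refine Finset.sum_congr rfl fun j _ => ?_
      simp only [pow_add, mul_comm ((-1 : k) ^ _) ((-1 : k) ^ j), mul_smul, ← Finset.smul_sum]
      congr 1
      unfold sFace
      split_ifs
      all_goals beta_reduce
      · rw [contr_seq a f fun l => X (l + 1), Finset.mul_sum]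
        refine Finset.sum_congr rfl fun i _ => (mul_smul_comm _ _ _).symm
      · rw [contr_seq a f X, Finset.sum_mul]
        refine Finset.sum_congr rfl fun i _ => (smul_mul_assoc _ _ _).symm
      · rw [contr_seq a f (sCon (j - 1) X)]
    rw [Finset.sum_eq_zero fun i _ => z i, w] at main
    rw [Cochain.neg_apply]
    have main' := (sub_eq_zero.mp main.symm).symm
    rw [main', act_apply', Finset.sum_sub_distrib, sum_range_succ' P, sum_range_succ Q, hD]
    have p0 : P 0 = a * F X := if_pos rfl
    have qn : Q (n + 1) = F X * a := if_pos rfl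
    have s1 : ∑ i : Fin (n + 1), f (update (fun l : Fin (n + 1) => X l) i (toLin D (X i))) =
        ∑ i ∈ range (n + 1), P (i + 1) - ∑ i ∈ range (n + 1), Q i := by
      rw [← Finset.sum_sub_distrib, Finset.sum_range]
      refine Finset.sum_congr rfl fun i _ => ?_
      have hi := i.2
      have p1 : P (i + 1) = F (update X i (X i * a)) := if_neg (by omega)
      have q1 : Q i = F (update X i (a * X i)) := if_neg (by omega)
      rw [p1, q1, ← hFa X i _ _ hi, hD]
      refine congrArg f (funext fun l => ?_)
      simp only [update_apply, Fin.ext_iff]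
    rw [s1, p0, qn]
    change F X * a - a * F X - _ = _
    abel
  · intro i j hji hi
    show sFace (n + 1) F j (sIns a i X) = sFace n (fun Y => F (sIns a (i - 1) Y)) j X
    unfold sFace
    split_ifs with c1 c2 c3 c3
    · congr 1
      · simp only [sIns, if_pos (show 0 < i by omega)]
      · refine hF (fun l => sIns a i X (l + 1)) (sIns a (i - 1) fun l => X (l + 1)) ?_
        intro l hl
        simp only [sIns]
        split_ifs <;> first | rfl | omega | (congr 1; omega)
    · omega
    · omega
    · omega
    · refine hF _ _ fun l hl => ?_
      simp only [sIns, sCon]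
      split_ifs <;> first | rfl | omega | (congr 1; omega) | (congr 2 <;> omega)
  · intro i j hji hi
    show sFace (n + 1) F j (sIns a i X) = sFace n (fun Y => F (sIns a i Y)) (j - 1) X
    unfold sFace
    split_ifs with c1 c2 c3 c3 c4 c5 c6
    all_goals first | omega | skip
    · congr 1
      simp only [sIns]
      split_ifs <;> first | rfl | omega
    · refine hF _ _ fun l hl => ?_
      simp only [sIns, sCon]
      split_ifs <;> first | rfl | omega | (congr 1; omega) | (congr 2 <;> omega)
  · intro i hi
    show sFace (n + 1) F i (sIns a i X) = P i
    unfold sFace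
    simp only [hP]
    split_ifs with c1 c2
    · subst c1
      congr 1
    · omega
    · refine hF _ _ fun l hl => ?_
      simp only [sIns, sCon, update_apply]
      split_ifs <;> first | rfl | omega | (congr 1; omega) | (congr 2 <;> omega) | skip
  · intro i hi
    show sFace (n + 1) F (i + 1) (sIns a i X) = Q i
    unfold sFace
    simp only [hQ]
    rw [if_neg (Nat.succ_ne_zero i)]
    split_ifs
    all_goals first | omega | skip
    · congr 1
      · refine hF _ _ fun l hl => ?_
        simp only [sIns]
        split_ifs <;> first | rfl | omega
      · simp only [sIns]
        split_ifs <;> first | rfl | omega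
    · refine hF _ _ fun l hl => ?_
      simp only [sIns, sCon, update_apply]
      split_ifs <;> first | rfl | omega | (congr 1; omega) | (congr 2 <;> omega) | skip

end Homotopy

lemma act_mem_Z {n : ℕ} {D : Cochain k A 1} (hD : D ∈ Z k A 1) {f : Cochain k A n}
    (hf : f ∈ Z k A n) : act k A n D f ∈ Z k A n := by
  have hf' : d k A n f = 0 := hf
  change d k A n _ = 0
  rw [d_act hD, hf', map_zero]

lemma act_mem_B {n : ℕ} {D : Cochain k A 1} (hD : D ∈ Z k A 1) {f : Cochain k A n}
    (hf : f ∈ B k A n) : act k A n D f ∈ B k A n := by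
  cases n with
  | zero =>
    have : f = 0 := hf
    rw [this, map_zero]
    exact Submodule.zero_mem _
  | succ n =>
    obtain ⟨g, rfl⟩ := hf
    exact ⟨act k A n D g, d_act hD g⟩

lemma act_inner_mem_B {n : ℕ} {D : Cochain k A 1} (hD : D ∈ B k A 1) {f : Cochain k A n}
    (hf : f ∈ Z k A n) : act k A n D f ∈ B k A n := by
  obtain ⟨c, rfl⟩ := hD
  have hD : ∀ v, toLin (d k A 0 c) v = v * c ![] - c ![] * v := by
    intro v
    change d k A 0 c (fun _ => v) = _
    rw [d_apply]
    have e1 : (Fin.tail fun _ : Fin 1 => v) = ![] := Subsingleton.elim _ _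
    have e2 : (Fin.init fun _ : Fin 1 => v) = ![] := Subsingleton.elim _ _
    rw [e1, e2]
    simp [sub_eq_add_neg]
  cases n with
  | zero =>
    change act k A 0 _ f = 0
    ext x
    have h : d k A 0 f (fun _ => c ![]) = 0 := by
      have : d k A 0 f = 0 := hf
      rw [this]; rfl
    rw [d_apply] at h
    have e1 : (Fin.tail fun _ : Fin 1 => c ![]) = x := Subsingleton.elim _ _
    have e2 : (Fin.init fun _ : Fin 1 => c ![]) = x := Subsingleton.elim _ _
    rw [e1, e2] at h
    simp only [Finset.univ_eq_empty, Finset.sum_empty, add_zero, zero_add, pow_one, neg_smul,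
      one_smul, ← sub_eq_add_neg] at h
    rw [act_apply', hD, Cochain.zero_apply]
    simp only [Finset.univ_eq_empty, Finset.sum_empty, sub_zero]
    rw [← neg_sub, h, neg_zero]
  | succ n =>
    rw [homotopy (c ![]) f hf _ hD]
    exact Submodule.neg_mem _ ⟨_, rfl⟩

variable (k A) in
/-- The bracket of `HH¹` on `HHⁿ`, induced by the Gerstenhaber bracket of cocycles. -/
def hhBracket (n : ℕ) : HH k A 1 →ₗ[k] HH k A n →ₗ[k] HH k A n :=
  Submodule.liftQ _
    { toFun := fun D => Submodule.liftQ _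
        { toFun := fun f => HH.mk k A n ⟨act k A n D f, act_mem_Z D.2 f.2⟩
          map_add' := fun f g => by
            rw [← map_add]; congr 1; ext1; exact map_add (act k A n D.1) f.1 g.1
          map_smul' := fun c f => by
            rw [RingHom.id_apply, ← map_smul]; congr 1; ext1
            exact map_smul (act k A n D.1) c f.1 }
        (fun f hf => (Submodule.Quotient.mk_eq_zero _).2 (act_mem_B D.2 hf))
      map_add' := fun D D' => by
        refine Submodule.linearMap_qext _ (LinearMap.ext fun f => ?_)
        change HH.mk k A n _ = HH.mk k A n _ + HH.mk k A n _
        rw [← map_add]; congr 1; ext1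
        exact LinearMap.map_add₂ (act k A n) D.1 D'.1 f.1
      map_smul' := fun c D => by
        refine Submodule.linearMap_qext _ (LinearMap.ext fun f => ?_)
        change HH.mk k A n _ = c • HH.mk k A n _
        rw [← map_smul]; congr 1; ext1
        exact LinearMap.map_smul₂ (act k A n) c D.1 f.1 }
    (fun D hD => by
      refine Submodule.linearMap_qext _ (LinearMap.ext fun f => ?_)
      exact (Submodule.Quotient.mk_eq_zero _).2 (act_inner_mem_B hD f.2))

lemma HH.mk_surjective (n : ℕ) : Function.Surjective (HH.mk k A n) :=
  Submodule.mkQ_surjective _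

/-- `HH¹(A)` is a Lie algebra under the Gerstenhaber bracket. -/
instance : LieRing (HH k A 1) where
  bracket x y := hhBracket k A 1 x y
  add_lie x y z := LinearMap.map_add₂ _ x y z
  lie_add x y z := map_add _ y z
  lie_self x := by
    obtain ⟨D, rfl⟩ := HH.mk_surjective 1 x
    change HH.mk k A 1 _ = 0
    rw [← map_zero (HH.mk k A 1)]; congr 1; ext1
    exact act_self D.1
  leibniz_lie x y z := by
    obtain ⟨D, rfl⟩ := HH.mk_surjective 1 x
    obtain ⟨D', rfl⟩ := HH.mk_surjective 1 y
    obtain ⟨f, rfl⟩ := HH.mk_surjective 1 z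
    change HH.mk k A 1 _ = HH.mk k A 1 _ + HH.mk k A 1 _
    rw [← map_add]; congr 1; ext1
    exact act_leibniz D.1 D'.1 f.1

instance : LieAlgebra k (HH k A 1) where
  lie_smul c x y := map_smul (hhBracket k A 1 x) c y

/-- `HHⁿ(A)` is a Lie module over `HH¹(A)` under the Gerstenhaber bracket. -/
instance (n : ℕ) : LieRingModule (HH k A 1) (HH k A n) where
  bracket x y := hhBracket k A n x y
  add_lie x y z := LinearMap.map_add₂ _ x y z
  lie_add x y z := map_add _ y z
  leibniz_lie x y z := by
    obtain ⟨D, rfl⟩ := HH.mk_surjective 1 x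
    obtain ⟨D', rfl⟩ := HH.mk_surjective 1 y
    obtain ⟨f, rfl⟩ := HH.mk_surjective n z
    change HH.mk k A n _ = HH.mk k A n _ + HH.mk k A n _
    rw [← map_add]; congr 1; ext1
    exact act_leibniz D.1 D'.1 f.1

instance (n : ℕ) : LieModule k (HH k A 1) (HH k A n) where
  smul_lie c x y := LinearMap.map_smul₂ _ c x y
  lie_smul c x y := map_smul (hhBracket k A n x) c y

lemma lie_mk_mk (n : ℕ) (D : Z k A 1) (f : Z k A n) :
    ⁅HH.mk k A 1 D, HH.mk k A n f⁆ =
      HH.mk k A n ⟨gbracket (add_comm n 1) D.1 f.1, act_mem_Z D.2 f.2⟩ := rfl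

end Hochschild

namespace RadSq

/-- The type of all paths of a quiver. -/
def QPath (V : Type*) [Quiver V] : Type _ := Σ i j : V, Quiver.Path i j

namespace QPath

variable {V : Type*} [Quiver V]

/-- The source of a path. -/
def source (p : QPath V) : V := p.1

/-- The end of a path. -/
def target (p : QPath V) : V := p.2.1

/-- The number of arrows of a path. -/
def length (p : QPath V) : ℕ := p.2.2.length

/-- The trivial path at a vertex. -/
def nil (i : V) : QPath V := ⟨i, i, Quiver.Path.nil⟩

/-- An arrow as a path of length one. -/
def ofArrow {i j : V} (a : i ⟶ j) : QPath V := ⟨i, j, a.toPath⟩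

/-- Concatenation: first `p`, then `q`. -/
def comp (p q : QPath V) (h : p.target = q.source) : QPath V :=
  ⟨p.1, q.2.1, p.2.2.comp (q.2.2.cast h.symm rfl)⟩

lemma comp_assoc (p q r : QPath V) (h : p.target = q.source) (h' : q.target = r.source) :
    (p.comp q h).comp r h' = p.comp (q.comp r h') h := by
  obtain ⟨i, j, p⟩ := p
  obtain ⟨j', l, q⟩ := q
  obtain ⟨l', m, r⟩ := r
  change j = j' at h
  change l = l' at h'
  subst h h'
  exact congrArg (fun t => (⟨i, m, t⟩ : QPath V)) (Quiver.Path.comp_assoc p q r)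

lemma comp_nil (p : QPath V) (i : V) (h : p.target = i) : p.comp (nil i) h = p := by
  subst h
  rfl

lemma nil_comp (p : QPath V) (i : V) (h : i = p.source) : (nil i).comp p h = p := by
  subst h
  obtain ⟨i, j, p⟩ := p
  exact congrArg (fun t => (⟨i, j, t⟩ : QPath V)) (Quiver.Path.nil_comp p)

end QPath

/-- The path algebra `kQ`: the vector space on all paths of the quiver, the product of two paths
being their concatenation or zero. -/
def PathAlgebra (k : Type*) [Field k] (V : Type*) [Quiver V] : Type _ := QPath V →₀ k

namespace PathAlgebra

variable (k : Type*) [Field k] {V : Type*} [Quiver V]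

instance : AddCommGroup (PathAlgebra k V) := inferInstanceAs (AddCommGroup (QPath V →₀ k))

instance : Module k (PathAlgebra k V) := inferInstanceAs (Module k (QPath V →₀ k))

/-- The basis element of a path. -/
def of (p : QPath V) : PathAlgebra k V := Finsupp.single p 1

open Classical in
/-- The product of two paths: concatenation or zero. -/
def mulPath (p q : QPath V) : PathAlgebra k V :=
  if h : p.target = q.source then of k (p.comp q h) else 0

variable (V) in
/-- The bilinear extension of the product of paths. -/
def mulBilin : PathAlgebra k V →ₗ[k] PathAlgebra k V →ₗ[k] PathAlgebra k V :=
  Finsupp.linearCombination k fun p => Finsupp.linearCombination k fun q => mulPath k p q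

lemma mulBilin_of (p q : QPath V) : mulBilin k V (of k p) (of k q) = mulPath k p q := by
  unfold mulBilin of
  erw [Finsupp.linearCombination_single, one_smul, Finsupp.linearCombination_single, one_smul]

variable {k}

lemma induction {P : PathAlgebra k V → Prop} (x : PathAlgebra k V) (h0 : P 0)
    (hadd : ∀ x y, P x → P y → P (x + y)) (hof : ∀ (c : k) p, P (c • of k p)) : P x := by
  refine Finsupp.induction_linear (motive := P) x h0 hadd fun p c => ?_
  have := hof c p
  rwa [show c • of k p = Finsupp.single p c from Finsupp.smul_single_one p c] at this

lemma mulBilin_assoc (x y z : PathAlgebra k V) :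
    mulBilin k V (mulBilin k V x y) z = mulBilin k V x (mulBilin k V y z) := by
  induction x using induction with
  | h0 => simp
  | hadd x x' hx hx' => simp only [map_add, LinearMap.add_apply, hx, hx']
  | hof c p =>
    induction y using induction with
    | h0 => simp
    | hadd x x' hx hx' => simp only [map_add, LinearMap.add_apply, hx, hx']
    | hof c' q =>
      induction z using induction with
      | h0 => simp
      | hadd x x' hx hx' => simp only [map_add, hx, hx']
      | hof c'' r =>
        simp only [map_smul, LinearMap.smul_apply, mulBilin_of]
        congr 3
        unfold mulPath
        by_cases h : p.target = q.source <;> by_cases h' : q.target = r.source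
        · rw [dif_pos h, dif_pos h', mulBilin_of, mulBilin_of, mulPath, mulPath,
            dif_pos (show (p.comp q h).target = r.source from h'),
            dif_pos (show p.target = (q.comp r h').source from h), QPath.comp_assoc]
        · rw [dif_pos h, dif_neg h', mulBilin_of, mulPath,
            dif_neg (show ¬ (p.comp q h).target = r.source from h'), map_zero]
        · rw [dif_neg h, dif_pos h', mulBilin_of, mulPath,
            dif_neg (show ¬ p.target = (q.comp r h').source from h), map_zero,
            LinearMap.zero_apply]
        · rw [dif_neg h, dif_neg h', map_zero, map_zero, LinearMap.zero_apply]

variable [Fintype V]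

lemma one_mulBilin (x : PathAlgebra k V) :
    mulBilin k V (∑ i, of k (QPath.nil i)) x = x := by
  classical
  induction x using induction with
  | h0 => simp
  | hadd x x' hx hx' => rw [map_add, hx, hx']
  | hof c p =>
    rw [map_smul, map_sum, LinearMap.sum_apply, Finset.sum_eq_single p.source]
    · rw [mulBilin_of, mulPath, dif_pos (show (QPath.nil p.source).target = p.source from rfl),
        QPath.nil_comp _ _ rfl]
    · intro i _ hi
      rw [mulBilin_of, mulPath, dif_neg (show ¬ (QPath.nil i).target = p.source from hi)]
    · simp

lemma mulBilin_one (x : PathAlgebra k V) :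
    mulBilin k V x (∑ i, of k (QPath.nil i)) = x := by
  classical
  induction x using induction with
  | h0 => simp
  | hadd x x' hx hx' => rw [map_add, LinearMap.add_apply, hx, hx']
  | hof c p =>
    rw [map_smul, LinearMap.smul_apply, map_sum, Finset.sum_eq_single p.target]
    · rw [mulBilin_of, mulPath, dif_pos (show p.target = (QPath.nil p.target).source from rfl),
        QPath.comp_nil _ _ rfl]
    · intro i _ hi
      rw [mulBilin_of, mulPath,
        dif_neg (show ¬ p.target = (QPath.nil i).source from fun h => hi h.symm)]
    · simp

instance : Ring (PathAlgebra k V) :=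
  { (inferInstance : AddCommGroup (PathAlgebra k V)) with
    mul := fun x y => mulBilin k V x y
    one := ∑ i, of k (QPath.nil i)
    mul_assoc := mulBilin_assoc
    one_mul := one_mulBilin
    mul_one := mulBilin_one
    zero_mul := fun x => LinearMap.map_zero₂ _ x
    mul_zero := fun x => map_zero _
    left_distrib := fun x y z => map_add _ y z
    right_distrib := fun x y z => LinearMap.map_add₂ _ x y z }

instance : Algebra k (PathAlgebra k V) :=
  Algebra.ofModule (fun c x y => LinearMap.map_smul₂ (mulBilin k V) c x y)
    (fun c x y => map_smul (mulBilin k V x) c y)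

lemma of_mul_of (p q : QPath V) : of k p * of k q = mulPath k p q := mulBilin_of k p q

end PathAlgebra

/-- The ideal generated by the paths of length two. -/
def radSqIdeal (k : Type*) [Field k] (V : Type*) [Quiver V] [Fintype V] :
    TwoSidedIdeal (PathAlgebra k V) :=
  TwoSidedIdeal.span {x | ∃ p : QPath V, p.length = 2 ∧ x = PathAlgebra.of k p}

/-- The monomial algebra with radical square zero `kQ / ⟨Q₂⟩`. -/
def RadSqZero (k : Type*) [Field k] (V : Type*) [Quiver V] [Fintype V] : Type _ :=
  (radSqIdeal k V).ringCon.Quotient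

namespace RadSqZero

variable (k : Type*) [Field k] {V : Type*} [Quiver V] [Fintype V]

instance : Ring (RadSqZero k V) := inferInstanceAs (Ring (radSqIdeal k V).ringCon.Quotient)

instance : Algebra k (RadSqZero k V) :=
  inferInstanceAs (Algebra k (radSqIdeal k V).ringCon.Quotient)

/-- The class of an arrow. -/
def arrow {i j : V} (a : i ⟶ j) : RadSqZero k V :=
  (radSqIdeal k V).ringCon.mk' (PathAlgebra.of k (QPath.ofArrow a))

end RadSqZero

/-- The two loops quiver: one vertex and two loops. -/
abbrev TwoLoops : Type := Quiver.SingleObj (Fin 2)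

/-- The algebra `A = ℂQ / ⟨Q₂⟩` of the two loops quiver `Q`. -/
abbrev TwoLoopsAlgebra : Type := RadSqZero ℂ TwoLoops

/-- The classes of the two loops in `A`. -/
def loop (i : Fin 2) : TwoLoopsAlgebra := RadSqZero.arrow ℂ (Quiver.SingleObj.toHom i)


open scoped TensorProduct DirectSum

/-- `sl₂(ℂ)` -/
abbrev Sl2 : Type := LieAlgebra.SpecialLinear.sl (Fin 2) ℂ

/-- The abelian Lie algebra `ℂ`. -/
instance : LieRing ℂ := LieRing.ofAssociativeRing

/-- The derivation of `ℂ[X₀, X₁]` with `Xⱼ ↦ ∑ᵢ Mᵢⱼ Xᵢ`, that is, the action of the matrix `M`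
on `Sym(ℂ²) = ℂ[X₀, X₁]`. -/
def vecField (M : Matrix (Fin 2) (Fin 2) ℂ) :
    Derivation ℂ (MvPolynomial (Fin 2) ℂ) (MvPolynomial (Fin 2) ℂ) :=
  MvPolynomial.mkDerivation ℂ fun j => ∑ i, M i j • MvPolynomial.X i

lemma vecField_X (M : Matrix (Fin 2) (Fin 2) ℂ) (j : Fin 2) :
    vecField M (MvPolynomial.X j) = ∑ i, M i j • MvPolynomial.X i :=
  MvPolynomial.mkDerivation_X _ _ _

lemma vecField_add (M N : Matrix (Fin 2) (Fin 2) ℂ) :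
    vecField (M + N) = vecField M + vecField N := by
  refine MvPolynomial.derivation_ext fun j => ?_
  simp [vecField_X, add_smul]
  abel

lemma vecField_smul (c : ℂ) (M : Matrix (Fin 2) (Fin 2) ℂ) :
    vecField (c • M) = c • vecField M := by
  refine MvPolynomial.derivation_ext fun j => ?_
  simp only [vecField_X, Derivation.smul_apply, Matrix.smul_apply, smul_eq_mul, mul_smul,
    Finset.smul_sum]

lemma vecField_lie (M N : Matrix (Fin 2) (Fin 2) ℂ) :
    vecField ⁅M, N⁆ = ⁅vecField M, vecField N⁆ := by
  refine MvPolynomial.derivation_ext fun j => ?_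
  simp only [Derivation.commutator_apply, vecField_X, Fin.sum_univ_two, map_add,
    Derivation.map_smul, Ring.lie_def, Matrix.sub_apply, Matrix.mul_apply]
  module

lemma vecField_mem (M : Matrix (Fin 2) (Fin 2) ℂ) (t : ℕ) (p : MvPolynomial (Fin 2) ℂ)
    (hp : p ∈ MvPolynomial.homogeneousSubmodule (Fin 2) ℂ t) :
    vecField M p ∈ MvPolynomial.homogeneousSubmodule (Fin 2) ℂ t := by
  rw [MvPolynomial.mem_homogeneousSubmodule] at hp
  rw [← MvPolynomial.support_sum_monomial_coeff p, map_sum]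
  refine Submodule.sum_mem _ fun s hs => ?_
  have hd : s.degree = t := by
    rw [Finsupp.degree_eq_weight_one]
    exact hp (MvPolynomial.mem_support_iff.1 hs)
  rw [vecField, MvPolynomial.mkDerivation_monomial]
  refine Submodule.smul_mem _ _ (Submodule.sum_mem _ fun i hi => ?_)
  have hi' : s i ≠ 0 := Finsupp.mem_support_iff.1 hi
  have h1 : (MvPolynomial.monomial (s - Finsupp.single i 1) ((s i : ℕ) : ℂ)).IsHomogeneous
      (t - 1) := by
    refine MvPolynomial.isHomogeneous_monomial _ ?_
    have hle : Finsupp.single i 1 ≤ s := by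
      rw [Finsupp.single_le_iff]; omega
    have := congrArg Finsupp.degree (tsub_add_cancel_of_le hle)
    rw [map_add, Finsupp.degree_single, hd] at this
    omega
  have h2 : (∑ l, M l i • (MvPolynomial.X l : MvPolynomial (Fin 2) ℂ)).IsHomogeneous 1 :=
    Submodule.sum_mem (MvPolynomial.homogeneousSubmodule (Fin 2) ℂ 1) fun l _ =>
      Submodule.smul_mem _ _ (MvPolynomial.isHomogeneous_X ℂ l)
  have ht : 1 ≤ t := by
    have : s i ≤ s.degree := Finsupp.le_degree i s
    omega
  have := h1.mul h2
  rwa [Nat.sub_add_cancel ht] at this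

/-- The irreducible `sl₂(ℂ)`-module `V(t)` of dimension `t + 1`, realised as `Sym^t(ℂ²)`: the
homogeneous polynomials of degree `t` in two variables. -/
def V (t : ℕ) : Type := MvPolynomial.homogeneousSubmodule (Fin 2) ℂ t

namespace V

variable (t : ℕ)

instance : AddCommGroup (V t) :=
  inferInstanceAs (AddCommGroup (MvPolynomial.homogeneousSubmodule (Fin 2) ℂ t))

instance : Module ℂ (V t) :=
  inferInstanceAs (Module ℂ (MvPolynomial.homogeneousSubmodule (Fin 2) ℂ t))

instance : LieRingModule Sl2 (V t) where
  bracket M p := ⟨vecField M.1 p.1, vecField_mem M.1 t p.1 p.2⟩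
  add_lie M N p := Subtype.ext <| by
    change vecField (M.1 + N.1) p.1 = vecField M.1 p.1 + vecField N.1 p.1
    rw [vecField_add]; rfl
  lie_add M p q := Subtype.ext <| map_add (vecField M.1) p.1 q.1
  leibniz_lie M N p := Subtype.ext <| by
    change vecField M.1 (vecField N.1 p.1) =
      vecField ⁅M.1, N.1⁆ p.1 + vecField N.1 (vecField M.1 p.1)
    rw [vecField_lie, Derivation.commutator_apply]; abel

instance : LieModule ℂ Sl2 (V t) where
  smul_lie c M p := Subtype.ext <| by
    change vecField (c • M.1) p.1 = c • vecField M.1 p.1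
    rw [vecField_smul]; rfl
  lie_smul c M p := Subtype.ext <| (vecField M.1).map_smul c p.1

/-- `V(t)` as a module over `sl₂(ℂ) × ℂ` through the first projection. -/
instance : LieRingModule (Sl2 × ℂ) (V t) := LieRingModule.compLieHom (V t) (LieHom.fst ℂ Sl2 ℂ)

instance : LieModule ℂ (Sl2 × ℂ) (V t) := LieModule.compLieHom (V t) (LieHom.fst ℂ Sl2 ℂ)

end V

/-- The one-dimensional module `ℂ` over `sl₂(ℂ) × ℂ` on which `sl₂(ℂ)` acts by zero and the element
`(0, 1)` acts by the scalar `s`. -/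
def CMod (_s : ℂ) : Type := ℂ

namespace CMod

variable (s : ℂ)

instance : AddCommGroup (CMod s) := inferInstanceAs (AddCommGroup ℂ)

instance : Module ℂ (CMod s) := inferInstanceAs (Module ℂ ℂ)

instance : LieRingModule (Sl2 × ℂ) (CMod s) where
  bracket x z := (s * x.2) • z
  add_lie x y z := by
    change (s * (x.2 + y.2)) • z = _
    rw [mul_add, add_smul]
  lie_add x y z := smul_add _ _ _
  leibniz_lie x y z := by
    have h : (⁅x, y⁆ : Sl2 × ℂ).2 = 0 := by
      change ⁅x.2, y.2⁆ = 0
      rw [Ring.lie_def, mul_comm, sub_self]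
    change (s * x.2) • (s * y.2) • z = (s * (⁅x, y⁆ : Sl2 × ℂ).2) • z + (s * y.2) • (s * x.2) • z
    rw [h, mul_zero, zero_smul, zero_add, smul_comm]

instance : LieModule ℂ (Sl2 × ℂ) (CMod s) where
  smul_lie c x z := by
    change (s * (c * x.2)) • z = c • (s * x.2) • z
    rw [smul_smul]; congr 1; ring
  lie_smul c x z := smul_comm _ _ _

end CMod

/-- The largest `l` with `n + 1 - 2 l ≥ 0`. -/
def topIndex (n : ℕ) : ℕ := (n + 1) / 2

/-- The multiplicity `q(n, l)`, for `n ≥ 1` and `0 ≤ l ≤ topIndex n`: for `n ≥ 2` it is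
`C(n-1, l) - C(n-1, l-3)` with `C(n-1, j) = 0` for `j < 0`; for `n = 1` it is `1`. -/
def mult (n l : ℕ) : ℕ :=
  if n = 1 then 1
  else if l ≤ 2 then (n - 1).choose l
  else (n - 1).choose l - (n - 1).choose (l - 3)

/-- The module `⨁ₗ V(n + 1 - 2 l)^{q(n, l)} ⊗ ℂ` over `sl₂(ℂ) × ℂ`, the element `(0, 1)` acting
on `ℂ` by the scalar `1 - n`. -/
abbrev decomp (n : ℕ) : Type :=
  ⨁ l : Fin (topIndex n + 1),
    (⨁ _ : Fin (mult n l), V (n + 1 - 2 * l)) ⊗[ℂ] CMod (1 - (n : ℂ))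

end RadSq

end

/-! ### Normalization of Hochschild cocycles. -/

noncomputable section

namespace Hochschild

open Function Finset

variable {k A : Type*} [Field k] [Ring A] [Algebra k A]

/-! Let W = ℂ² be the span of the loops, so that A = ℂ ⊕ W with W·W = 0. Every cocycle of positive
degree is cohomologous to one that vanishes as soon as an argument is the unit
(`exists_normalized`). Such a cochain is a table: a function from words of loops to A. On words of
loops the differential keeps only its two outer terms, because the inner ones contain a product of
two loops. It therefore sees only the scalar parts of the values. Normalized cocycles of positive
degree are the tables with values in W, that is, elements of W ⊗ (W*)^{⊗n}, and the coboundaries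
among them are the tables w ↦ u(tail w) w₀ ± u(init w) w_last for scalar functions u on words of
length n - 1 (`hhTable_surjective`, `hhTable_eq_zero_iff`).

Since A is commutative, inner derivations vanish and HH¹(A) = gl(W) = sl₂ × ℂ. A derivation with
eigenvalues μ on the loops multiplies the entry "word w, value loop a" by μ_a - ∑ μ_{wᵢ}. For the
Euler derivation this is 1 - n, which settles the central factor (`lie_euler`).

For sl₂ it suffices to know the eigenvalues of h, since they determine a finite dimensional module.
The form used here avoids complete reducibility: e maps onto every vector of positive weight
(`exists_lie_eq`), so the primitive vectors of weight N - 2l ≥ 0 are counted by the difference of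
consecutive weight multiplicities, and each of them generates a copy of V(N - 2l)
(`exists_equiv_pi`). The action of e and f on tables is never computed.

The weights of HHⁿ(A), n ≥ 2, come from a complement to the coboundaries. Contracting the first
letter of a table with its value turns the coboundary of u into 2u ± (u composed with a rotation),
and this operator is invertible. Hence the traceless tables, a copy of sl₂ ⊗ (W*)^{⊗(n-1)},
represent each class once (`hhTable_tracelessTable_bijective`). The weight n + 1 - 2l occurs C(n-1,
l) + C(n-1, l-1) + C(n-1, l-2) times, and the differences of these numbers are the q(n, l). In
degree one the coboundaries are zero and the four matrix units are used directly. -/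

lemma sFace_sIns_of_lt {N i j : ℕ} {F : (ℕ → A) → A} (hji : j < i) (hi : i ≤ N)
    (hF : ∀ Y, F (sIns 1 (i - 1) Y) = 0) (X : ℕ → A) : sFace N F j (sIns 1 i X) = 0 := by
  unfold sFace
  split_ifs with h0
  · have : (fun l => sIns (1 : A) i X (l + 1)) = sIns 1 (i - 1) fun l => X (l + 1) := by
      ext l
      simp only [sIns]
      split_ifs <;> first | rfl | omega | (congr 1; omega)
    rw [this, hF, mul_zero]
  · omega
  · have : sCon (j - 1) (sIns (1 : A) i X) = sIns 1 (i - 1) (sCon (j - 1) X) := by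
      ext l
      simp only [sIns, sCon]
      split_ifs <;> first | rfl | omega | (congr 1; omega)
    rw [this, hF]

/-- A face to the right of the inserted unit does not touch it, so face and insertion commute up to
a shift of the face index. -/
lemma sFace_succ_sIns_of_gt {N i j : ℕ} (F : (ℕ → A) → A) (hij : i + 1 < j)
    (X : ℕ → A) :
    sFace (N + 1) F j (sIns 1 i X) = sFace N (fun Y => F (sIns 1 i Y)) (j - 1) X := by
  unfold sFace
  rw [if_neg (by omega), if_neg (show ¬ j - 1 = 0 by omega)]
  split_ifs with c1 c2 c3
  · congr 1
    simp only [sIns]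
    split_ifs <;> first | rfl | omega
  · omega
  · omega
  · congr 1
    ext l
    simp only [sIns, sCon]
    split_ifs <;> first | rfl | omega | (congr 1; omega) | (congr 2; omega)

lemma sFace_sIns_of_gt {N i j : ℕ} {F : (ℕ → A) → A} (hij : i + 1 < j) (hj : j ≤ N + 1)
    (hF : ∀ Y, F (sIns 1 i Y) = 0) (X : ℕ → A) : sFace N F j (sIns 1 i X) = 0 := by
  obtain ⟨N, rfl⟩ : ∃ M, N = M + 1 := ⟨N - 1, by omega⟩
  rw [sFace_succ_sIns_of_gt F hij]
  simp only [hF, sFace, mul_zero, zero_mul, ite_self]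

/-- The unit is absorbed by its left neighbour, or multiplies the value from the left when `i = 0`.
Together with the next face, where the right neighbour absorbs it, this gives two equal terms of
opposite sign, the cancellation on which normalization rests. -/
lemma sFace_sIns_self {N i : ℕ} {F : (ℕ → A) → A} (hi : i ≤ N) (X : ℕ → A) :
    sFace N F i (sIns 1 i X) = F X := by
  unfold sFace
  split_ifs with h0 h1
  · subst h0
    simp [sIns]
  · omega
  · congr 1
    ext l
    simp only [sIns, sCon]
    split_ifs <;> first | rfl | omega | simp

/-- For `i = N` the sequence with the unit inserted agrees with `X` only on the first `N` entries,
so `F` is required to depend on these alone. -/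
lemma sFace_sIns_succ {N i : ℕ} {F : (ℕ → A) → A}
    (hF : ∀ Y Y' : ℕ → A, (∀ l, l < N → Y l = Y' l) → F Y = F Y') (hi : i ≤ N) (X : ℕ → A) :
    sFace N F (i + 1) (sIns 1 i X) = F X := by
  unfold sFace
  rw [if_neg (Nat.succ_ne_zero i)]
  split_ifs with h1
  · obtain rfl : i = N := by omega
    rw [show sIns (1 : A) i X i = 1 by simp [sIns], mul_one]
    refine hF _ _ fun l hl => ?_
    simp [sIns, hl]
  · congr 1
    ext l
    simp only [sIns, sCon]
    split_ifs <;> first | rfl | omega | (subst l; simp)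

/-- The function of sequences that evaluates a cochain on the first `n` entries. -/
def onSeq {n : ℕ} (f : Cochain k A n) (Y : ℕ → A) : A := f fun l => Y l

lemma onSeq_congr {n : ℕ} (f : Cochain k A n) (Y Y' : ℕ → A) (h : ∀ l, l < n → Y l = Y' l) :
    onSeq f Y = onSeq f Y' :=
  congrArg f (funext fun l => h l l.2)

lemma exists_seq {n : ℕ} (x : Fin n → A) : ∃ X : ℕ → A, x = fun l : Fin n => X l :=
  ⟨fun l => if h : l < n then x ⟨l, h⟩ else 0, by
    ext l; change x l = dite _ _ _; rw [dif_pos l.2]⟩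

/-- The cochain obtained by inserting the unit at position `i`. -/
def degen {n : ℕ} (i : Fin (n + 1)) (f : Cochain k A (n + 1)) : Cochain k A n :=
  Cochain.ofFun (fun x => f (tIns 1 i x)) (by
    intro x j
    obtain ⟨l, h⟩ := tIns_update (1 : A) i (by omega) x j
    simp only [h]
    exact isLinearMap_update _ _ _)

lemma onSeq_degen {n : ℕ} (i : Fin (n + 1)) (f : Cochain k A (n + 1)) (X : ℕ → A) :
    onSeq (degen i f) X = onSeq f (sIns 1 i X) := by
  change f (tIns 1 i fun l : Fin n => X l) = f _
  congr 1
  ext l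
  exact tIns_seq _ _ (by omega) X l

/-- A cochain vanishes when one of the first `J` arguments is the unit. -/
def NormalizedBelow {n : ℕ} (J : ℕ) (f : Cochain k A (n + 1)) : Prop :=
  ∀ i < J, i ≤ n → ∀ X, onSeq f (sIns 1 i X) = 0

lemma onSeq_d {n : ℕ} (f : Cochain k A n) (X : ℕ → A) :
    onSeq (d k A n f) X = ∑ j ∈ range (n + 2), (-1 : k) ^ j • sFace n (onSeq f) j X :=
  d_seq f X

/-- The simplicial identities. Associativity of the product enters when the two faces meet in a
common entry or both multiply the value from outside. -/
lemma sFace_sFace {n i j : ℕ} (hij : i ≤ j) (hj : j ≤ n + 1) (F : (ℕ → A) → A)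
    (hF : ∀ Y Y' : ℕ → A, (∀ l, l < n → Y l = Y' l) → F Y = F Y') (X : ℕ → A) :
    sFace (n + 1) (sFace n F j) i X = sFace (n + 1) (sFace n F i) (j + 1) X := by
  simp only [sFace]
  rw [if_neg (show ¬ i = n + 1 + 1 by omega), if_neg (Nat.succ_ne_zero j), Nat.add_sub_cancel]
  by_cases hi : i = 0
  · subst hi
    simp only [if_true]
    by_cases hj0 : j = 0
    · subst hj0
      rw [if_pos rfl, if_neg (by omega), ← mul_assoc]
      congr 1
    · by_cases hjn : j = n + 1
      · subst hjn
        simp [mul_assoc]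
      · simp only [hj0, hjn, if_false]
        rw [if_neg (by omega)]
        congr 1
        · simp [sCon, Nat.pos_of_ne_zero hj0]
        · congr 1
          ext l
          simp only [sCon]
          split_ifs <;> first | rfl | omega
  · have hj0 : j ≠ 0 := by omega
    simp only [hi, hj0, if_false]
    by_cases hjn : j = n + 1
    · subst hjn
      rw [if_pos rfl, if_pos rfl]
      by_cases hin : i = n + 1
      · subst hin
        rw [if_pos rfl, mul_assoc]
        congr 1
        · refine hF _ _ fun l hl => ?_
          simp only [sCon]
          rw [if_pos (by omega)]
        · simp [sCon]
      · rw [if_neg hin]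
        congr 1
        simp only [sCon]
        rw [if_neg (by omega), if_neg (by omega)]
    · rw [if_neg hjn, if_neg (by omega), if_neg (by omega)]
      congr 1
      ext l
      obtain ⟨i, rfl⟩ := Nat.exists_eq_succ_of_ne_zero hi
      obtain ⟨j, rfl⟩ := Nat.exists_eq_succ_of_ne_zero hj0
      simp only [sCon, Nat.succ_eq_add_one, Nat.add_sub_cancel]
      split_ifs <;> first | rfl | omega | (congr 1; omega) | (rw [mul_assoc])

/-- The square of the Hochschild differential is zero. -/
lemma d_d {n : ℕ} (f : Cochain k A n) : d k A (n + 1) (d k A n f) = 0 := by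
  ext x
  obtain ⟨X, rfl⟩ := exists_seq x
  change onSeq (d k A (n + 1) (d k A n f)) X = 0
  have e : onSeq (d k A n f) =
      fun Y => ∑ j ∈ range (n + 2), (-1 : k) ^ j • sFace n (onSeq f) j Y := funext (onSeq_d f)
  have e2 : ∀ i, sFace (n + 1) (onSeq (d k A n f)) i X =
      ∑ j ∈ range (n + 2), (-1 : k) ^ j • sFace (n + 1) (sFace n (onSeq f) j) i X := by
    intro i
    rw [e]
    unfold sFace
    split_ifs
    · simp only [mul_sum, mul_smul_comm]
    · simp only [sum_mul, smul_mul_assoc]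
    · rfl
  rw [onSeq_d]
  simp only [e2, smul_sum, smul_smul, ← pow_add]
  rw [← Finset.sum_product', ← Finset.sum_filter_add_sum_filter_not _ (fun p => p.1 ≤ p.2),
    ← eq_neg_iff_add_eq_zero, ← Finset.sum_neg_distrib]
  -- The simplicial identity pairs `(i, j)` with `i ≤ j` against `(j + 1, i)`, and these two terms
  -- carry opposite signs.
  refine Finset.sum_bij (fun p _ => (p.2 + 1, p.1)) ?_ ?_ ?_ ?_
  · rintro ⟨i, j⟩ h
    simp only [mem_filter, mem_product, mem_range] at h ⊢
    omega
  · rintro ⟨i, j⟩ _ ⟨i', j'⟩ _ h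
    simp only [Prod.mk.injEq] at h ⊢
    omega
  · rintro ⟨i, j⟩ h
    simp only [mem_filter, mem_product, mem_range] at h
    refine ⟨(j, i - 1), ?_, ?_⟩
    · simp only [mem_filter, mem_product, mem_range]
      omega
    · simp only [Prod.mk.injEq, and_true]
      omega
  · rintro ⟨i, j⟩ h
    simp only [mem_filter, mem_product, mem_range] at h
    dsimp only
    rw [sFace_sFace h.2 (by omega) _ (onSeq_congr f), show j + 1 + i = i + j + 1 by ring, neg_one_pow_smul_succ,
      neg_neg]

lemma d_mem_B {n : ℕ} (f : Cochain k A n) : d k A n f ∈ B k A (n + 1) := ⟨f, rfl⟩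

lemma d_mem_Z {n : ℕ} (f : Cochain k A n) : d k A n f ∈ Z k A (n + 1) := d_d f

lemma alternating_pair_cancel {N i : ℕ} (hi : i + 1 < N) {T : ℕ → A} {v : A}
    (hv : T i = v) (hv' : T (i + 1) = v) (h0 : ∀ j < N, j ≠ i → j ≠ i + 1 → T j = 0) :
    ∑ j ∈ range N, (-1 : k) ^ j • T j = 0 := by
  rw [← Finset.sum_subset (s₁ := {i, i + 1})]
  · rw [Finset.sum_pair (by omega), hv, hv', pow_succ, mul_neg_one, neg_smul, add_neg_cancel]
  · intro j hj
    simp only [mem_insert, mem_singleton] at hj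
    rw [mem_range]
    omega
  · intro j hj hj'
    simp only [mem_insert, mem_singleton, not_or] at hj'
    rw [h0 j (mem_range.1 hj) hj'.1 hj'.2, smul_zero]

/-- Subtracting the coboundary of `±g`, where `g` is `f` with a unit inserted at position `J`,
removes the value of `f` on a unit at `J`. It does not disturb the positions below `J`, because `g`
already vanishes on units there and hence so does its differential. -/
lemma normalize_step {n J : ℕ} (hJ : J ≤ n) (f : Cochain k A (n + 1)) (hf : f ∈ Z k A (n + 1))
    (hn : NormalizedBelow J f) :
    NormalizedBelow (J + 1) (f - d k A n ((-1 : k) ^ J • degen ⟨J, by omega⟩ f)) := by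
  set g := degen ⟨J, by omega⟩ f with hg
  have hgX : ∀ X, onSeq g X = onSeq f (sIns 1 J X) := onSeq_degen _ f
  have hgi : ∀ i < J, ∀ X, onSeq g (sIns 1 i X) = 0 := by
    intro i hi X
    have : sIns (1 : A) J (sIns 1 i X) = sIns 1 i (sIns 1 (J - 1) X) := by
      ext l
      simp only [sIns]
      split_ifs <;> first | rfl | omega
    rw [hgX, this, hn i hi (by omega)]
  -- The cocycle identity for `f`, evaluated with a unit at `J`: faces below `J` vanish by
  -- hypothesis, the faces `J` and `J + 1` cancel, and the remaining ones are exactly the faces of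
  -- `g` above `J`, shifted by one.
  have upper : ∀ X, ∑ l ∈ range (n + 2), (if J < l then (-1 : k) ^ l • sFace n (onSeq g) l X
      else 0) = 0 := by
    intro X
    have h0 : onSeq (d k A (n + 1) f) (sIns 1 J X) = 0 := by
      have : d k A (n + 1) f = 0 := hf
      rw [this]; rfl
    have hd : ∀ j ∈ range (n + 1 + 2), (-1 : k) ^ j • sFace (n + 1) (onSeq f) j (sIns 1 J X) =
        (if J + 1 < j then (-1 : k) ^ j • sFace n (onSeq g) (j - 1) X else 0) +
        (-1 : k) ^ j • if j = J ∨ j = J + 1 then onSeq f X else 0 := by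
      intro j hj
      rw [mem_range] at hj
      rcases lt_trichotomy j J with h | h | h
      · rw [sFace_sIns_of_lt h (by omega) (hn (J - 1) (by omega) (by omega)),
          if_neg (by omega), if_neg (by omega)]
        simp
      · subst h
        rw [sFace_sIns_self (by omega), if_neg (by omega), if_pos (Or.inl rfl), zero_add]
      · by_cases h' : j = J + 1
        · subst h'
          rw [sFace_sIns_succ (onSeq_congr f) (by omega), if_neg (by omega),
            if_pos (Or.inr rfl), zero_add]
        · rw [sFace_succ_sIns_of_gt _ (by omega), if_pos (by omega),
            if_neg (by omega), smul_zero, add_zero]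
          congr 2
          ext Y
          rw [hgX]
    rw [onSeq_d, Finset.sum_congr rfl hd, Finset.sum_add_distrib,
      alternating_pair_cancel (N := n + 1 + 2) (i := J) (v := onSeq f X)
        (T := fun j => if j = J ∨ j = J + 1 then onSeq f X else 0) (by omega)
        (if_pos (Or.inl rfl)) (if_pos (Or.inr rfl)) (fun j _ h h' => if_neg (by omega)), add_zero, Finset.sum_range_succ',
      if_neg (by omega), add_zero] at h0
    rw [← neg_eq_zero, ← Finset.sum_neg_distrib]
    refine Eq.trans ?_ h0
    refine Finset.sum_congr rfl fun l _ => ?_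
    by_cases h : J < l
    · rw [if_pos h, if_pos (by omega), Nat.add_sub_cancel, neg_one_pow_smul_succ]
    · rw [if_neg h, if_neg (by omega), neg_zero]
  intro i hi hin X
  have key : onSeq (f - d k A n ((-1 : k) ^ J • g)) (sIns 1 i X) =
      onSeq f (sIns 1 i X) - (-1 : k) ^ J • onSeq (d k A n g) (sIns 1 i X) := by
    rw [map_smul]; rfl
  rw [key]
  by_cases hiJ : i < J
  · rw [hn i hiJ hin, onSeq_d, alternating_pair_cancel (i := i) (v := onSeq g X) (by omega)
      (sFace_sIns_self hin X) (sFace_sIns_succ (onSeq_congr g) hin X), smul_zero, sub_zero]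
    intro j hj h1 h2
    rcases lt_trichotomy j i with h | h | h
    · exact sFace_sIns_of_lt h hin (hgi _ (by omega)) X
    · exact absurd h h1
    · exact sFace_sIns_of_gt (by omega) (by omega) (hgi _ hiJ) X
  · obtain rfl : i = J := by omega
    have lower : onSeq (d k A n g) (sIns 1 i X) = (-1 : k) ^ i • onSeq g X := by
      -- Subtracting the vanishing sum `upper` discards all faces above the unit. Those below
      -- vanish, and only the face absorbing the unit is left.
      rw [onSeq_d, ← sub_zero (∑ _ ∈ _, _), ← upper (sIns 1 i X), ← Finset.sum_sub_distrib,
        Finset.sum_eq_single i]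
      · rw [if_neg (lt_irrefl i), sub_zero, sFace_sIns_self hin]
      · intro j hj hji
        split_ifs with h
        · rw [sub_self]
        · rw [sFace_sIns_of_lt (by omega) hin (hgi _ (by omega)), smul_zero, sub_zero]
      · intro h
        rw [mem_range] at h
        omega
    rw [lower, smul_smul, ← mul_pow, neg_one_mul, neg_neg, one_pow, one_smul, hgX, sub_self]

/-- A cochain vanishes when one of its arguments is the unit. -/
def Normalized {n : ℕ} (f : Cochain k A n) : Prop :=
  ∀ (x : Fin n → A) (i : Fin n), x i = 1 → f x = 0

lemma normalized_of_onSeq {n : ℕ} {f : Cochain k A n}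
    (h : ∀ i < n, ∀ X, onSeq f (sIns 1 i X) = 0) : Normalized f := by
  intro x i hi
  obtain ⟨X, rfl⟩ := exists_seq x
  rw [← h i i.2 (fun l => if l < i then X l else X (l + 1))]
  refine onSeq_congr _ _ _ fun l hl => ?_
  simp only [sIns]
  split_ifs with h1 h2 h3
  · rfl
  · subst h2; exact hi
  · omega
  · congr 1; omega

lemma Normalized.onSeq_sIns {n : ℕ} {f : Cochain k A n} (hf : Normalized f) {i : ℕ} (hi : i < n)
    (X : ℕ → A) : onSeq f (sIns 1 i X) = 0 :=
  hf _ ⟨i, hi⟩ (by simp [sIns])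

/-- The differential of a normalized cochain is normalized. -/
lemma Normalized.d {n : ℕ} {f : Cochain k A n} (hf : Normalized f) :
    Normalized (d k A n f) := by
  refine normalized_of_onSeq fun i hi X => ?_
  rw [onSeq_d, alternating_pair_cancel (i := i) (v := onSeq f X) (by omega)
    (sFace_sIns_self (by omega) X) (sFace_sIns_succ (onSeq_congr f) (by omega) X)]
  intro j hj h1 h2
  rcases lt_trichotomy j i with h | h | h
  · exact sFace_sIns_of_lt h (by omega) (hf.onSeq_sIns (by omega)) X
  · exact absurd h h1
  · exact sFace_sIns_of_gt (by omega) (by omega) (hf.onSeq_sIns (by omega)) X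

lemma toLin_one {D : Cochain k A 1} (hD : D ∈ Z k A 1) : toLin D 1 = 0 := by
  have := toLin_mul hD 1 1
  simpa using this

/-- The action of a derivation preserves normalized cochains. -/
lemma Normalized.act {n : ℕ} {D : Cochain k A 1} (hD : D ∈ Z k A 1) {f : Cochain k A n}
    (hf : Normalized f) : Normalized (act k A n D f) := by
  intro x j hj
  rw [act_apply', hf x j hj, map_zero, zero_sub, neg_eq_zero]
  refine Finset.sum_eq_zero fun i _ => ?_
  by_cases hij : i = j
  · subst hij
    rw [hj, toLin_one hD]
    exact (isLinearMap_update f x i).map_zero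
  · exact hf _ j (by rw [update_of_ne (Ne.symm hij), hj])

/-- Every Hochschild cocycle is cohomologous to a normalized one. -/
theorem exists_normalized {n : ℕ} (f : Cochain k A (n + 1)) (hf : f ∈ Z k A (n + 1)) :
    ∃ h : Cochain k A n, Normalized (f - d k A n h) := by
  have step : ∀ J, J ≤ n + 1 → ∃ h : Cochain k A n, NormalizedBelow J (f - d k A n h) := by
    intro J
    induction J with
    | zero => exact fun _ => ⟨0, fun i hi => absurd hi (Nat.not_lt_zero i)⟩
    | succ J ih =>
      intro hJ
      obtain ⟨h, hh⟩ := ih (by omega)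
      have hZ : f - d k A n h ∈ Z k A (n + 1) := by
        refine Submodule.sub_mem _ hf ?_
        exact d_mem_Z h
      refine ⟨h + (-1 : k) ^ J • degen ⟨J, by omega⟩ (f - d k A n h), ?_⟩
      rw [map_add, ← sub_sub]
      exact normalize_step (by omega) _ hZ hh
  obtain ⟨h, hh⟩ := step (n + 1) le_rfl
  exact ⟨h, normalized_of_onSeq fun i hi X => hh i hi (by omega) X⟩

end Hochschild

end
-- The two loops algebra as a trivial square zero extension.
noncomputable section

namespace RadSq

/-- The image of a path of the two loops quiver in the trivial square zero extension of `ℂ` by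
`ℂ²`. -/
def pathVal : {i j : TwoLoops} → Quiver.Path i j → TrivSqZeroExt ℂ (Fin 2 → ℂ)
  | _, _, .nil => 1
  | _, _, .cons p a =>
    pathVal p * TrivSqZeroExt.inr (Pi.single (M := fun _ => ℂ) (show Fin 2 from a) 1)

lemma pathVal_nil (i : TwoLoops) : pathVal (Quiver.Path.nil : Quiver.Path i i) = 1 := by
  rw [pathVal]

lemma pathVal_cons {i j l : TwoLoops} (p : Quiver.Path i j) (a : j ⟶ l) :
    pathVal (p.cons a) =
      pathVal p * TrivSqZeroExt.inr (Pi.single (M := fun _ => ℂ) (show Fin 2 from a) 1) := by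
  rw [pathVal]

lemma pathVal_comp {i j l : TwoLoops} (p : Quiver.Path i j) (q : Quiver.Path j l) :
    pathVal (p.comp q) = pathVal p * pathVal q := by
  induction q with
  | nil => rw [Quiver.Path.comp_nil, pathVal_nil, mul_one]
  | cons q a ih => rw [Quiver.Path.comp_cons, pathVal_cons, ih, pathVal_cons, mul_assoc]

/-- The basis element of a path with given ends. -/
def pathElem {i j : TwoLoops} (p : Quiver.Path i j) : PathAlgebra ℂ TwoLoops :=
  PathAlgebra.of ℂ ⟨i, j, p⟩

/-- The linear extension of `pathVal`. -/
def pathAlgebraVal : PathAlgebra ℂ TwoLoops →ₗ[ℂ] TrivSqZeroExt ℂ (Fin 2 → ℂ) :=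
  Finsupp.linearCombination ℂ fun p => pathVal p.2.2

lemma pathAlgebraVal_pathElem {i j : TwoLoops} (p : Quiver.Path i j) :
    pathAlgebraVal (pathElem p) = pathVal p := by
  unfold pathAlgebraVal pathElem PathAlgebra.of
  erw [Finsupp.linearCombination_single, one_smul]

lemma pathElem_nil (i : TwoLoops) : pathElem (Quiver.Path.nil : Quiver.Path i i) = 1 := by
  change _ = ∑ i : TwoLoops, PathAlgebra.of ℂ (QPath.nil i)
  rw [Fintype.sum_unique]
  rfl

lemma pathElem_mul {i j l : TwoLoops} (p : Quiver.Path i j) (q : Quiver.Path j l) :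
    pathElem p * pathElem q = pathElem (p.comp q) := by
  unfold pathElem
  exact (PathAlgebra.of_mul_of _ _).trans (dif_pos rfl)

/-- `pathAlgebraVal` as a homomorphism of algebras. -/
def pathAlgebraHom : PathAlgebra ℂ TwoLoops →ₐ[ℂ] TrivSqZeroExt ℂ (Fin 2 → ℂ) :=
  AlgHom.ofLinearMap pathAlgebraVal
    (by rw [← pathElem_nil (Quiver.SingleObj.star (Fin 2)), pathAlgebraVal_pathElem, pathVal_nil])
    (by
      intro x y
      induction x using PathAlgebra.induction with
      | h0 => simp
      | hadd x x' hx hx' => simp only [add_mul, map_add, hx, hx']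
      | hof c p =>
        induction y using PathAlgebra.induction with
        | h0 => simp
        | hadd x x' hx hx' => simp only [mul_add, map_add, hx, hx']
        | hof c' q =>
          obtain ⟨i, j, p⟩ := p
          obtain ⟨j', l, q⟩ := q
          -- The quiver has one vertex, so any two paths are composable.
          obtain rfl : j = j' := Subsingleton.elim (α := Unit) _ _
          change pathAlgebraVal ((c • pathElem p) * (c' • pathElem q)) =
            pathAlgebraVal (c • pathElem p) * pathAlgebraVal (c' • pathElem q)
          simp only [smul_mul_smul_comm, map_smul, pathElem_mul, pathAlgebraVal_pathElem,
            pathVal_comp])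

lemma pathAlgebraHom_pathElem {i j : TwoLoops} (p : Quiver.Path i j) :
    pathAlgebraHom (pathElem p) = pathVal p :=
  pathAlgebraVal_pathElem p

/-- A path of length two is sent to a product of two elements of the square zero ideal. The
resulting map from A to the extension shows that the unit and the loops stay linearly independent in
the quotient. -/
lemma radSqIdeal_le_ker :
    (radSqIdeal ℂ TwoLoops).ringCon ≤ RingCon.ker pathAlgebraHom.toRingHom := by
  have : radSqIdeal ℂ TwoLoops ≤ TwoSidedIdeal.ker pathAlgebraHom := by
    unfold radSqIdeal
    rw [TwoSidedIdeal.span_le]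
    rintro _ ⟨⟨i, j, p⟩, hp, rfl⟩
    rw [SetLike.mem_coe, TwoSidedIdeal.mem_ker]
    refine (pathAlgebraHom_pathElem p).trans ?_
    match p, hp with
    | .cons (.cons .nil a) b, _ =>
      simp only [pathVal_cons, pathVal_nil, one_mul]
      exact TrivSqZeroExt.inr_mul_inr ℂ _ _
  intro x y h
  exact (TwoSidedIdeal.ringCon_le_iff.1 this) h

/-- The quotient map from the path algebra of the two loops quiver. -/
def quotHom : PathAlgebra ℂ TwoLoops →ₐ[ℂ] TwoLoopsAlgebra :=
  (radSqIdeal ℂ TwoLoops).ringCon.mkₐ (α := ℂ)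

lemma quotHom_surjective : Function.Surjective quotHom := by
  intro x
  exact Quotient.exists_rep x

/-- The homomorphism from `A` to the trivial square zero extension. -/
def toTriv : TwoLoopsAlgebra →ₐ[ℂ] TrivSqZeroExt ℂ (Fin 2 → ℂ) :=
  (radSqIdeal ℂ TwoLoops).ringCon.liftₐ pathAlgebraHom radSqIdeal_le_ker

lemma toTriv_quotHom (x : PathAlgebra ℂ TwoLoops) : toTriv (quotHom x) = pathAlgebraHom x := rfl

lemma quotHom_arrow {j l : TwoLoops} (a : j ⟶ l) :
    quotHom (pathElem a.toPath) = loop (show Fin 2 from a) := rfl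

lemma loop_mul_loop (a b : Fin 2) : loop a * loop b = 0 := by
  set i := Quiver.SingleObj.star (Fin 2)
  have h : pathElem ((Quiver.Path.nil.cons (show i ⟶ i from a)).cons (show i ⟶ i from b)) ∈
      radSqIdeal ℂ TwoLoops :=
    TwoSidedIdeal.subset_span ⟨_, rfl, rfl⟩
  have h' : quotHom (pathElem ((Quiver.Path.nil.cons (show i ⟶ i from a)).cons
      (show i ⟶ i from b))) = quotHom 0 :=
    (RingCon.eq _).2 h
  rw [map_zero] at h'
  rw [← h']
  refine ((map_mul quotHom _ _).symm.trans ?_ :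
    quotHom (pathElem (show i ⟶ i from a).toPath) * quotHom (pathElem (show i ⟶ i from b).toPath)
      = _)
  rw [pathElem_mul]
  rfl

/-- The augmentation `A → ℂ`. -/
def aug : TwoLoopsAlgebra →ₐ[ℂ] ℂ := (TrivSqZeroExt.fstHom ℂ ℂ (Fin 2 → ℂ)).comp toTriv

/-- The coordinates of an element of `A` with respect to the two loops. -/
def coef : TwoLoopsAlgebra →ₗ[ℂ] (Fin 2 → ℂ) :=
  (TrivSqZeroExt.sndHom ℂ (Fin 2 → ℂ)).comp toTriv.toLinearMap

/-- The element of the radical of `A` with given coordinates. -/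
def radElem : (Fin 2 → ℂ) →ₗ[ℂ] TwoLoopsAlgebra := Fintype.linearCombination ℂ loop

lemma radElem_apply (v : Fin 2 → ℂ) : radElem v = ∑ i, v i • loop i :=
  Fintype.linearCombination_apply ℂ loop v

lemma radElem_single (i : Fin 2) : radElem (Pi.single i 1) = loop i := by
  rw [radElem, Fintype.linearCombination_apply_single, one_smul]

lemma radElem_mul_radElem (v w : Fin 2 → ℂ) : radElem v * radElem w = 0 := by
  simp [radElem_apply, add_mul, mul_add, loop_mul_loop]

lemma toTriv_loop (i : Fin 2) : toTriv (loop i) = TrivSqZeroExt.inr (Pi.single i 1) := by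
  rw [← quotHom_arrow (j := Quiver.SingleObj.star (Fin 2)) (l := Quiver.SingleObj.star (Fin 2)) i,
    toTriv_quotHom, pathAlgebraHom_pathElem]
  change pathVal (Quiver.Path.nil.cons _) = _
  rw [pathVal_cons, pathVal_nil, one_mul]

@[simp] lemma aug_loop (i : Fin 2) : aug (loop i) = 0 := by
  change (toTriv (loop i)).fst = 0
  rw [toTriv_loop, TrivSqZeroExt.fst_inr]

@[simp] lemma coef_loop (i : Fin 2) : coef (loop i) = Pi.single i 1 := by
  change (toTriv (loop i)).snd = _
  rw [toTriv_loop, TrivSqZeroExt.snd_inr]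

@[simp] lemma aug_radElem (v : Fin 2 → ℂ) : aug (radElem v) = 0 := by
  simp [radElem_apply]

@[simp] lemma coef_radElem (v : Fin 2 → ℂ) : coef (radElem v) = v := by
  ext j
  fin_cases j <;> simp [radElem_apply]

@[simp] lemma coef_one : coef 1 = 0 := by
  change (toTriv 1).snd = 0
  rw [map_one, TrivSqZeroExt.snd_one]

@[simp] lemma coef_algebraMap (c : ℂ) : coef (algebraMap ℂ _ c) = 0 := by
  rw [Algebra.algebraMap_eq_smul_one, map_smul, coef_one, smul_zero]

lemma coef_mul (x y : TwoLoopsAlgebra) : coef (x * y) = aug x • coef y + aug y • coef x := by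
  change (toTriv (x * y)).snd = (toTriv x).fst • (toTriv y).snd + (toTriv y).fst • (toTriv x).snd
  rw [map_mul, TrivSqZeroExt.snd_mul, op_smul_eq_smul]

/-- The elements of `A` are the sums of a scalar and an element of the radical. -/
lemma eq_algebraMap_add_radElem (x : TwoLoopsAlgebra) :
    x = algebraMap ℂ _ (aug x) + radElem (coef x) := by
  have path : ∀ {i j : TwoLoops} (p : Quiver.Path i j), quotHom (pathElem p) =
      algebraMap ℂ _ (aug (quotHom (pathElem p))) + radElem (coef (quotHom (pathElem p))) := by
    intro i j p
    induction p with
    | nil => simp [pathElem_nil]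
    | cons p a ih =>
      have e : pathElem (p.cons a) = pathElem p * pathElem a.toPath := by
        rw [pathElem_mul]; rfl
      rw [e, map_mul, map_mul, quotHom_arrow, coef_mul, aug_loop, mul_zero, map_zero, zero_smul,
        add_zero, zero_add, map_smul, coef_loop, radElem_single]
      set y := quotHom (pathElem p)
      -- Of the scalar and radical parts of `y`, only the scalar part survives multiplication by a
      -- loop.
      rw [ih, add_mul, ← radElem_single, radElem_mul_radElem, add_zero, ← Algebra.smul_def]
      congr 1
      simp
  obtain ⟨x, rfl⟩ := quotHom_surjective x
  induction x using PathAlgebra.induction with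
  | h0 => simp
  | hadd x y hx hy =>
    simp only [map_add]
    conv_lhs => rw [hx, hy]
    abel
  | hof c p =>
    simp only [map_smul]
    conv_lhs => rw [show quotHom (PathAlgebra.of ℂ p) = _ from path p.2.2]
    rw [smul_add, smul_eq_mul, map_mul, Algebra.smul_def c (algebraMap _ _ _)]
    rfl

lemma eq_of_aug_of_coef {x y : TwoLoopsAlgebra} (h : aug x = aug y) (h' : coef x = coef y) :
    x = y := by
  rw [eq_algebraMap_add_radElem x, eq_algebraMap_add_radElem y, h, h']

/-- Both products have the coordinates of a product in the commutative extension ℂ ⊕ ℂ². As a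
consequence, left and right multiplication by a loop agree, and A has no nonzero inner derivations.
-/
lemma twoLoops_mul_comm (x y : TwoLoopsAlgebra) : x * y = y * x := by
  refine eq_of_aug_of_coef ?_ ?_
  · rw [map_mul, map_mul, mul_comm]
  · rw [coef_mul, coef_mul, add_comm]

lemma eq_radElem_of_aug_eq_zero {x : TwoLoopsAlgebra} (h : aug x = 0) : x = radElem (coef x) := by
  conv_lhs => rw [eq_algebraMap_add_radElem x]
  rw [h, map_zero, zero_add]

end RadSq

end
-- Cohomology classes as tables on words of loops.
noncomputable section

namespace RadSq

open Hochschild Function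

/-- The coordinates of an element of `A` with respect to the unit and the two loops. -/
def coordEquiv : TwoLoopsAlgebra ≃ₗ[ℂ] (Option (Fin 2) → ℂ) where
  toFun x o := o.elim (aug x) (coef x)
  map_add' x y := by
    ext o
    cases o with
    | none => exact map_add aug x y
    | some i => exact congrFun (map_add coef x y) i
  map_smul' c x := by
    ext o
    cases o with
    | none => exact map_smul aug c x
    | some i => exact congrFun (map_smul coef c x) i
  invFun v := algebraMap ℂ _ (v none) + radElem fun i => v (some i)
  left_inv x := (eq_algebraMap_add_radElem x).symm
  right_inv v := by
    ext o
    cases o with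
    | none =>
      change aug _ = _
      rw [map_add, aug_radElem, AlgHom.commutes, add_zero]
      rfl
    | some i =>
      change coef _ i = _
      rw [map_add, coef_radElem, coef_algebraMap, zero_add]

lemma coordEquiv_symm_apply (v : Option (Fin 2) → ℂ) :
    coordEquiv.symm v = algebraMap ℂ _ (v none) + radElem fun i => v (some i) := rfl

/-- The basis of `A` consisting of the unit and the two loops. -/
def loopBasis : Module.Basis (Option (Fin 2)) ℂ TwoLoopsAlgebra :=
  Module.Basis.ofEquivFun coordEquiv

lemma loopBasis_none : loopBasis none = 1 := by
  rw [loopBasis, Module.Basis.coe_ofEquivFun]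
  beta_reduce
  rw [coordEquiv_symm_apply, Pi.single_eq_same, map_one]
  convert add_zero _
  exact map_zero radElem

lemma loopBasis_some (i : Fin 2) : loopBasis (some i) = loop i := by
  rw [loopBasis, Module.Basis.coe_ofEquivFun]
  beta_reduce
  rw [coordEquiv_symm_apply, Pi.single_eq_of_ne (by simp),
    map_zero, zero_add, ← radElem_single]
  congr 1
  ext j
  simp [Pi.single_apply]

/-- Normalized cochains that agree on the loops are equal. -/
lemma normalized_ext {n : ℕ} {f g : Cochain ℂ TwoLoopsAlgebra n} (hf : Normalized f)
    (hg : Normalized g) (h : ∀ w : Fin n → Fin 2, f (fun i => loop (w i)) = g fun i => loop (w i)) :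
    f = g := by
  refine Module.Basis.ext_multilinear (f := f) (g := g) (fun _ => loopBasis) fun v => ?_
  change f (fun i => loopBasis (v i)) = g fun i => loopBasis (v i)
  by_cases hv : ∃ i, v i = none
  · obtain ⟨i, hi⟩ := hv
    have : loopBasis (v i) = 1 := by rw [hi, loopBasis_none]
    rw [hf _ i this, hg _ i this]
  · push Not at hv
    choose w hw using fun i => Option.ne_none_iff_exists'.1 (hv i)
    simp only [hw, loopBasis_some, h]

/-- The cochain with given values on the loops that vanishes when an argument is a scalar. -/
def ofTable (n : ℕ) :
    ((Fin n → Fin 2) → TwoLoopsAlgebra) →ₗ[ℂ] Cochain ℂ TwoLoopsAlgebra n where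
  toFun g := Cochain.ofFun (fun x => ∑ w, (∏ i, coef (x i) (w i)) • g w) (by
    intro x i
    have key : ∀ (v : TwoLoopsAlgebra) (w : Fin n → Fin 2), ∏ j, coef (update x i v j) (w j) =
        coef v (w i) * ∏ j ∈ Finset.univ.erase i, coef (x j) (w j) := by
      intro v w
      rw [← Finset.mul_prod_erase _ _ (Finset.mem_univ i), update_self]
      congr 1
      refine Finset.prod_congr rfl fun j hj => ?_
      rw [update_of_ne (Finset.ne_of_mem_erase hj)]
    simp only [key]
    refine ⟨fun v v' => ?_, fun c v => ?_⟩
    · rw [← Finset.sum_add_distrib]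
      refine Finset.sum_congr rfl fun w _ => ?_
      rw [map_add, Pi.add_apply, add_mul, add_smul]
    · rw [Finset.smul_sum]
      refine Finset.sum_congr rfl fun w _ => ?_
      rw [map_smul, Pi.smul_apply, smul_eq_mul, mul_assoc, mul_smul])
  map_add' g g' := by
    ext x
    simp only [Cochain.ofFun_apply, Cochain.add_apply, Pi.add_apply, smul_add,
      Finset.sum_add_distrib]
  map_smul' c g := by
    ext x
    simp only [Cochain.ofFun_apply, Cochain.smul_apply, Pi.smul_apply, Finset.smul_sum,
      smul_comm c, RingHom.id_apply]

lemma ofTable_apply {n : ℕ} (g : (Fin n → Fin 2) → TwoLoopsAlgebra)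
    (x : Fin n → TwoLoopsAlgebra) :
    ofTable n g x = ∑ w, (∏ i, coef (x i) (w i)) • g w := rfl

lemma ofTable_loop {n : ℕ} (g : (Fin n → Fin 2) → TwoLoopsAlgebra) (w : Fin n → Fin 2) :
    ofTable n g (fun i => loop (w i)) = g w := by
  rw [ofTable_apply, Finset.sum_eq_single w]
  · simp
  · intro v _ hv
    obtain ⟨i, hi⟩ := Function.ne_iff.1 hv
    rw [Finset.prod_eq_zero (Finset.mem_univ i) (by simp [hi]), zero_smul]
  · simp

lemma normalized_ofTable {n : ℕ} (g : (Fin n → Fin 2) → TwoLoopsAlgebra) :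
    Normalized (ofTable n g) := by
  intro x i hi
  rw [ofTable_apply]
  refine Finset.sum_eq_zero fun w _ => ?_
  rw [Finset.prod_eq_zero (Finset.mem_univ i) (by rw [hi, coef_one]; rfl), zero_smul]

lemma eq_ofTable {n : ℕ} {f : Cochain ℂ TwoLoopsAlgebra n} (hf : Normalized f) :
    f = ofTable n fun w => f fun i => loop (w i) :=
  normalized_ext hf (normalized_ofTable _) fun w =>
    (ofTable_loop (fun w => f fun i => loop (w i)) w).symm

lemma cochain_eq_zero {n : ℕ} (f : Cochain ℂ TwoLoopsAlgebra n) (x : Fin n → TwoLoopsAlgebra)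
    (i : Fin n) (h : x i = 0) : f x = 0 :=
  MultilinearMap.map_coord_zero (f := f) i h

/-- Each inner term of the differential has a product of two loops, hence zero, among its arguments.
-/
lemma d_loop {n : ℕ} (f : Cochain ℂ TwoLoopsAlgebra n) (w : Fin (n + 1) → Fin 2) :
    d ℂ TwoLoopsAlgebra n f (fun i => loop (w i)) =
      loop (w 0) * f (fun i => loop (Fin.tail w i)) +
        (-1 : ℂ) ^ (n + 1) • (f (fun i => loop (Fin.init w i)) * loop (w (Fin.last n))) := by
  rw [d_apply, Finset.sum_eq_zero, add_zero]
  · rfl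
  · intro j _
    rw [cochain_eq_zero f _ j, smul_zero]
    rw [Fin.contractNth_apply_of_eq _ _ _ _ rfl]
    exact loop_mul_loop _ _

lemma d_ofTable {n : ℕ} (g : (Fin n → Fin 2) → TwoLoopsAlgebra) :
    d ℂ TwoLoopsAlgebra n (ofTable n g) = ofTable (n + 1) fun w =>
      loop (w 0) * g (Fin.tail w) + (-1 : ℂ) ^ (n + 1) • (g (Fin.init w) * loop (w (Fin.last n))) := by
  refine normalized_ext (normalized_ofTable g).d (normalized_ofTable _) fun w => ?_
  rw [d_loop, ofTable_loop, ofTable_loop, ofTable_loop]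

lemma loop_mul (i : Fin 2) (x : TwoLoopsAlgebra) : loop i * x = aug x • loop i :=
  eq_of_aug_of_coef (by simp) (by simp [coef_mul])

lemma mul_loop (i : Fin 2) (x : TwoLoopsAlgebra) : x * loop i = aug x • loop i := by
  rw [twoLoops_mul_comm, loop_mul]

/-- The two outer terms multiply a radical value by a loop, and the radical has square zero. -/
lemma ofTable_radElem_mem_Z {n : ℕ} (g : (Fin n → Fin 2) → Fin 2 → ℂ) :
    ofTable n (fun w => radElem (g w)) ∈ Z ℂ TwoLoopsAlgebra n := by
  change d ℂ TwoLoopsAlgebra n _ = 0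
  rw [d_ofTable, ← map_zero (ofTable (n + 1))]
  congr 1
  ext w
  simp [loop_mul, mul_loop]

/-- Normalized cocycles of positive degree have their values on the loops in the radical. -/
lemma aug_eq_zero_of_mem_Z {n : ℕ} {f : Cochain ℂ TwoLoopsAlgebra (n + 1)}
    (hf : f ∈ Z ℂ TwoLoopsAlgebra (n + 1)) (w : Fin (n + 1) → Fin 2) :
    aug (f fun i => loop (w i)) = 0 := by
  have hf' : d ℂ TwoLoopsAlgebra (n + 1) f = 0 := hf
  -- The letter `1 - w (Fin.last n)`, put in front of `w`, is the loop different from the last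
  -- letter. Its coefficient in the differential then comes from the left outer term alone and
  -- equals the scalar part of `f` at `w`.
  have h := d_loop f (Fin.cons (1 - w (Fin.last n)) w : Fin (n + 2) → Fin 2)
  rw [hf', Cochain.zero_apply, Fin.cons_zero, Fin.tail_cons, loop_mul, mul_loop] at h
  have h2 := congrArg (fun x => coef x (1 - w (Fin.last n))) h
  have e : (Fin.cons (1 - w (Fin.last n)) w : Fin (n + 2) → Fin 2) (Fin.last (n + 1)) =
      w (Fin.last n) := by
    rw [← Fin.succ_last, Fin.cons_succ]
  have ne : (1 - w (Fin.last n)) ≠ w (Fin.last n) := by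
    generalize w (Fin.last n) = a
    fin_cases a <;> simp
  simp only [e, map_zero, Pi.zero_apply, map_add, map_smul, Pi.add_apply, Pi.smul_apply, coef_loop,
    Pi.single_eq_same, Pi.single_eq_of_ne ne, smul_eq_mul, mul_one, mul_zero, add_zero] at h2
  exact h2.symm

/-- The cohomology class with given values on the loops. -/
def hhTable (n : ℕ) : ((Fin n → Fin 2) → Fin 2 → ℂ) →ₗ[ℂ] HH ℂ TwoLoopsAlgebra n :=
  (HH.mk ℂ TwoLoopsAlgebra n).comp
    (((ofTable n).comp (radElem.compLeft (Fin n → Fin 2))).codRestrict _ fun g =>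
      ofTable_radElem_mem_Z g)

lemma hhTable_apply {n : ℕ} (g : (Fin n → Fin 2) → Fin 2 → ℂ) :
    hhTable n g = HH.mk ℂ TwoLoopsAlgebra n
      ⟨ofTable n fun w => radElem (g w), ofTable_radElem_mem_Z g⟩ := rfl

lemma mk_eq_mk_of_sub_mem {n : ℕ} {f g : Z ℂ TwoLoopsAlgebra n}
    (h : f.1 - g.1 ∈ B ℂ TwoLoopsAlgebra n) :
    HH.mk ℂ TwoLoopsAlgebra n f = HH.mk ℂ TwoLoopsAlgebra n g :=
  (Submodule.Quotient.eq _).2 h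

lemma mk_eq_zero_iff {n : ℕ} {f : Z ℂ TwoLoopsAlgebra n} :
    HH.mk ℂ TwoLoopsAlgebra n f = 0 ↔ f.1 ∈ B ℂ TwoLoopsAlgebra n :=
  Submodule.Quotient.mk_eq_zero _

/-- A normalized representative is the table of its values on loops, and the cocycle condition
forces these values into the radical. -/
lemma hhTable_surjective (n : ℕ) : Function.Surjective (hhTable (n + 1)) := by
  intro x
  obtain ⟨f, rfl⟩ := HH.mk_surjective (n + 1) x
  obtain ⟨h, hh⟩ := exists_normalized f.1 f.2
  have hZ : f.1 - d ℂ TwoLoopsAlgebra n h ∈ Z ℂ TwoLoopsAlgebra (n + 1) :=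
    Submodule.sub_mem _ f.2 (d_mem_Z h)
  refine ⟨fun w => coef ((f.1 - d ℂ TwoLoopsAlgebra n h) fun i => loop (w i)), ?_⟩
  rw [hhTable_apply]
  refine mk_eq_mk_of_sub_mem ?_
  dsimp only
  simp only [← eq_radElem_of_aug_eq_zero (aug_eq_zero_of_mem_Z hZ _)]
  rw [← eq_ofTable hh, sub_sub_cancel_left]
  exact Submodule.neg_mem _ (d_mem_B h)

/-- The classes with vanishing image in cohomology. -/
lemma hhTable_eq_zero_iff {n : ℕ} (g : (Fin (n + 1) → Fin 2) → Fin 2 → ℂ) :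
    hhTable (n + 1) g = 0 ↔ ∃ u : (Fin n → Fin 2) → ℂ, ∀ w,
      g w = u (Fin.tail w) • Pi.single (w 0) 1 +
        ((-1 : ℂ) ^ (n + 1) * u (Fin.init w)) • Pi.single (w (Fin.last n)) 1 := by
  rw [hhTable_apply, mk_eq_zero_iff]
  constructor
  · rintro ⟨h, hh⟩
    -- The primitive `h` need not be normalized: on words of loops its differential involves only
    -- the scalar parts of its values on loops.
    refine ⟨fun w => aug (h fun i => loop (w i)), fun w => ?_⟩
    have := congrArg (fun f : Cochain ℂ TwoLoopsAlgebra (n + 1) => coef (f fun i => loop (w i))) hh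
    dsimp only at this
    rw [d_loop, ofTable_loop, coef_radElem, loop_mul, mul_loop] at this
    rw [← this]
    simp [mul_smul]
  · rintro ⟨u, hu⟩
    refine ⟨ofTable n fun w => algebraMap ℂ _ (u w), ?_⟩
    rw [d_ofTable]
    congr 1
    ext w
    simp only [loop_mul, mul_loop, hu, map_add, map_smul, radElem_single, smul_smul]
    simp

end RadSq

end
-- The Lie algebra `HH¹(A)` and the action of its diagonal elements.
noncomputable section

namespace RadSq

open Hochschild Function

lemma toLin_loop {D : Cochain ℂ TwoLoopsAlgebra 1} (hD : D ∈ Z ℂ TwoLoopsAlgebra 1) (j : Fin 2) :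
    toLin D (loop j) = radElem (coef (toLin D (loop j))) :=
  eq_radElem_of_aug_eq_zero (aug_eq_zero_of_mem_Z hD fun _ => j)

lemma normalized_of_mem_Z_one {D : Cochain ℂ TwoLoopsAlgebra 1} (hD : D ∈ Z ℂ TwoLoopsAlgebra 1) :
    Normalized D := by
  intro x i hi
  have hx : x = fun _ => 1 := by
    ext j
    rw [Subsingleton.elim j i, hi]
  rw [hx]
  exact toLin_one hD

/-- The action of a derivation that is diagonal on the loops. -/
lemma lie_hhTable_of_diagonal {n : ℕ} {D : Cochain ℂ TwoLoopsAlgebra 1}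
    (hD : D ∈ Z ℂ TwoLoopsAlgebra 1) (μ : Fin 2 → ℂ) (h : ∀ j, toLin D (loop j) = μ j • loop j)
    (g : (Fin n → Fin 2) → Fin 2 → ℂ) :
    ⁅HH.mk ℂ TwoLoopsAlgebra 1 ⟨D, hD⟩, hhTable n g⁆ =
      hhTable n fun w a => (μ a - ∑ i, μ (w i)) * g w a := by
  rw [hhTable_apply, hhTable_apply, lie_mk_mk]
  congr 2
  change act ℂ TwoLoopsAlgebra n D _ = _
  refine normalized_ext ((normalized_ofTable _).act hD) (normalized_ofTable _) fun w => ?_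
  rw [act_apply', ofTable_loop, ofTable_loop]
  have h1 : ∀ i, ofTable n (fun w => radElem (g w))
      (update (fun i => loop (w i)) i (toLin D (loop (w i)))) = μ (w i) • radElem (g w) := by
    intro i
    rw [h, Cochain.map_update_smul]
    congr 1
    -- Once the eigenvalue is taken out, the updated word is the original one.
    rw [update_eq_self_iff.2 rfl, ofTable_loop]
  simp only [h1, ← Finset.sum_smul]
  rw [radElem_apply, radElem_apply, map_sum, Finset.smul_sum, ← Finset.sum_sub_distrib]
  refine Finset.sum_congr rfl fun a _ => ?_
  rw [map_smul, h, smul_comm, ← sub_smul, smul_smul]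

/-- The matrix of a derivation on the loops. -/
def matrixZ : Z ℂ TwoLoopsAlgebra 1 →ₗ[ℂ] Matrix (Fin 2) (Fin 2) ℂ where
  toFun D := Matrix.of fun i j => coef (toLin D.1 (loop j)) i
  map_add' D D' := by
    ext i j
    exact congrFun (map_add coef (toLin D.1 (loop j)) (toLin D'.1 (loop j))) i
  map_smul' c D := by
    ext i j
    exact congrFun (map_smul coef c (toLin D.1 (loop j))) i

lemma matrixZ_apply (D : Z ℂ TwoLoopsAlgebra 1) (i j : Fin 2) :
    matrixZ D i j = coef (toLin D.1 (loop j)) i := rfl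

lemma toLin_loop_eq_sum (D : Z ℂ TwoLoopsAlgebra 1) (j : Fin 2) :
    toLin D.1 (loop j) = ∑ i, matrixZ D i j • loop i := by
  rw [toLin_loop D.2, radElem_apply]
  rfl

/-- Inner derivations of a commutative algebra vanish. -/
lemma B_one_eq_bot : B ℂ TwoLoopsAlgebra 1 = ⊥ := by
  rw [eq_bot_iff]
  rintro _ ⟨c, rfl⟩
  rw [Submodule.mem_bot]
  ext x
  rw [d_apply, twoLoops_mul_comm, Subsingleton.elim (Fin.tail x) (Fin.init x)]
  simp

lemma matrixZ_injective : Function.Injective matrixZ := by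
  rw [injective_iff_map_eq_zero]
  intro D hD
  refine Subtype.ext ?_
  refine normalized_ext (normalized_of_mem_Z_one D.2) (fun _ _ _ => rfl) fun w => ?_
  have h : toLin D.1 (loop (w 0)) = 0 := by
    rw [toLin_loop_eq_sum, hD]
    simp
  rw [← show (fun _ => loop (w 0)) = fun i => loop (w i) from
    funext fun i => by rw [Subsingleton.elim i 0]]
  exact h

/-- Any linear endomorphism of the radical, extended by zero on the unit, is a derivation because
products of radical elements vanish. -/
lemma matrixZ_surjective : Function.Surjective matrixZ := by
  intro M
  refine ⟨⟨ofTable 1 fun w => radElem fun i => M i (w 0), ofTable_radElem_mem_Z _⟩, ?_⟩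
  ext i j
  rw [matrixZ_apply]
  change coef (ofTable 1 _ fun _ => loop j) i = _
  rw [ofTable_loop _ fun _ => j, coef_radElem]

/-- `HH¹(A)` as the space of matrices of derivations on the loops. -/
def hhMatrix : HH ℂ TwoLoopsAlgebra 1 →ₗ[ℂ] Matrix (Fin 2) (Fin 2) ℂ :=
  Submodule.liftQ _ matrixZ (by
    intro D hD
    have : D.1 ∈ B ℂ TwoLoopsAlgebra 1 := hD
    rw [B_one_eq_bot, Submodule.mem_bot] at this
    rw [LinearMap.mem_ker, show D = 0 from Subtype.ext this, map_zero])

lemma hhMatrix_mk (D : Z ℂ TwoLoopsAlgebra 1) :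
    hhMatrix (HH.mk ℂ TwoLoopsAlgebra 1 D) = matrixZ D := rfl

lemma hhMatrix_injective : Function.Injective hhMatrix := by
  rw [injective_iff_map_eq_zero]
  intro x hx
  obtain ⟨D, rfl⟩ := HH.mk_surjective 1 x
  rw [hhMatrix_mk] at hx
  rw [matrixZ_injective (hx.trans (map_zero matrixZ).symm), map_zero]

lemma hhMatrix_surjective : Function.Surjective hhMatrix := fun M => by
  obtain ⟨D, hD⟩ := matrixZ_surjective M
  exact ⟨HH.mk ℂ TwoLoopsAlgebra 1 D, hD⟩

lemma hhMatrix_lie (x y : HH ℂ TwoLoopsAlgebra 1) :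
    hhMatrix ⁅x, y⁆ = ⁅hhMatrix x, hhMatrix y⁆ := by
  obtain ⟨D, rfl⟩ := HH.mk_surjective 1 x
  obtain ⟨D', rfl⟩ := HH.mk_surjective 1 y
  rw [lie_mk_mk, hhMatrix_mk, hhMatrix_mk, hhMatrix_mk]
  ext i j
  rw [matrixZ_apply]
  change coef (toLin (act ℂ TwoLoopsAlgebra 1 D.1 D'.1) (loop j)) i = _
  rw [act_one, toLin_loop_eq_sum D, toLin_loop_eq_sum D']
  simp only [map_sum, map_smul, toLin_loop_eq_sum, Ring.lie_def, Matrix.sub_apply,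
    Matrix.mul_apply, map_sub, coef_loop, Pi.sub_apply, Finset.sum_apply, Pi.smul_apply,
    Pi.single_apply, smul_eq_mul, mul_ite, mul_one, mul_zero, Finset.sum_ite_eq,
    Finset.mem_univ, if_true]
  simp only [mul_comm]

/-- The traceless part of a matrix. -/
def tracelessPart (M : Matrix (Fin 2) (Fin 2) ℂ) : Sl2 :=
  ⟨M - (M.trace / 2) • 1, by
    change (M - (M.trace / 2) • (1 : Matrix (Fin 2) (Fin 2) ℂ)).trace = 0
    rw [Matrix.trace_sub, Matrix.trace_smul, Matrix.trace_one]
    simp⟩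

/-- The decomposition of a matrix into its traceless and its scalar part, on `HH¹(A)`. -/
def hhOneHom : HH ℂ TwoLoopsAlgebra 1 →ₗ⁅ℂ⁆ Sl2 × ℂ where
  toFun x := (tracelessPart (hhMatrix x), (hhMatrix x).trace / 2)
  map_add' x y := by
    refine Prod.ext (Subtype.ext ?_) ?_
    · change hhMatrix (x + y) - _ = (hhMatrix x - _) + (hhMatrix y - _)
      rw [map_add, Matrix.trace_add, add_div, add_smul]
      abel
    · change (hhMatrix (x + y)).trace / 2 = _
      rw [map_add, Matrix.trace_add, add_div]
      rfl
  map_smul' c x := by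
    refine Prod.ext (Subtype.ext ?_) ?_
    · change hhMatrix (c • x) - _ = c • (hhMatrix x - _)
      rw [map_smul, Matrix.trace_smul, smul_sub, smul_smul, smul_eq_mul, mul_div_assoc]
    · change (hhMatrix (c • x)).trace / 2 = c * _
      rw [map_smul, Matrix.trace_smul, smul_eq_mul, mul_div_assoc]
  map_lie' {x y} := by
    have ht : (hhMatrix ⁅x, y⁆).trace = 0 := by
      rw [hhMatrix_lie, LieAlgebra.matrix_trace_commutator_zero]
    refine Prod.ext (Subtype.ext ?_) ?_
    · change hhMatrix ⁅x, y⁆ - _ = ⁅hhMatrix x - _, hhMatrix y - _⁆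
      rw [ht, hhMatrix_lie, zero_div, zero_smul, sub_zero]
      simp only [Ring.lie_def, sub_mul, mul_sub, smul_mul_assoc, mul_smul_comm, one_mul, mul_one,
        smul_sub, smul_smul, mul_comm ((hhMatrix x).trace / 2)]
      abel
    · change (hhMatrix ⁅x, y⁆).trace / 2 = _ * _ - _ * _
      rw [ht, mul_comm, sub_self, zero_div]

lemma hhMatrix_eq (x : HH ℂ TwoLoopsAlgebra 1) :
    hhMatrix x = (hhOneHom x).1.1 + (hhOneHom x).2 • 1 := by
  change _ = (hhMatrix x - _) + _
  exact (sub_add_cancel _ _).symm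

/-- The isomorphism of Lie algebras `HH¹(A) ≅ sl₂(ℂ) × ℂ`. -/
def hhOneEquiv : HH ℂ TwoLoopsAlgebra 1 ≃ₗ⁅ℂ⁆ Sl2 × ℂ :=
  LieEquiv.ofBijective hhOneHom (by
    constructor
    · intro x y h
      refine hhMatrix_injective ?_
      rw [hhMatrix_eq x, hhMatrix_eq y, h]
    · rintro ⟨X, c⟩
      obtain ⟨x, hx⟩ := hhMatrix_surjective (X.1 + c • 1)
      have hX : Matrix.trace X.1 = 0 := X.2
      have ht : (hhMatrix x).trace / 2 = c := by
        rw [hx, Matrix.trace_add, hX, Matrix.trace_smul, Matrix.trace_one]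
        simp
      refine ⟨x, Prod.ext (Subtype.ext ?_) ht⟩
      change hhMatrix x - _ • 1 = X.1
      rw [ht, hx, add_sub_cancel_right])

lemma hhMatrix_eq_of_equiv (x : HH ℂ TwoLoopsAlgebra 1) :
    hhMatrix x = (hhOneEquiv x).1.1 + (hhOneEquiv x).2 • 1 := hhMatrix_eq x

lemma apply_loop_eq (D : Z ℂ TwoLoopsAlgebra 1) (j : Fin 2) :
    D.1 (fun _ => loop j) =
      ∑ i, (hhOneEquiv (HH.mk ℂ TwoLoopsAlgebra 1 D)).1.1 i j • loop i +
        (hhOneEquiv (HH.mk ℂ TwoLoopsAlgebra 1 D)).2 • loop j := by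
  have h := toLin_loop_eq_sum D j
  rw [← hhMatrix_mk, hhMatrix_eq_of_equiv] at h
  refine h.trans ?_
  simp only [Matrix.add_apply, Matrix.smul_apply, add_smul, Finset.sum_add_distrib]
  congr 1
  simp [Matrix.one_apply, ite_smul]

/-- The action of a diagonal element of `sl₂(ℂ) × ℂ` on `HHⁿ(A)`. -/
lemma lie_symm_hhTable {n : ℕ} (X : Sl2) (c : ℂ) (μ : Fin 2 → ℂ)
    (h : X.1 + c • 1 = Matrix.diagonal μ) (g : (Fin n → Fin 2) → Fin 2 → ℂ) :
    ⁅hhOneEquiv.symm (X, c), hhTable n g⁆ =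
      hhTable n fun w a => (μ a - ∑ i, μ (w i)) * g w a := by
  obtain ⟨D, hD⟩ := HH.mk_surjective 1 (hhOneEquiv.symm (X, c))
  have hM : matrixZ D = Matrix.diagonal μ := by
    rw [← hhMatrix_mk, hhMatrix_eq_of_equiv, hD, LieEquiv.apply_symm_apply, h]
  rw [← hD]
  refine lie_hhTable_of_diagonal D.2 μ (fun j => ?_) g
  rw [toLin_loop_eq_sum, hM]
  simp [Matrix.diagonal_apply, ite_smul]

/-- The Euler derivation acts on `HHⁿ(A)` by the scalar `1 - n`. -/
lemma lie_euler {n : ℕ} (hn : 1 ≤ n) (m : HH ℂ TwoLoopsAlgebra n) :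
    ⁅hhOneEquiv.symm (0, 1), m⁆ = (1 - (n : ℂ)) • m := by
  obtain ⟨n, rfl⟩ : ∃ k, n = k + 1 := ⟨n - 1, by omega⟩
  obtain ⟨g, rfl⟩ := hhTable_surjective n m
  -- The element `(0, 1)` is the identity matrix, so both eigenvalues are `1`, and every entry over
  -- a word of length `n` has the weight `1 - n`.
  rw [lie_symm_hhTable 0 1 (fun _ => 1) (by simp), ← map_smul]
  congr 1
  ext w a
  simp

end RadSq

end
-- The irreducible modules `V(t)`.
noncomputable section

namespace RadSq

open Module

/-- The element `h` of `sl₂(ℂ)`. -/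
def slH : Sl2 := ⟨!![1, 0; 0, -1], by
  change Matrix.trace !![(1 : ℂ), 0; 0, -1] = 0
  simp [Matrix.trace_fin_two]⟩

/-- The element `e` of `sl₂(ℂ)`. -/
def slE : Sl2 := ⟨!![0, 1; 0, 0], by
  change Matrix.trace !![(0 : ℂ), 1; 0, 0] = 0
  simp [Matrix.trace_fin_two]⟩

/-- The element `f` of `sl₂(ℂ)`. -/
def slF : Sl2 := ⟨!![0, 0; 1, 0], by
  change Matrix.trace !![(0 : ℂ), 0; 1, 0] = 0
  simp [Matrix.trace_fin_two]⟩

lemma isSl2Triple : IsSl2Triple slH slE slF where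
  h_ne_zero h := by
    have := congrFun (congrFun (congrArg Subtype.val h) 0) 0
    exact one_ne_zero (α := ℂ) this
  lie_e_f := by
    refine Subtype.ext ?_
    rw [LieAlgebra.SpecialLinear.sl_bracket]
    ext i j
    fin_cases i <;> fin_cases j <;> simp [slE, slF, slH]
  lie_h_e_nsmul := by
    refine Subtype.ext ?_
    rw [LieAlgebra.SpecialLinear.sl_bracket, two_nsmul]
    ext i j
    fin_cases i <;> fin_cases j <;> simp [slE, slH]
  lie_h_f_nsmul := by
    refine Subtype.ext ?_
    rw [LieAlgebra.SpecialLinear.sl_bracket, two_nsmul]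
    ext i j
    fin_cases i <;> fin_cases j <;> simp [slF, slH]
    norm_num

lemma sl_eq_sum (X : Sl2) : X = X.1 0 1 • slE + X.1 1 0 • slF + X.1 0 0 • slH := by
  have h : X.1 0 0 + X.1 1 1 = 0 := by
    rw [← Matrix.trace_fin_two]
    exact X.2
  refine Subtype.ext ?_
  change X.1 = X.1 0 1 • slE.1 + X.1 1 0 • slF.1 + X.1 0 0 • slH.1
  ext i j
  fin_cases i <;> fin_cases j <;> simp [slE, slF, slH]
  exact eq_neg_of_add_eq_zero_right h

namespace V

open MvPolynomial

/-- A homogeneous polynomial as an element of `V(t)`. -/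
def ofPoly {t : ℕ} (p : MvPolynomial (Fin 2) ℂ) (hp : p ∈ homogeneousSubmodule (Fin 2) ℂ t) :
    V t :=
  ⟨p, hp⟩

/-- The monomial `X₀^{t-b} X₁^b` of `V(t)`; zero for `b > t`. -/
def mon (t b : ℕ) : V t :=
  if h : b ≤ t then
    ofPoly (X 0 ^ (t - b) * X 1 ^ b) (by
      have := ((isHomogeneous_X ℂ (0 : Fin 2)).pow (t - b)).mul ((isHomogeneous_X ℂ 1).pow b)
      rw [mem_homogeneousSubmodule]
      convert this using 1
      omega)
  else 0

variable {t b : ℕ}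

lemma mon_val (h : b ≤ t) : (mon t b).1 = X 0 ^ (t - b) * X 1 ^ b := by
  rw [mon, dif_pos h]
  rfl

lemma lie_val (x : Sl2) (p : V t) : (⁅x, p⁆ : V t).1 = vecField x.1 p.1 := rfl

lemma vecField_mon (M : Matrix (Fin 2) (Fin 2) ℂ) (a b : ℕ) :
    vecField M (X 0 ^ a * X 1 ^ b) =
      (a : ℂ) • (X 0 ^ (a - 1) * X 1 ^ b * (M 0 0 • X 0 + M 1 0 • X 1)) +
      (b : ℂ) • (X 0 ^ a * X 1 ^ (b - 1) * (M 0 1 • X 0 + M 1 1 • X 1)) := by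
  rw [Derivation.leibniz, Derivation.leibniz_pow, Derivation.leibniz_pow, vecField_X, vecField_X]
  simp only [Fin.sum_univ_two, smul_eq_mul, nsmul_eq_mul, smul_eq_C_mul, map_natCast]
  ring

/-- Here `slE` acts as X₀ ∂/∂X₁. For `b = 0` the truncated index `b - 1` is harmless, since the
coefficient is zero. -/
lemma lie_slE_mon (hb : b ≤ t) : ⁅slE, mon t b⁆ = (b : ℂ) • mon t (b - 1) := by
  refine Subtype.ext ?_
  change (⁅slE, mon t b⁆ : V t).1 = (b : ℂ) • (mon t (b - 1)).1
  rw [lie_val, mon_val hb, mon_val (by omega), vecField_mon]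
  simp only [slE, Matrix.of_apply, Matrix.cons_val', Matrix.cons_val_zero, Matrix.cons_val_one,
    Matrix.cons_val_fin_one, zero_smul, add_zero, mul_zero, smul_zero, zero_add, one_smul]
  rcases Nat.eq_zero_or_pos b with rfl | h
  · simp
  · congr 1
    rw [show t - (b - 1) = t - b + 1 by omega]
    ring

/-- Here `slF` acts as X₁ ∂/∂X₀. For `b = t` both the coefficient and `mon t (t + 1)` are zero. -/
lemma lie_slF_mon (hb : b ≤ t) : ⁅slF, mon t b⁆ = ((t : ℂ) - b) • mon t (b + 1) := by
  rcases hb.lt_or_eq with h | rfl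
  · refine Subtype.ext ?_
    change (⁅slF, mon t b⁆ : V t).1 = ((t : ℂ) - b) • (mon t (b + 1)).1
    rw [lie_val, mon_val hb, mon_val (by omega), vecField_mon]
    simp only [slF, Matrix.of_apply, Matrix.cons_val', Matrix.cons_val_zero, Matrix.cons_val_one,
      Matrix.cons_val_fin_one, zero_smul, add_zero, mul_zero, smul_zero, zero_add, one_smul]
    rw [Nat.cast_sub hb, show t - b - 1 = t - (b + 1) by omega]
    congr 1
    ring
  · rw [sub_self, zero_smul]
    refine Subtype.ext ?_
    rw [lie_val, mon_val hb, vecField_mon]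
    simp [slF]
    rfl

lemma lie_slH_mon (hb : b ≤ t) : ⁅slH, mon t b⁆ = ((t : ℂ) - 2 * b) • mon t b := by
  refine Subtype.ext ?_
  change (⁅slH, mon t b⁆ : V t).1 = ((t : ℂ) - 2 * b) • (mon t b).1
  obtain ⟨a, rfl⟩ := Nat.exists_eq_add_of_le hb
  rw [lie_val, mon_val hb, vecField_mon, Nat.add_sub_cancel_left]
  simp only [slH, Matrix.of_apply, Matrix.cons_val', Matrix.cons_val_zero, Matrix.cons_val_one,
    Matrix.cons_val_fin_one, zero_smul, add_zero, zero_add, one_smul]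
  have h1 : (a : ℂ) • (X 0 ^ (a - 1) * X 1 ^ b * X 0 : MvPolynomial (Fin 2) ℂ) =
      (a : ℂ) • (X 0 ^ a * X 1 ^ b) := by
    cases a with
    | zero => simp
    | succ a => rw [Nat.add_sub_cancel]; congr 1; ring
  have h2 : (b : ℂ) • (X 0 ^ a * X 1 ^ (b - 1) * (-1 : ℂ) • X 1 : MvPolynomial (Fin 2) ℂ) =
      (-(b : ℂ)) • (X 0 ^ a * X 1 ^ b) := by
    cases b with
    | zero => simp
    | succ b => rw [Nat.add_sub_cancel, mul_smul_comm, smul_smul, mul_neg_one]; congr 1; ring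
  rw [h1, h2, ← add_smul]
  congr 1
  push_cast
  ring

lemma mon_val_eq_monomial (h : b ≤ t) :
    (mon t b).1 = monomial (Finsupp.single 0 (t - b) + Finsupp.single 1 b) 1 := by
  rw [mon_val h, X_pow_eq_monomial, X_pow_eq_monomial, monomial_mul, one_mul]

/-- The inclusion of `V(t)` into the polynomials. -/
def toPoly (t : ℕ) : V t →ₗ[ℂ] MvPolynomial (Fin 2) ℂ :=
  (homogeneousSubmodule (Fin 2) ℂ t).subtype

lemma toPoly_injective : Function.Injective (toPoly t) := Subtype.val_injective

lemma linearIndependent_mon (t : ℕ) :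
    LinearIndependent ℂ fun b : Fin (t + 1) => mon t b := by
  refine LinearIndependent.of_comp (toPoly t) ?_
  have h := (basisMonomials (Fin 2) ℂ).linearIndependent.comp
    (fun b : Fin (t + 1) => (Finsupp.single 0 (t - b) + Finsupp.single 1 (b : ℕ) : Fin 2 →₀ ℕ)) (by
      intro b b' h
      have := DFunLike.congr_fun h 1
      refine Fin.ext ?_
      simpa using this)
  have e : (toPoly t ∘ fun b : Fin (t + 1) => mon t b) = (basisMonomials (Fin 2) ℂ) ∘
      fun b : Fin (t + 1) => Finsupp.single 0 (t - b) + Finsupp.single 1 (b : ℕ) := by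
    ext1 b
    rw [Function.comp_apply, Function.comp_apply, coe_basisMonomials]
    exact mon_val_eq_monomial (by omega)
  rw [e]
  exact h

lemma span_mon (t : ℕ) : ⊤ ≤ Submodule.span ℂ (Set.range fun b : Fin (t + 1) => mon t b) := by
  rintro p -
  have hp : p.1.IsHomogeneous t := p.2
  have : toPoly t p ∈ (Submodule.span ℂ (Set.range fun b : Fin (t + 1) => mon t b)).map
      (toPoly t) := by
    change p.1 ∈ _
    rw [← support_sum_monomial_coeff p.1]
    refine Submodule.sum_mem _ fun s hs => ?_
    have hd : s.degree = t := by
      rw [Finsupp.degree_eq_weight_one]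
      exact hp (mem_support_iff.1 hs)
    have hd' : s 0 + s 1 = t := by
      rw [← hd, Finsupp.degree_eq_sum (f := s), Fin.sum_univ_two]
    refine ⟨coeff s p.1 • mon t (s 1), Submodule.smul_mem _ _
      (Submodule.subset_span ⟨⟨s 1, by omega⟩, rfl⟩), ?_⟩
    rw [map_smul]
    change _ • (mon t (s 1)).1 = _
    rw [mon_val_eq_monomial (by omega), smul_monomial, smul_eq_mul, mul_one]
    have hs : Finsupp.single 0 (t - s 1) + Finsupp.single 1 (s 1) = s := by
      refine Finsupp.ext fun i => ?_
      fin_cases i <;> simp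
      omega
    rw [hs]
  obtain ⟨q, hq, hqp⟩ := this
  rwa [← toPoly_injective hqp]

/-- The basis of `V(t)` by monomials. -/
def basis (t : ℕ) : Basis (Fin (t + 1)) ℂ (V t) :=
  Basis.mk (linearIndependent_mon t) (span_mon t)

lemma basis_apply (b : Fin (t + 1)) : basis t b = mon t b := Basis.mk_apply _ _ b

lemma finrank_eq (t : ℕ) : finrank ℂ (V t) = t + 1 := by
  rw [finrank_eq_card_basis (basis t), Fintype.card_fin]

/-- The action of `e` on `V(t)`. -/
def raise (t : ℕ) : V t →ₗ[ℂ] V t := LieModule.toEnd ℂ Sl2 (V t) slE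

lemma raise_apply (p : V t) : raise t p = ⁅slE, p⁆ := rfl

lemma raise_pow_mon (hb : b ≤ t) : (raise t ^ (b + 1)) (mon t b) = 0 := by
  induction b with
  | zero => rw [zero_add, pow_one, raise_apply, lie_slE_mon hb, Nat.cast_zero, zero_smul]
  | succ b ih =>
    rw [pow_succ, Module.End.mul_apply, raise_apply, lie_slE_mon hb, map_smul, Nat.add_sub_cancel,
      ih (by omega), smul_zero]

lemma raise_pow_eq_zero {k : ℕ} (hk : t < k) : raise t ^ k = 0 := by
  refine (basis t).ext fun b => ?_
  rw [basis_apply, LinearMap.zero_apply, show k = (k - (b + 1)) + (b + 1) by omega, pow_add,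
    Module.End.mul_apply, raise_pow_mon (by omega), map_zero]

lemma repr_raise (p : V t) (b : ℕ) (hb : b + 1 < t + 1) :
    (basis t).repr (raise t p) ⟨b, by omega⟩ =
      ((b : ℂ) + 1) * (basis t).repr p ⟨b + 1, hb⟩ := by
  have : ((basis t).coord ⟨b, by omega⟩).comp (raise t) =
      ((b : ℂ) + 1) • (basis t).coord ⟨b + 1, hb⟩ := by
    refine (basis t).ext fun c => ?_
    rw [LinearMap.comp_apply, LinearMap.smul_apply, Basis.coord_apply, Basis.coord_apply,
      basis_apply, raise_apply, lie_slE_mon (by omega), map_smul,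
      ← basis_apply (t := t) ⟨(c : ℕ) - 1, by omega⟩, ← basis_apply c, Basis.repr_self,
      Basis.repr_self, Finsupp.smul_apply, Finsupp.single_apply, Finsupp.single_apply]
    simp only [Fin.ext_iff, smul_eq_mul]
    by_cases h : (c : ℕ) = b + 1
    · rw [if_pos (by omega), if_pos h, h]
      push_cast
      rfl
    · rw [if_neg h]
      by_cases h0 : (c : ℕ) = 0
      · rw [h0]; simp
      · rw [if_neg (by omega), mul_zero, mul_zero]
  exact LinearMap.congr_fun this p

/-- The vectors of `V(t)` killed by `e` are the multiples of `X₀^t`. -/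
lemma eq_smul_mon_of_raise_eq_zero (p : V t) (h : raise t p = 0) :
    p = (basis t).repr p 0 • mon t 0 := by
  conv_lhs => rw [← (basis t).sum_repr p]
  rw [Finset.sum_eq_single 0]
  · rw [basis_apply]
    rfl
  · intro b _ hb
    obtain ⟨c, rfl⟩ := Fin.exists_succ_eq.2 hb
    have := repr_raise p c (by omega)
    rw [h, map_zero, Finsupp.zero_apply, eq_comm, mul_eq_zero] at this
    rw [show (basis t).repr p c.succ = 0 from
      this.resolve_left (Nat.cast_add_one_ne_zero _), zero_smul]
  · simp

end V

/-- A nonzero vector has a nonzero image under a power of a nilpotent endomorphism that is killed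
by the endomorphism. -/
lemma exists_pow_apply_ne_zero {M : Type*} [AddCommGroup M] [Module ℂ M] {T : M →ₗ[ℂ] M} {k : ℕ}
    (hT : T ^ k = 0) {v : M} (hv : v ≠ 0) : ∃ j, (T ^ j) v ≠ 0 ∧ T ((T ^ j) v) = 0 := by
  have h : ∃ n, (T ^ n) v = 0 := ⟨k, by rw [hT, LinearMap.zero_apply]⟩
  obtain ⟨n, hn, hn'⟩ := Nat.exists_not_and_succ_of_not_zero_of_exists (p := fun n => (T ^ n) v = 0)
    hv h
  exact ⟨n, hn, by rwa [pow_succ', Module.End.mul_apply] at hn'⟩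

namespace V

variable {t : ℕ}

lemma mon_zero_ne_zero (t : ℕ) : mon t 0 ≠ 0 := (linearIndependent_mon t).ne_zero (0 : Fin (t + 1))

/-- Applying e to a nonzero vector of `N` until the last nonzero image gives a multiple of X₀^t.
From there f reaches every monomial, since its coefficients `t - b` are nonzero for `b < t`. -/
lemma eq_top_of_ne_bot (N : LieSubmodule ℂ Sl2 (V t)) (hN : N ≠ ⊥) : N = ⊤ := by
  obtain ⟨v, hv, hv0⟩ : ∃ v ∈ N, v ≠ 0 := by
    by_contra! h
    exact hN ((LieSubmodule.eq_bot_iff N).2 h)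
  obtain ⟨j, hj, hj'⟩ := exists_pow_apply_ne_zero (raise_pow_eq_zero (Nat.lt_succ_self t)) hv0
  have hjN : (raise t ^ j) v ∈ N := by
    clear hj hj'
    induction j with
    | zero => exact hv
    | succ j ih =>
      rw [pow_succ', Module.End.mul_apply]
      exact N.lie_mem ih
  have e := eq_smul_mon_of_raise_eq_zero _ hj'
  have hc : (basis t).repr ((raise t ^ j) v) 0 ≠ 0 := by
    intro h
    rw [h, zero_smul] at e
    exact hj e
  have h0 : mon t 0 ∈ N := by
    rw [e] at hjN
    exact (N.toSubmodule.smul_mem_iff hc).1 hjN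
  have hmon : ∀ b ≤ t, mon t b ∈ N := by
    intro b
    induction b with
    | zero => exact fun _ => h0
    | succ b ih =>
      intro hb
      have := N.lie_mem (x := slF) (ih (by omega))
      rw [lie_slF_mon (by omega)] at this
      refine (N.toSubmodule.smul_mem_iff ?_).1 this
      rw [sub_ne_zero, Ne, Nat.cast_inj]
      omega
  rw [eq_top_iff]
  rintro p -
  change p ∈ N.toSubmodule
  rw [← (basis t).sum_repr p]
  refine Submodule.sum_mem _ fun b _ => Submodule.smul_mem _ _ ?_
  rw [basis_apply]
  exact hmon b (by omega)

instance isIrreducible (t : ℕ) : LieModule.IsIrreducible ℂ Sl2 (V t) := by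
  have : Nontrivial (V t) := ⟨⟨_, _, mon_zero_ne_zero t⟩⟩
  exact LieModule.IsIrreducible.mk eq_top_of_ne_bot

end V

end RadSq

end
-- Surjectivity of e onto positive weights, and spaces of vectors of a given weight.
noncomputable section

namespace RadSq

open Module

section Surjectivity

variable {M : Type*} [AddCommGroup M] [Module ℂ M] [LieRingModule Sl2 M] [LieModule ℂ Sl2 M]
  [FiniteDimensional ℂ M]

/-- In a finite dimensional module every vector of positive weight is in the image of `e`. -/
lemma exists_lie_eq {h e f : Sl2} (t : IsSl2Triple h e f) (k : ℕ) (y : M)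
    (hy : ⁅h, y⁆ = ((k : ℂ) + 1) • y) : ∃ x : M, ⁅e, x⁆ = y := by
  set E : M →ₗ[ℂ] M := LieModule.toEnd ℂ Sl2 M e with hE
  set H : M →ₗ[ℂ] M := LieModule.toEnd ℂ Sl2 M h - ((k : ℂ) + 1) • LinearMap.id with hH
  have hHE : ∀ x, H (E x) = E (H x + (2 : ℂ) • x) := by
    intro x
    change ⁅h, ⁅e, x⁆⁆ - ((k : ℂ) + 1) • ⁅e, x⁆ = ⁅e, ⁅h, x⁆ - ((k : ℂ) + 1) • x + (2 : ℂ) • x⁆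
    rw [leibniz_lie, t.lie_h_e_smul ℂ, lie_add, lie_sub, lie_smul, lie_smul, smul_lie]
    abel
  have hHy : H y = 0 := by
    change ⁅h, y⁆ - ((k : ℂ) + 1) • y = 0
    rw [hy, sub_self]
  -- `H` descends to the cokernel of `E` and kills the class of `y`. If it is surjective there, it
  -- is injective by finite dimension, and `y` lies in the image of `E`.
  by_cases htop : LinearMap.range E ⊔ LinearMap.range H = ⊤
  · have hle : LinearMap.range E ≤ (LinearMap.range E).comap H := by
      rintro _ ⟨x, rfl⟩
      exact ⟨_, (hHE x).symm⟩
    have hsurj : Function.Surjective ((LinearMap.range E).mapQ (LinearMap.range E) H hle) := by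
      intro q
      obtain ⟨m, rfl⟩ := Submodule.Quotient.mk_surjective _ q
      have hm : m ∈ LinearMap.range E ⊔ LinearMap.range H := htop ▸ Submodule.mem_top
      obtain ⟨a, ha, _, ⟨b, rfl⟩, rfl⟩ := Submodule.mem_sup.1 hm
      refine ⟨Submodule.Quotient.mk b, ?_⟩
      rw [Submodule.mapQ_apply, eq_comm, Submodule.Quotient.eq, add_sub_cancel_right]
      exact ha
    have hinj := LinearMap.injective_iff_surjective.2 hsurj
    have : Submodule.Quotient.mk (p := LinearMap.range E) y = 0 := by
      refine hinj ?_
      rw [Submodule.mapQ_apply, hHy, map_zero]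
      rfl
    exact (Submodule.Quotient.mk_eq_zero _).1 this
  -- Otherwise a nonzero functional vanishes on both images. In the dual module it is a primitive
  -- vector of the negative weight `-(k + 1)`, which finite dimension excludes.
  · obtain ⟨φ, hφ, hle⟩ := Submodule.exists_le_ker_of_lt_top _ (lt_top_iff_ne_top.2 htop)
    have P : t.HasPrimitiveVectorWith (φ : Dual ℂ M) (-((k : ℂ) + 1)) := by
      refine ⟨hφ, ?_, ?_⟩
      · ext x
        have h0 : φ (⁅h, x⁆ - ((k : ℂ) + 1) • x) = 0 :=
          hle (Submodule.mem_sup_right ⟨x, rfl⟩)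
        rw [map_sub, map_smul, sub_eq_zero] at h0
        rw [Module.Dual.lie_apply, h0, LinearMap.smul_apply, neg_smul]
      · ext x
        have h0 : φ ⁅e, x⁆ = 0 := hle (Submodule.mem_sup_left ⟨x, rfl⟩)
        rw [Module.Dual.lie_apply, h0, neg_zero, LinearMap.zero_apply]
    obtain ⟨m, hm⟩ := P.exists_nat
    have : ((m + k + 1 : ℕ) : ℂ) = 0 := by
      push_cast
      rw [← hm]
      ring
    exact absurd this (Nat.cast_ne_zero.2 (by omega))

end Surjectivity

section Support

variable {M ι : Type*} [AddCommGroup M] [Module ℂ M] [Fintype ι] (b : Basis ι ℂ M)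

/-- The part of a vector supported on the basis vectors with a given property. -/
def part (P : ι → Prop) [DecidablePred P] (v : M) : M := ∑ i, if P i then b.repr v i • b i else 0

lemma repr_part (P : ι → Prop) [DecidablePred P] (v : M) (i : ι) :
    b.repr (part b P v) i = if P i then b.repr v i else 0 := by
  classical
  rw [part, map_sum, Finsupp.finsetSum_apply, Finset.sum_eq_single i]
  · split_ifs <;> simp
  · intro j _ hj
    split_ifs
    · simp [hj]
    · simp
  · simp

lemma repr_apply_eq_sum (T : M →ₗ[ℂ] M) (v : M) (k : ι) :
    b.repr (T v) k = ∑ i, b.repr v i * b.repr (T (b i)) k := by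
  conv_lhs => rw [← b.sum_repr v]
  rw [map_sum, map_sum, Finsupp.finsetSum_apply]
  simp

/-- An endomorphism that maps basis vectors to combinations of corresponding ones commutes with
taking parts. -/
lemma apply_part (T : M →ₗ[ℂ] M) (P Q : ι → Prop) [DecidablePred P] [DecidablePred Q]
    (h : ∀ i k, b.repr (T (b i)) k ≠ 0 → (P i ↔ Q k)) (v : M) :
    T (part b P v) = part b Q (T v) := by
  refine b.ext_elem fun k => ?_
  rw [repr_part, repr_apply_eq_sum, repr_apply_eq_sum]
  simp only [repr_part]
  split_ifs with hk
  · refine Finset.sum_congr rfl fun i _ => ?_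
    split_ifs with hi
    · rfl
    · rw [zero_mul, eq_comm, mul_eq_zero]
      by_contra! h0
      exact hi ((h i k h0.2).2 hk)
  · refine Finset.sum_eq_zero fun i _ => ?_
    split_ifs with hi
    · rw [mul_eq_zero]
      by_contra! h0
      exact hk ((h i k h0.2).1 hi)
    · rw [zero_mul]

lemma part_eq_self {P : ι → Prop} [DecidablePred P] {v : M} (h : ∀ i, ¬ P i → b.repr v i = 0) :
    part b P v = v := by
  refine b.ext_elem fun k => ?_
  rw [repr_part]
  split_ifs with hk
  · rfl
  · exact (h k hk).symm

end Support

section Levels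

variable {M ι : Type*} [AddCommGroup M] [Module ℂ M] (b : Basis ι ℂ M) (lev : ι → ℕ)

/-- The span of the basis vectors of a given level. -/
def levelSpace (l : ℕ) : Submodule ℂ M :=
  Submodule.span ℂ (Set.range fun i : {i // lev i = l} => b i)

lemma mem_levelSpace_iff {l : ℕ} {v : M} :
    v ∈ levelSpace b lev l ↔ ∀ i, lev i ≠ l → b.repr v i = 0 := by
  have : (Set.range fun i : {i // lev i = l} => b i) = b '' {i | lev i = l} := by
    rw [Set.image_eq_range]
    rfl
  rw [levelSpace, this, Basis.mem_span_image]
  constructor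
  · intro h i hi
    by_contra h0
    exact hi (h (Finsupp.mem_support_iff.2 h0))
  · intro h i hi
    by_contra h0
    exact Finsupp.mem_support_iff.1 hi (h i h0)

/-- The vectors of different levels are independent. -/
lemma eq_zero_of_sum_eq_zero {κ : Type*} [Fintype κ] {l : κ → ℕ} (hl : Function.Injective l)
    {v : κ → M} (hv : ∀ a, v a ∈ levelSpace b lev (l a)) (h : ∑ a, v a = 0) (a : κ) : v a = 0 := by
  refine b.ext_elem fun i => ?_
  rw [map_zero, Finsupp.zero_apply]
  by_cases hi : lev i = l a
  · have := congrArg (fun u => b.repr u i) h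
    rw [map_sum, Finsupp.finsetSum_apply, Finset.sum_eq_single a, map_zero] at this
    · exact this
    · intro a' _ ha'
      exact (mem_levelSpace_iff b lev).1 (hv a') i fun h' => ha' (hl (h'.symm.trans hi))
    · simp
  · exact (mem_levelSpace_iff b lev).1 (hv a) i hi

variable [Fintype ι]

lemma finrank_levelSpace (l : ℕ) :
    finrank ℂ (levelSpace b lev l) = Fintype.card {i // lev i = l} :=
  finrank_span_eq_card (b.linearIndependent.comp _ Subtype.val_injective)

lemma part_mem_levelSpace (l : ℕ) (v : M) : part b (fun i => lev i = l) v ∈ levelSpace b lev l := by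
  rw [mem_levelSpace_iff]
  intro i hi
  rw [repr_part, if_neg hi]

lemma part_of_mem_levelSpace {l : ℕ} {v : M} (hv : v ∈ levelSpace b lev l) :
    part b (fun i => lev i = l) v = v :=
  part_eq_self b ((mem_levelSpace_iff b lev).1 hv)

lemma mem_of_forall_levelSpace_le {R : Submodule ℂ M} (h : ∀ l, levelSpace b lev l ≤ R) (v : M) :
    v ∈ R := by
  rw [← b.sum_repr v]
  exact Submodule.sum_mem _ fun i _ =>
    Submodule.smul_mem _ _ (h (lev i) (Submodule.subset_span ⟨⟨i, rfl⟩, rfl⟩))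

variable [LieRingModule Sl2 M]

/-- The basis vectors are weight vectors, those of level `l` having the weight `N - 2 l`. -/
def IsWeightBasis (N : ℕ) : Prop := ∀ i, ⁅slH, b i⁆ = ((N : ℂ) - 2 * lev i) • b i

variable [LieModule ℂ Sl2 M] {N : ℕ}

/-- The action of `e` on the vectors of a given level. -/
def raiseLevel (l : ℕ) : levelSpace b lev l →ₗ[ℂ] M :=
  (LieModule.toEnd ℂ Sl2 M slE).domRestrict (levelSpace b lev l)

lemma repr_lie_slH (hb : IsWeightBasis b lev N) (v : M) (i : ι) :
    b.repr ⁅slH, v⁆ i = ((N : ℂ) - 2 * lev i) * b.repr v i := by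
  classical
  have := repr_apply_eq_sum b (LieModule.toEnd ℂ Sl2 M slH) v i
  rw [LieModule.toEnd_apply_apply] at this
  rw [this, Finset.sum_eq_single i]
  · rw [LieModule.toEnd_apply_apply, hb _]
    simp [mul_comm]
  · intro j _ hj
    rw [LieModule.toEnd_apply_apply, hb _]
    simp [hj]
  · simp

lemma weight_eq_of_repr_ne_zero (hb : IsWeightBasis b lev N) {v : M} {c : ℂ}
    (hv : ⁅slH, v⁆ = c • v) {i : ι} (hi : b.repr v i ≠ 0) : c = (N : ℂ) - 2 * lev i := by
  have := repr_lie_slH b lev hb v i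
  rw [hv, map_smul, Finsupp.smul_apply, smul_eq_mul] at this
  exact mul_right_cancel₀ hi this

lemma mem_levelSpace_iff_lie (hb : IsWeightBasis b lev N) {l : ℕ} {v : M} :
    v ∈ levelSpace b lev l ↔ ⁅slH, v⁆ = ((N : ℂ) - 2 * l) • v := by
  constructor
  · intro hv
    refine b.ext_elem fun i => ?_
    rw [repr_lie_slH b lev hb, map_smul, Finsupp.smul_apply, smul_eq_mul]
    by_cases hi : lev i = l
    · rw [hi]
    · rw [(mem_levelSpace_iff b lev).1 hv i hi, mul_zero, mul_zero]
  · intro hv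
    rw [mem_levelSpace_iff]
    intro i hi
    by_contra h0
    have := weight_eq_of_repr_ne_zero b lev hb hv h0
    rw [sub_right_inj, mul_right_inj' two_ne_zero, Nat.cast_inj] at this
    exact hi this.symm

/-- Raising the weight by 2 lowers the level by one, as level `l` has weight `N - 2 l`. -/
lemma lev_of_repr_lie_slE (hb : IsWeightBasis b lev N) {i k : ι} (h : b.repr ⁅slE, b i⁆ k ≠ 0) :
    lev i = lev k + 1 := by
  have h1 : ⁅slH, ⁅slE, b i⁆⁆ = ((N : ℂ) - 2 * lev i + 2) • ⁅slE, b i⁆ := by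
    rw [leibniz_lie, isSl2Triple.lie_h_e_smul ℂ, hb _, smul_lie, lie_smul, ← add_smul, add_comm]
  have h2 := weight_eq_of_repr_ne_zero b lev hb h1 h
  have h3 : (2 : ℂ) * lev i = 2 * ((lev k + 1 : ℕ) : ℂ) := by
    push_cast
    linear_combination -h2
  rw [mul_right_inj' two_ne_zero, Nat.cast_inj] at h3
  exact h3

lemma lev_of_repr_lie_slF (hb : IsWeightBasis b lev N) {i k : ι} (h : b.repr ⁅slF, b i⁆ k ≠ 0) :
    lev k = lev i + 1 := by
  have h1 : ⁅slH, ⁅slF, b i⁆⁆ = ((N : ℂ) - 2 * lev i - 2) • ⁅slF, b i⁆ := by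
    rw [leibniz_lie, isSl2Triple.lie_lie_smul_f ℂ, hb _, neg_lie, smul_lie, lie_smul, sub_smul _ 2]
    abel
  have h2 := weight_eq_of_repr_ne_zero b lev hb h1 h
  have h3 : (2 : ℂ) * lev k = 2 * ((lev i + 1 : ℕ) : ℂ) := by
    push_cast
    linear_combination h2
  rw [mul_right_inj' two_ne_zero, Nat.cast_inj] at h3
  exact h3

lemma lie_slE_part (hb : IsWeightBasis b lev N) (l : ℕ) (v : M) :
    ⁅slE, part b (fun i => lev i = l + 1) v⁆ = part b (fun i => lev i = l) ⁅slE, v⁆ :=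
  apply_part b (LieModule.toEnd ℂ Sl2 M slE) _ _ (fun i k h => by
    have := lev_of_repr_lie_slE b lev hb h
    omega) v

lemma lie_slF_part (hb : IsWeightBasis b lev N) (l : ℕ) (v : M) :
    ⁅slF, part b (fun i => lev i = l) v⁆ = part b (fun i => lev i = l + 1) ⁅slF, v⁆ :=
  apply_part b (LieModule.toEnd ℂ Sl2 M slF) _ _ (fun i k h => by
    have := lev_of_repr_lie_slF b lev hb h
    omega) v

lemma lie_slE_mem (hb : IsWeightBasis b lev N) {l : ℕ} {v : M} (hv : v ∈ levelSpace b lev (l + 1)) :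
    ⁅slE, v⁆ ∈ levelSpace b lev l := by
  rw [← part_of_mem_levelSpace b lev hv, lie_slE_part b lev hb]
  exact part_mem_levelSpace b lev l _

lemma lie_slE_eq_zero (hb : IsWeightBasis b lev N) {v : M} (hv : v ∈ levelSpace b lev 0) : ⁅slE, v⁆ = 0 := by
  rw [← part_of_mem_levelSpace b lev hv]
  refine (apply_part b (LieModule.toEnd ℂ Sl2 M slE) (fun i => lev i = 0) (fun _ => False)
    (fun i k h => ?_) v).trans ?_
  · have := lev_of_repr_lie_slE b lev hb h
    exact iff_of_false (by omega) id
  · simp [part]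

/-- The bound on `l` says that level `l` has positive weight. A preimage under e exists by
`exists_lie_eq`, and its component of level `l + 1` is still a preimage. -/
lemma exists_mem_lie_slE_eq (hb : IsWeightBasis b lev N) [FiniteDimensional ℂ M]
    {l : ℕ} (hl : 2 * l + 1 ≤ N) {y : M}
    (hy : y ∈ levelSpace b lev l) : ∃ x ∈ levelSpace b lev (l + 1), ⁅slE, x⁆ = y := by
  obtain ⟨x, hx⟩ := exists_lie_eq isSl2Triple (N - 2 * l - 1) y (by
    rw [(mem_levelSpace_iff_lie b lev hb).1 hy]
    congr 1
    rw [Nat.cast_sub (by omega), Nat.cast_sub (by omega)]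
    push_cast
    ring)
  refine ⟨_, part_mem_levelSpace b lev (l + 1) x, ?_⟩
  rw [lie_slE_part b lev hb, hx, part_of_mem_levelSpace b lev hy]

/-- The same argument for the triple (-h, f, e): below weight zero it is f that is surjective onto
the weight spaces. -/
lemma exists_mem_lie_slF_eq (hb : IsWeightBasis b lev N) [FiniteDimensional ℂ M]
    {l : ℕ} (hl : N + 1 ≤ 2 * (l + 1)) {y : M}
    (hy : y ∈ levelSpace b lev (l + 1)) : ∃ x ∈ levelSpace b lev l, ⁅slF, x⁆ = y := by
  obtain ⟨x, hx⟩ := exists_lie_eq isSl2Triple.symm (2 * (l + 1) - N - 1) y (by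
    rw [neg_lie, (mem_levelSpace_iff_lie b lev hb).1 hy, ← neg_smul]
    congr 1
    rw [Nat.cast_sub (by omega), Nat.cast_sub (by omega)]
    push_cast
    ring)
  refine ⟨_, part_mem_levelSpace b lev l x, ?_⟩
  rw [lie_slF_part b lev hb, hx, part_of_mem_levelSpace b lev hy]

lemma finrank_ker_raiseLevel_zero (hb : IsWeightBasis b lev N) [FiniteDimensional ℂ M] :
    finrank ℂ (LinearMap.ker (raiseLevel b lev 0)) = Fintype.card {i // lev i = 0} := by
  have : LinearMap.ker (raiseLevel b lev 0) = ⊤ := by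
    rw [LinearMap.ker_eq_top]
    ext v
    exact lie_slE_eq_zero b lev hb v.2
  rw [this, finrank_top, finrank_levelSpace]

/-- Rank and nullity for e from level `l + 1` onto level `l`: the primitive vectors of level `l + 1`
are counted by the growth of the weight multiplicities. -/
lemma finrank_ker_raiseLevel_succ (hb : IsWeightBasis b lev N) [FiniteDimensional ℂ M]
    {l : ℕ} (hl : 2 * l + 1 ≤ N) :
    Fintype.card {i // lev i = l} + finrank ℂ (LinearMap.ker (raiseLevel b lev (l + 1))) =
      Fintype.card {i // lev i = l + 1} := by
  have : LinearMap.range (raiseLevel b lev (l + 1)) = levelSpace b lev l := by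
    refine le_antisymm ?_ ?_
    · rintro _ ⟨v, rfl⟩
      exact lie_slE_mem b lev hb v.2
    · intro y hy
      obtain ⟨x, hx, rfl⟩ := exists_mem_lie_slE_eq b lev hb hl hy
      exact ⟨⟨x, hx⟩, rfl⟩
  rw [← finrank_levelSpace b, ← finrank_levelSpace b, ← this]
  exact LinearMap.finrank_range_add_finrank_ker _

end Levels

end RadSq

end
-- Decomposition of an sl₂-module with a given basis of weight vectors.
noncomputable section

namespace RadSq

open Module

section PrimitiveVectors

variable {M : Type*} [AddCommGroup M] [Module ℂ M] [LieRingModule Sl2 M] [LieModule ℂ Sl2 M]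

/-- The map from `V(t)` that sends `X₀^t` to a given vector and commutes with `f`. -/
def primHom (t : ℕ) (p : M) : V t →ₗ[ℂ] M :=
  (V.basis t).constr ℂ fun b =>
    -- In `V(t)` one has f^b X₀^t = t!/(t-b)! · X₀^{t-b} X₁^b, which dictates the coefficient.
    (((t - b).factorial : ℂ) / t.factorial) • ((LieModule.toEnd ℂ Sl2 M slF) ^ (b : ℕ)) p

lemma primHom_mon {t b : ℕ} (p : M) (hb : b ≤ t) :
    primHom t p (V.mon t b) =
      (((t - b).factorial : ℂ) / t.factorial) • ((LieModule.toEnd ℂ Sl2 M slF) ^ b) p := by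
  rw [← V.basis_apply (t := t) ⟨b, by omega⟩, primHom, Basis.constr_basis]

lemma primHom_mon_zero (t : ℕ) (p : M) : primHom t p (V.mon t 0) = p := by
  rw [primHom_mon p (Nat.zero_le t), Nat.sub_zero, div_self, pow_zero, one_smul,
    Module.End.one_apply]
  exact_mod_cast t.factorial_ne_zero

variable [FiniteDimensional ℂ M]

/-- It is enough to compare e, f and h on monomials. The standard formulas for the string of a
primitive vector of weight `t` match those in `V(t)`, the end of the string being f^{t+1} p = 0 by
finite dimension. -/
lemma primHom_lie {t : ℕ} {p : M} (P : isSl2Triple.HasPrimitiveVectorWith p (t : ℂ)) (x : Sl2)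
    (v : V t) : primHom t p ⁅x, v⁆ = ⁅x, primHom t p v⁆ := by
  have key : ∀ y : Sl2, (∀ b ≤ t, primHom t p ⁅y, V.mon t b⁆ = ⁅y, primHom t p (V.mon t b)⁆) →
      ∀ v : V t, primHom t p ⁅y, v⁆ = ⁅y, primHom t p v⁆ := by
    intro y hy v
    have : (primHom t p).comp (LieModule.toEnd ℂ Sl2 (V t) y) =
        (LieModule.toEnd ℂ Sl2 M y).comp (primHom t p) := by
      refine (V.basis t).ext fun b => ?_
      rw [V.basis_apply]
      exact hy b (by omega)
    exact LinearMap.congr_fun this v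
  have hE := key slE fun b hb => by
    rw [V.lie_slE_mon hb, map_smul, primHom_mon p hb, primHom_mon p (by omega), lie_smul]
    cases b with
    | zero => rw [Nat.cast_zero, zero_smul, pow_zero, Module.End.one_apply, P.lie_e, smul_zero]
    | succ b =>
      rw [P.lie_e_pow_succ_toEnd_f, Nat.add_sub_cancel, smul_smul, smul_smul]
      congr 1
      rw [show t - b = t - (b + 1) + 1 by omega, Nat.factorial_succ]
      push_cast [Nat.cast_sub hb]
      ring
  have hF := key slF fun b hb => by
    rw [V.lie_slF_mon hb, map_smul, primHom_mon p hb, lie_smul, P.lie_f_pow_toEnd_f]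
    rcases hb.lt_or_eq with h | rfl
    · rw [primHom_mon p (by omega), smul_smul]
      congr 1
      rw [show t - b = t - (b + 1) + 1 by omega, Nat.factorial_succ]
      push_cast [Nat.cast_sub (show b + 1 ≤ t by omega)]
      ring
    · rw [sub_self, zero_smul, P.pow_toEnd_f_eq_zero_of_eq_nat rfl, smul_zero]
  have hH := key slH fun b hb => by
    rw [V.lie_slH_mon hb, map_smul, primHom_mon p hb, lie_smul, P.lie_h_pow_toEnd_f, smul_comm]
  rw [sl_eq_sum x]
  simp only [add_lie, smul_lie, map_add, map_smul, hE, hF, hH]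

end PrimitiveVectors

section Decomposition

variable {M ι : Type*} [AddCommGroup M] [Module ℂ M] [Fintype ι] [LieRingModule Sl2 M]
  [LieModule ℂ Sl2 M] [FiniteDimensional ℂ M] {b : Basis ι ℂ M} {lev : ι → ℕ} {N : ℕ} {q : ℕ → ℕ}

lemma finrank_ker_raiseLevel (hb : IsWeightBasis b lev N)
    (h0 : Fintype.card {i // lev i = 0} = q 0)
    (hs : ∀ l, 2 * (l + 1) ≤ N →
      Fintype.card {i // lev i = l + 1} = Fintype.card {i // lev i = l} + q (l + 1))
    {l : ℕ} (hl : 2 * l ≤ N) : finrank ℂ (LinearMap.ker (raiseLevel b lev l)) = q l := by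
  cases l with
  | zero => rw [finrank_ker_raiseLevel_zero b lev hb, h0]
  | succ l =>
    have := finrank_ker_raiseLevel_succ b lev hb (l := l) (by omega)
    have := hs l hl
    omega

/-- A finite dimensional module with a basis of weight vectors is a direct sum of modules `V(t)`,
with multiplicities given by the differences of the dimensions of the weight spaces. -/
theorem exists_equiv_pi (hb : IsWeightBasis b lev N)
    (h0 : Fintype.card {i // lev i = 0} = q 0)
    (hs : ∀ l, 2 * (l + 1) ≤ N →
      Fintype.card {i // lev i = l + 1} = Fintype.card {i // lev i = l} + q (l + 1)) :
    ∃ Ψ : ((l : Fin (N / 2 + 1)) → Fin (q l) → V (N - 2 * l)) ≃ₗ[ℂ] M,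
      ∀ (x : Sl2) y, Ψ (fun l i => ⁅x, y l i⁆) = ⁅x, Ψ y⁆ := by
  have hl : ∀ l : Fin (N / 2 + 1), 2 * (l : ℕ) ≤ N := fun l => by omega
  -- For each level of nonnegative weight, a basis of its primitive vectors. Each basis vector will
  -- generate one summand.
  let B : (l : Fin (N / 2 + 1)) → Basis (Fin (q l)) ℂ (LinearMap.ker (raiseLevel b lev l)) :=
    fun l => finBasisOfFinrankEq _ _ (finrank_ker_raiseLevel hb h0 hs (hl l))
  let p : (l : Fin (N / 2 + 1)) → Fin (q l) → M := fun l i => (B l i).1.1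
  have hB : ∀ (l : Fin (N / 2 + 1)) (c : Fin (q l) → ℂ),
      (∑ i, c i • B l i).1.1 = ∑ i, c i • p l i := fun l c => by
    simp [p]
  have hpl : ∀ (l : Fin (N / 2 + 1)) i, p l i ∈ levelSpace b lev l := fun l i => (B l i).1.2
  have hpE : ∀ l i, ⁅slE, p l i⁆ = 0 := fun l i => (B l i).2
  have hP : ∀ l i, isSl2Triple.HasPrimitiveVectorWith (p l i) ((N - 2 * (l : ℕ) : ℕ) : ℂ) :=
    fun l i => by
      refine ⟨fun h => (B l).ne_zero i (Subtype.ext (Subtype.ext h)), ?_, hpE l i⟩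
      rw [(mem_levelSpace_iff_lie b lev hb).1 (hpl l i), Nat.cast_sub (hl l)]
      push_cast
      rfl
  let ev : (l : Fin (N / 2 + 1)) → (i : Fin (q l)) →
      ((l : Fin (N / 2 + 1)) → Fin (q l) → V (N - 2 * l)) →ₗ[ℂ] V (N - 2 * l) := fun l i =>
    { toFun := fun y => y l i
      map_add' := fun _ _ => rfl
      map_smul' := fun _ _ => rfl }
  let Ψ : ((l : Fin (N / 2 + 1)) → Fin (q l) → V (N - 2 * l)) →ₗ[ℂ] M :=
    ∑ l, ∑ i, (primHom _ (p l i)).comp (ev l i)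
  have hΨ : ∀ y, Ψ y = ∑ l, ∑ i, primHom _ (p l i) (y l i) := fun y => by
    simp [Ψ, ev, LinearMap.sum_apply]
  have hlie : ∀ (x : Sl2) y, Ψ (fun l i => ⁅x, y l i⁆) = ⁅x, Ψ y⁆ := by
    intro x y
    rw [hΨ, hΨ, lie_sum]
    refine Finset.sum_congr rfl fun l _ => ?_
    rw [lie_sum]
    exact Finset.sum_congr rfl fun i _ => primHom_lie (hP l i) x _
  have hinj : Function.Injective Ψ := by
    rw [injective_iff_map_eq_zero]
    intro y hy
    by_contra hy0
    let T : ((l : Fin (N / 2 + 1)) → Fin (q l) → V (N - 2 * l)) →ₗ[ℂ]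
        ((l : Fin (N / 2 + 1)) → Fin (q l) → V (N - 2 * l)) :=
      LinearMap.pi fun l => LinearMap.pi fun i => (V.raise _).comp (ev l i)
    have hT : ∀ (j : ℕ) y l i, (T ^ j) y l i = (V.raise _ ^ j) (y l i) := by
      intro j
      induction j with
      | zero => exact fun _ _ _ => rfl
      | succ j ih =>
        intro y l i
        rw [pow_succ, pow_succ, Module.End.mul_apply, Module.End.mul_apply, ih]
        rfl
    have hT0 : T ^ (N + 1) = 0 := by
      refine LinearMap.ext fun y => ?_
      funext l i
      rw [hT, V.raise_pow_eq_zero (by omega)]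
      rfl
    -- The kernel of `Ψ` is stable under e. Replacing `y` by its last nonzero image under powers of
    -- e makes every component a multiple of X₀^t, so `Ψ` yields a relation between the chosen
    -- primitive vectors. These are independent within a level and across levels.
    obtain ⟨j, hj, hj'⟩ := exists_pow_apply_ne_zero hT0 hy0
    have hz : ∀ j, Ψ ((T ^ j) y) = 0 := by
      intro j
      induction j with
      | zero => exact hy
      | succ j ih =>
        rw [pow_succ', Module.End.mul_apply]
        exact (hlie slE _).trans ((congrArg _ ih).trans (lie_zero _))
    refine hj ?_
    set z := (T ^ j) y with hzdef
    have hc : ∀ l i, z l i = (V.basis _).repr (z l i) 0 • V.mon _ 0 := fun l i =>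
      V.eq_smul_mon_of_raise_eq_zero _ (congrFun (congrFun hj' l) i)
    have hsum : ∑ l, (∑ i, (V.basis _).repr (z l i) 0 • p l i) = 0 := by
      rw [← hz j, hΨ]
      refine Finset.sum_congr rfl fun l _ => Finset.sum_congr rfl fun i _ => ?_
      conv_rhs => rw [← hzdef, hc l i]
      rw [map_smul, primHom_mon_zero]
    funext l i
    have hsl := eq_zero_of_sum_eq_zero b lev (l := fun l : Fin (N / 2 + 1) => (l : ℕ))
      Fin.val_injective (fun l => Submodule.sum_mem _ fun i _ => Submodule.smul_mem _ _ (hpl l i))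
      hsum l
    have hB0 : ∑ i, (V.basis _).repr (z l i) 0 • B l i = 0 :=
      Subtype.ext (Subtype.ext ((hB l _).trans hsl))
    have := Fintype.linearIndependent_iff.1 (B l).linearIndependent _ hB0 i
    rw [hc l i, this, zero_smul]
    rfl
  have hsurj : Function.Surjective Ψ := by
    have hprim : ∀ l, ∀ v ∈ levelSpace b lev l, ⁅slE, v⁆ = 0 → v ∈ LinearMap.range Ψ := by
      intro l v hv hv'
      by_cases h : 2 * l ≤ N
      · let l' : Fin (N / 2 + 1) := ⟨l, by omega⟩
        have e : ∀ u : LinearMap.ker (raiseLevel b lev l'),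
            u.1.1 = ∑ i, (B l').repr u i • p l' i := fun u =>
          (congrArg (fun w => w.1.1) ((B l').sum_repr u).symm).trans (hB _ _)
        have e' : v = _ := e ⟨⟨v, hv⟩, hv'⟩
        rw [e']
        refine Submodule.sum_mem _ fun i _ => Submodule.smul_mem _ _ ?_
        refine ⟨Pi.single l' (Pi.single i (V.mon _ 0)), ?_⟩
        rw [hΨ, Finset.sum_eq_single l', Finset.sum_eq_single i, Pi.single_eq_same,
          Pi.single_eq_same, primHom_mon_zero]
        · intro i' _ hi'
          rw [Pi.single_eq_same, Pi.single_eq_of_ne hi', map_zero]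
        · simp
        · intro l'' _ hl''
          rw [Pi.single_eq_of_ne hl'']
          simp
        · simp
      -- A nonzero vector here would be primitive of negative weight, which is impossible.
      · by_cases hv0 : v = 0
        · rw [hv0]
          exact Submodule.zero_mem _
        · have P : isSl2Triple.HasPrimitiveVectorWith v ((N : ℂ) - 2 * l) :=
            ⟨hv0, (mem_levelSpace_iff_lie b lev hb).1 hv, hv'⟩
          obtain ⟨m, hm⟩ := P.exists_nat
          have : ((N : ℕ) : ℂ) = ((m + 2 * l : ℕ) : ℂ) := by
            push_cast
            linear_combination hm
          rw [Nat.cast_inj] at this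
          omega
    have hker : ∀ v : M, ⁅slE, v⁆ = 0 → v ∈ LinearMap.range Ψ := by
      intro v hv
      -- Since e shifts levels, each weight component of a vector killed by e is itself killed by e.
      have hpart : ∀ l, part b (fun i => lev i = l) v ∈ LinearMap.range Ψ := by
        intro l
        refine hprim l _ (part_mem_levelSpace b lev l v) ?_
        cases l with
        | zero => exact lie_slE_eq_zero b lev hb (part_mem_levelSpace b lev 0 v)
        | succ l =>
          rw [lie_slE_part b lev hb, hv]
          simp [part]
      have : v = ∑ l ∈ Finset.univ.image lev, part b (fun i => lev i = l) v := by
        refine b.ext_elem fun i => ?_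
        rw [map_sum, Finsupp.finsetSum_apply]
        simp only [repr_part]
        rw [Finset.sum_ite_eq, if_pos (Finset.mem_image_of_mem lev (Finset.mem_univ i))]
      rw [this]
      exact Submodule.sum_mem _ fun l _ => hpart l
    let R : LieSubmodule ℂ Sl2 M :=
      { LinearMap.range Ψ with
        lie_mem := by
          rintro x _ ⟨y, rfl⟩
          exact ⟨_, hlie x y⟩ }
    have hR : ∀ v, v ∈ R ↔ v ∈ LinearMap.range Ψ := fun v => Iff.rfl
    have hlev : ∀ l, levelSpace b lev l ≤ LinearMap.range Ψ := by
      intro l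
      induction l with
      | zero => exact fun v hv => hprim 0 v hv (lie_slE_eq_zero b lev hb hv)
      | succ l ih =>
        intro v hv
        by_cases h : 2 * (l + 1) ≤ N
        · have hev := lie_slE_mem b lev hb hv
          -- The surjectivity of e is applied inside the image `R`, a finite dimensional module of
          -- its own: ⁅e, v⁆ lies in `R` by induction and has positive weight, so it is ⁅e, r⁆ with
          -- `r` in `R`. Then `v - r` is killed by e and lies in `R` too.
          obtain ⟨r, hr⟩ := exists_lie_eq (M := R) isSl2Triple (N - 2 * l - 1)
            ⟨⁅slE, v⁆, ih hev⟩ (by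
              refine Subtype.ext ?_
              change ⁅slH, ⁅slE, v⁆⁆ = _ • ⁅slE, v⁆
              rw [(mem_levelSpace_iff_lie b lev hb).1 hev]
              congr 1
              rw [Nat.cast_sub (by omega), Nat.cast_sub (by omega)]
              push_cast
              ring)
          have hr' : ⁅slE, r.1⁆ = ⁅slE, v⁆ := congrArg Subtype.val hr
          have := hker (v - r.1) (by rw [lie_sub, hr', sub_self])
          have h2 := Submodule.add_mem _ this ((hR _).1 r.2)
          rwa [sub_add_cancel] at h2
        -- At negative weight `v` is obtained by f from the preceding level, which lies in `R` by
        -- induction.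
        · obtain ⟨x, hx, rfl⟩ := exists_mem_lie_slF_eq b lev hb (l := l) (by omega) hv
          exact R.lie_mem (ih hx)
    exact fun v => mem_of_forall_levelSpace_le b lev hlev v
  exact ⟨LinearEquiv.ofBijective Ψ ⟨hinj, hsurj⟩, hlie⟩

end Decomposition

end RadSq

end
-- Passage from sl₂ to sl₂ × ℂ and comparison with `decomp n`.
noncomputable section

namespace RadSq

open Hochschild Module
open scoped TensorProduct DirectSum

/-- A summand of `decomp n` as a space of tuples. -/
def summandEquiv (t q : ℕ) (s : ℂ) :
    (⨁ _ : Fin q, V t) ⊗[ℂ] CMod s ≃ₗ[ℂ] (Fin q → V t) :=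
  (TensorProduct.congr (LinearEquiv.refl ℂ _) (LinearEquiv.refl ℂ ℂ : CMod s ≃ₗ[ℂ] ℂ)).trans
    ((TensorProduct.rid ℂ _).trans (DirectSum.linearEquivFunOnFintype ℂ (Fin q) fun _ => V t))

lemma summandEquiv_tmul {t q : ℕ} {s : ℂ} (y : ⨁ _ : Fin q, V t) (r : CMod s) (i : Fin q) :
    summandEquiv t q s (y ⊗ₜ r) i = (show ℂ from r) • y i := rfl

lemma summandEquiv_lie {t q : ℕ} {s : ℂ} (x : Sl2 × ℂ) (z : (⨁ _ : Fin q, V t) ⊗[ℂ] CMod s)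
    (i : Fin q) :
    summandEquiv t q s ⁅x, z⁆ i =
      ⁅x.1, summandEquiv t q s z i⁆ + (x.2 * s) • summandEquiv t q s z i := by
  induction z using TensorProduct.induction_on with
  | zero => simp
  | add z z' h h' =>
    rw [lie_add, map_add, Pi.add_apply, h, h', map_add, Pi.add_apply, lie_add, smul_add]
    abel
  | tmul y r =>
    rw [TensorProduct.LieModule.lie_tmul_right, map_add, Pi.add_apply, summandEquiv_tmul,
      summandEquiv_tmul, summandEquiv_tmul, DirectSum.lie_module_bracket_apply, lie_smul,
      smul_smul]
    congr 2
    change s * x.2 * _ = _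
    rw [mul_comm s]

/-- `decomp n` as a space of tuples. -/
def decompEquiv (n : ℕ) :
    decomp n ≃ₗ[ℂ] ((l : Fin ((n + 1) / 2 + 1)) → Fin (mult n l) → V (n + 1 - 2 * l)) :=
  (DirectSum.linearEquivFunOnFintype ℂ (Fin (topIndex n + 1)) fun l =>
    (⨁ _ : Fin (mult n l), V (n + 1 - 2 * l)) ⊗[ℂ] CMod (1 - (n : ℂ))).trans
    (LinearEquiv.piCongrRight fun l => summandEquiv (n + 1 - 2 * l) (mult n l) (1 - (n : ℂ)))

lemma decompEquiv_lie {n : ℕ} (x : Sl2 × ℂ) (y : decomp n) :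
    decompEquiv n ⁅x, y⁆ =
      (fun l i => ⁅x.1, decompEquiv n y l i⁆) + (x.2 * (1 - (n : ℂ))) • decompEquiv n y := by
  funext l i
  exact summandEquiv_lie x (y l) i

/-- `HHⁿ(A)` as a module over `sl₂(ℂ)`. -/
def sl2ToHH : Sl2 →ₗ⁅ℂ⁆ HH ℂ TwoLoopsAlgebra 1 :=
  hhOneEquiv.symm.toLieHom.comp (LieHom.inl ℂ Sl2 ℂ)

/-- The decomposition of `HHⁿ(A)`, given a basis of weight vectors. -/
lemma exists_equiv_decomp {n : ℕ} (hn : 1 ≤ n) {ι : Type*} [Fintype ι]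
    (b : Basis ι ℂ (HH ℂ TwoLoopsAlgebra n)) (lev : ι → ℕ)
    (hb : ∀ i, ⁅hhOneEquiv.symm (slH, 0), b i⁆ = (((n + 1 : ℕ) : ℂ) - 2 * lev i) • b i)
    (h0 : Fintype.card {i // lev i = 0} = mult n 0)
    (hs : ∀ l, 2 * (l + 1) ≤ n + 1 →
      Fintype.card {i // lev i = l + 1} = Fintype.card {i // lev i = l} + mult n (l + 1)) :
    ∃ e : HH ℂ TwoLoopsAlgebra n ≃ₗ[ℂ] decomp n,
      ∀ (x : HH ℂ TwoLoopsAlgebra 1) (m : HH ℂ TwoLoopsAlgebra n),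
        e ⁅x, m⁆ = ⁅hhOneEquiv x, e m⁆ := by
  -- The action is restricted to the factor sl₂ in order to apply `exists_equiv_pi` with `N = n +
  -- 1`.
  let _ : LieRingModule Sl2 (HH ℂ TwoLoopsAlgebra n) := LieRingModule.compLieHom _ sl2ToHH
  let _ : LieModule ℂ Sl2 (HH ℂ TwoLoopsAlgebra n) := LieModule.compLieHom _ sl2ToHH
  have : FiniteDimensional ℂ (HH ℂ TwoLoopsAlgebra n) := Module.Finite.of_basis b
  have hb' : IsWeightBasis b lev (n + 1) := hb
  obtain ⟨Ψ, hΨ⟩ := exists_equiv_pi (q := mult n) hb' h0 hs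
  refine ⟨Ψ.symm.trans (decompEquiv n).symm, fun x m => ?_⟩
  obtain ⟨⟨X, c⟩, rfl⟩ : ∃ z, hhOneEquiv.symm z = x :=
    ⟨hhOneEquiv x, LieEquiv.symm_apply_apply _ _⟩
  obtain ⟨y, rfl⟩ := Ψ.surjective m
  -- The central factor acts on both sides by the same scalar, so compatibility with sl₂ is all that
  -- remains.
  have h1 : ⁅hhOneEquiv.symm (X, c), Ψ y⁆ = ⁅X, Ψ y⁆ + (c * (1 - (n : ℂ))) • Ψ y := by
    have : ((X, c) : Sl2 × ℂ) = (X, 0) + c • (0, 1) := by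
      simp
    rw [this, map_add, map_smul, add_lie, smul_lie, lie_euler hn, smul_smul]
    rfl
  rw [h1, LieEquiv.apply_symm_apply]
  refine (decompEquiv n).injective ?_
  rw [decompEquiv_lie, ← hΨ, ← map_smul, ← map_add]
  simp

end RadSq

end
-- A weight basis of `HHⁿ(A)` and the multiplicities.
noncomputable section

namespace RadSq

open Hochschild Module

/-- The number of letters `0` in a word. -/
def zeroCount {n : ℕ} (w : Fin n → Fin 2) : ℕ := (Finset.univ.filter fun i => w i = 0).card

/-- A word in two letters is the set of positions of its letters `0`. -/
lemma card_zeroCount (n k : ℕ) :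
    (Finset.univ.filter fun w : Fin n → Fin 2 => zeroCount w = k).card = n.choose k := by
  conv_rhs => rw [← Finset.card_fin n, ← Finset.card_powersetCard]
  refine Finset.card_nbij' (fun w => Finset.univ.filter fun i => w i = 0)
    (fun S i => if i ∈ S then 0 else 1) ?_ ?_ ?_ ?_
  · intro w hw
    exact Finset.mem_powersetCard.2 ⟨Finset.subset_univ _, (Finset.mem_filter.1 hw).2⟩
  · intro S hS
    refine Finset.mem_filter.2 ⟨Finset.mem_univ _, ?_⟩
    rw [← (Finset.mem_powersetCard.1 hS).2, zeroCount]
    congr 1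
    ext i
    simp
  · intro w _
    ext i
    have : w i = 0 ∨ w i = 1 := by
      generalize w i = a
      fin_cases a <;> simp
    rcases this with h | h <;> simp [h]
  · intro S _
    ext i
    simp

/-- The eigenvalues of `slH`. -/
def slWeight : Fin 2 → ℂ := ![1, -1]

lemma slH_eq_diagonal : slH.1 + (0 : ℂ) • 1 = Matrix.diagonal slWeight := by
  ext i j
  fin_cases i <;> fin_cases j <;> simp [slH, slWeight]

lemma sum_slWeight {n : ℕ} (w : Fin n → Fin 2) :
    ∑ i, slWeight (w i) = 2 * zeroCount w - n := by
  have h : ∀ a : Fin 2, slWeight a = 2 * (if a = 0 then 1 else 0) - 1 := by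
    intro a
    fin_cases a <;> norm_num [slWeight]
  simp only [h, Finset.sum_sub_distrib, ← Finset.mul_sum, Finset.sum_boole, zeroCount]
  simp

/-- The coboundary of the scalar cochain with values `u`, on words of loops. -/
def bdry (n : ℕ) (u : (Fin n → Fin 2) → ℂ) : (Fin (n + 1) → Fin 2) → Fin 2 → ℂ := fun w =>
  u (Fin.tail w) • Pi.single (w 0) 1 +
    ((-1 : ℂ) ^ (n + 1) * u (Fin.init w)) • Pi.single (w (Fin.last n)) 1

lemma hhTable_bdry (n : ℕ) (u : (Fin n → Fin 2) → ℂ) : hhTable (n + 1) (bdry n u) = 0 :=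
  (hhTable_eq_zero_iff _).2 ⟨u, fun _ => rfl⟩

/-- The partial trace of a table. -/
def tableTrace (n : ℕ) :
    ((Fin (n + 1) → Fin 2) → Fin 2 → ℂ) →ₗ[ℂ] ((Fin n → Fin 2) → ℂ) where
  toFun g w := g (Fin.cons 0 w) 0 + g (Fin.cons 1 w) 1
  map_add' g g' := by
    funext w
    simp only [Pi.add_apply]
    ring
  map_smul' c g := by
    funext w
    simp only [Pi.smul_apply, smul_eq_mul, RingHom.id_apply]
    ring

/-- The cyclic rotation of a word. -/
def rotWord {m : ℕ} (w : Fin (m + 1) → Fin 2) : Fin (m + 1) → Fin 2 :=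
  Fin.init (Fin.cons (w (Fin.last m)) w : Fin (m + 2) → Fin 2)

/-- Of the two terms of the coboundary, the first contributes `u w` for each of the two possible
first letters. The second contributes only when the first letter equals the last letter of `w`, and
then its argument is the rotated word. -/
lemma tableTrace_bdry {m : ℕ} (u : (Fin (m + 1) → Fin 2) → ℂ) (w : Fin (m + 1) → Fin 2) :
    tableTrace (m + 1) (bdry (m + 1) u) w = 2 * u w + (-1 : ℂ) ^ (m + 2) * u (rotWord w) := by
  have h : ∀ i : Fin 2, bdry (m + 1) u (Fin.cons i w) i = u w +
      if i = w (Fin.last m) then (-1 : ℂ) ^ (m + 2) * u (rotWord w) else 0 := by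
    intro i
    have e : (Fin.cons i w : Fin (m + 2) → Fin 2) (Fin.last (m + 1)) = w (Fin.last m) := by
      rw [← Fin.succ_last, Fin.cons_succ]
    simp only [bdry, Pi.add_apply, Pi.smul_apply, Fin.cons_zero, Fin.tail_cons, Pi.single_eq_same,
      smul_eq_mul, mul_one, e, Pi.single_apply]
    split_ifs with hi
    · rw [mul_one, hi, rotWord]
    · rw [mul_zero]
  change bdry (m + 1) u (Fin.cons 0 w) 0 + bdry (m + 1) u (Fin.cons 1 w) 1 = _
  rw [h, h]
  have : w (Fin.last m) = 0 ∨ w (Fin.last m) = 1 := by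
    generalize w (Fin.last m) = a
    fin_cases a <;> simp
  rcases this with h | h <;> simp [h] <;> ring

/-- The partial trace of coboundaries as a linear endomorphism. -/
def traceBdry (m : ℕ) : ((Fin (m + 1) → Fin 2) → ℂ) →ₗ[ℂ] ((Fin (m + 1) → Fin 2) → ℂ) where
  toFun u := tableTrace (m + 1) (bdry (m + 1) u)
  map_add' u v := by
    funext w
    simp only [tableTrace_bdry, Pi.add_apply]
    ring
  map_smul' c u := by
    funext w
    simp only [tableTrace_bdry, Pi.smul_apply, smul_eq_mul, RingHom.id_apply]
    ring

/-- At a word where `‖u‖` is maximal, a kernel element satisfies 2‖u w₀‖ = ‖u (rotWord w₀)‖ ≤ ‖u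
w₀‖, hence vanishes. -/
lemma traceBdry_injective (m : ℕ) : Function.Injective (traceBdry m) := by
  rw [← LinearMap.ker_eq_bot, LinearMap.ker_eq_bot']
  intro u hu
  obtain ⟨w₀, h₀⟩ := Finite.exists_max fun w => ‖u w‖
  have h1 : 2 * u w₀ + (-1 : ℂ) ^ (m + 2) * u (rotWord w₀) = 0 := by
    rw [← tableTrace_bdry]
    exact congrFun hu w₀
  have h2 : 2 * ‖u w₀‖ = ‖u (rotWord w₀)‖ := by
    have := congrArg norm (eq_neg_of_add_eq_zero_left h1)
    simpa using this
  have h3 : ‖u (rotWord w₀)‖ ≤ ‖u w₀‖ := h₀ (rotWord w₀)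
  funext w
  have h4 : ‖u w‖ ≤ ‖u w₀‖ := h₀ w
  exact norm_le_zero_iff.1 (by linarith)

/-- Tables with vanishing partial trace, parametrized by their entries. -/
def tracelessTable (n : ℕ) :
    ((Fin n → Fin 2) → Fin 3 → ℂ) →ₗ[ℂ] ((Fin (n + 1) → Fin 2) → Fin 2 → ℂ) where
  toFun a w j := !![a (Fin.tail w) 1, a (Fin.tail w) 0; a (Fin.tail w) 2, -a (Fin.tail w) 1] j (w 0)
  map_add' a b := by
    funext w j
    generalize hi : w 0 = i
    fin_cases j <;> fin_cases i <;> simp [hi, add_comm]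
  map_smul' c a := by
    funext w j
    generalize hi : w 0 = i
    fin_cases j <;> fin_cases i <;> simp [hi]

lemma tracelessTable_apply {n : ℕ} (a : (Fin n → Fin 2) → Fin 3 → ℂ) (w : Fin (n + 1) → Fin 2)
    (j : Fin 2) : tracelessTable n a w j =
      !![a (Fin.tail w) 1, a (Fin.tail w) 0; a (Fin.tail w) 2, -a (Fin.tail w) 1] j (w 0) := rfl

lemma tableTrace_tracelessTable {n : ℕ} (a : (Fin n → Fin 2) → Fin 3 → ℂ) :
    tableTrace n (tracelessTable n a) = 0 := by
  funext w
  change tracelessTable n a (Fin.cons 0 w) 0 + tracelessTable n a (Fin.cons 1 w) 1 = 0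
  simp [tracelessTable_apply]

lemma tracelessTable_injective (n : ℕ) : Function.Injective (tracelessTable n) := by
  intro a b h
  have key : ∀ w i j, tracelessTable n a (Fin.cons i w) j = tracelessTable n b (Fin.cons i w) j :=
    fun w i j => by rw [h]
  funext w s
  fin_cases s
  · simpa [tracelessTable_apply] using key w 1 0
  · simpa [tracelessTable_apply] using key w 0 0
  · simpa [tracelessTable_apply] using key w 0 1

lemma exists_tracelessTable_eq {n : ℕ} {g : (Fin (n + 1) → Fin 2) → Fin 2 → ℂ}
    (hg : tableTrace n g = 0) : ∃ a, tracelessTable n a = g := by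
  refine ⟨fun w => ![g (Fin.cons 1 w) 0, g (Fin.cons 0 w) 0, g (Fin.cons 0 w) 1], ?_⟩
  funext w j
  obtain ⟨i, w, rfl⟩ : ∃ i v, (Fin.cons i v : Fin (n + 1) → Fin 2) = w :=
    ⟨w 0, Fin.tail w, Fin.cons_self_tail w⟩
  have h : g (Fin.cons 0 w) 0 + g (Fin.cons 1 w) 1 = 0 := congrFun hg w
  fin_cases i <;> fin_cases j <;> simp [tracelessTable_apply]
  exact neg_eq_of_add_eq_zero_right h

/-- The partial trace is bijective on coboundary data: `traceBdry` is injective on a finite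
dimensional space, hence surjective. So every table becomes traceless after subtracting a unique
coboundary. -/
lemma hhTable_tracelessTable_bijective (m : ℕ) :
    Function.Bijective ((hhTable (m + 2)).comp (tracelessTable (m + 1))) := by
  constructor
  · rw [← LinearMap.ker_eq_bot, LinearMap.ker_eq_bot']
    intro a ha
    obtain ⟨u, hu⟩ := (hhTable_eq_zero_iff _).1 ha
    have hu' : tracelessTable (m + 1) a = bdry (m + 1) u := funext hu
    have h : traceBdry m u = 0 := by
      change tableTrace (m + 1) (bdry (m + 1) u) = 0
      rw [← hu', tableTrace_tracelessTable]
    have h0 : u = 0 := traceBdry_injective m (h.trans (map_zero _).symm)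
    refine tracelessTable_injective _ ?_
    rw [hu', h0, map_zero]
    funext w j
    simp [bdry]
  · intro x
    obtain ⟨g, rfl⟩ := hhTable_surjective (m + 1) x
    obtain ⟨u, hu⟩ := LinearMap.injective_iff_surjective.1 (traceBdry_injective m)
      (tableTrace (m + 1) g)
    obtain ⟨a, ha⟩ := exists_tracelessTable_eq (n := m + 1) (g := g - bdry (m + 1) u) (by
      rw [map_sub, ← hu]
      exact sub_self _)
    refine ⟨a, ?_⟩
    rw [LinearMap.comp_apply, ha, map_sub, hhTable_bdry, sub_zero]

/-- The basis of `HHⁿ(A)`, `n ≥ 2`, coming from traceless tables. -/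
def tableBasis (m : ℕ) :
    Basis (Σ _ : Fin (m + 1) → Fin 2, Fin 3) ℂ (HH ℂ TwoLoopsAlgebra (m + 2)) :=
  (Pi.basis fun _ => Pi.basisFun ℂ (Fin 3)).map
    (LinearEquiv.ofBijective _ (hhTable_tracelessTable_bijective m))

lemma tableBasis_apply {m : ℕ} (w : Fin (m + 1) → Fin 2) (s : Fin 3) :
    tableBasis m ⟨w, s⟩ =
      hhTable (m + 2) (tracelessTable (m + 1) (Pi.single w (Pi.single s 1))) := by
  rw [tableBasis, Basis.map_apply, Pi.basis_apply, Pi.basisFun_apply]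
  rfl

/-- The index `s` = 0, 1, 2 is the sl₂-weight 2, 0, -2 of the pair formed by value and first letter.
The remaining letters contribute their number minus twice the number of zeros. -/
lemma weight_mul_tracelessTable {n : ℕ} (a : (Fin n → Fin 2) → Fin 3 → ℂ) :
    (fun w j => (slWeight j - ∑ i, slWeight (w i)) * tracelessTable n a w j) =
      tracelessTable n fun w s => ((n + 2 : ℂ) - 2 * ((s : ℕ) + zeroCount w : ℕ)) * a w s := by
  funext w j
  obtain ⟨i, w, rfl⟩ : ∃ i v, (Fin.cons i v : Fin (n + 1) → Fin 2) = w :=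
    ⟨w 0, Fin.tail w, Fin.cons_self_tail w⟩
  rw [Fin.sum_univ_succ]
  simp only [Fin.cons_zero, Fin.cons_succ, sum_slWeight, tracelessTable_apply, Fin.tail_cons]
  fin_cases i <;> fin_cases j <;> simp [slWeight] <;> left <;> ring

lemma lie_tableBasis {m : ℕ} (p : Σ _ : Fin (m + 1) → Fin 2, Fin 3) :
    ⁅hhOneEquiv.symm (slH, 0), tableBasis m p⁆ =
      (((m + 2 + 1 : ℕ) : ℂ) - 2 * ((p.2 : ℕ) + zeroCount p.1 : ℕ)) • tableBasis m p := by
  obtain ⟨w, s⟩ := p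
  rw [tableBasis_apply, lie_symm_hhTable _ _ _ slH_eq_diagonal, weight_mul_tracelessTable,
    ← map_smul, ← map_smul]
  congr 2
  funext v r
  rw [Pi.smul_apply, Pi.smul_apply, smul_eq_mul]
  by_cases hv : v = w
  · subst hv
    by_cases hr : r = s
    · subst hr
      push_cast
      ring
    · simp [hr]
  · simp [hv]

/-- The three summands are the contributions of `s` = 0, 1, 2, the word then having `l - s` zeros.
-/
lemma card_tableLevel (n l : ℕ) :
    Fintype.card {p : Σ _ : Fin n → Fin 2, Fin 3 // (p.2 : ℕ) + zeroCount p.1 = l} =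
      n.choose l + (if 1 ≤ l then n.choose (l - 1) else 0) +
        if 2 ≤ l then n.choose (l - 2) else 0 := by
  have h : ∀ s : ℕ, ∑ w : Fin n → Fin 2, (if s + zeroCount w = l then 1 else 0) =
      if s ≤ l then n.choose (l - s) else 0 := by
    intro s
    rw [← card_zeroCount, Finset.sum_boole, Nat.cast_id]
    split_ifs with hs
    · congr 2
      funext w
      exact propext (by omega)
    · rw [Finset.card_eq_zero, Finset.filter_eq_empty_iff]
      intro w _
      omega
  rw [Fintype.card_subtype, Finset.card_filter, Fintype.sum_sigma, Finset.sum_comm,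
    Fin.sum_univ_three]
  have h0 := h 0
  have h1 := h 1
  have h2 := h 2
  simp only [Nat.zero_le, if_true, Nat.sub_zero] at h0
  rw [← h0, ← h1, ← h2]
  rfl

/-- Binomial coefficients increase up to the middle. An index `j` beyond it is reflected to `n - j`,
which is still at least `i`. -/
lemma choose_le_choose_of_add_le {n i j : ℕ} (hij : i ≤ j) (h : i + j ≤ n) :
    n.choose i ≤ n.choose j := by
  rcases le_or_gt j (n / 2) with hj | hj
  · induction j, hij using Nat.le_induction with
    | base => exact le_rfl
    | succ j hij ih =>
      exact (ih (by omega) (by omega)).trans (Nat.choose_le_succ_of_lt_half_left (by omega))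
  · rw [← Nat.choose_symm (show j ≤ n by omega)]
    obtain ⟨k, hk⟩ : ∃ k, k = n - j := ⟨_, rfl⟩
    have hik : i ≤ k := by omega
    have hk2 : k ≤ n / 2 := by omega
    rw [← hk]
    clear hk h hij hj
    induction k, hik using Nat.le_induction with
    | base => exact le_rfl
    | succ k hik ih =>
      exact (ih (by omega)).trans (Nat.choose_le_succ_of_lt_half_left (by omega))

/-- Sums of three consecutive binomial coefficients at consecutive levels share two terms, so they
differ by C(n-1, l) - C(n-1, l-3). Small `l` are separate because some of these terms are then
absent. -/
lemma exists_equiv_decomp_add_two (m : ℕ) :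
    ∃ e : HH ℂ TwoLoopsAlgebra (m + 2) ≃ₗ[ℂ] decomp (m + 2),
      ∀ (x : HH ℂ TwoLoopsAlgebra 1) (y : HH ℂ TwoLoopsAlgebra (m + 2)),
        e ⁅x, y⁆ = ⁅hhOneEquiv x, e y⁆ := by
  refine exists_equiv_decomp (by omega) (tableBasis m) (fun p => (p.2 : ℕ) + zeroCount p.1)
    lie_tableBasis ?_ ?_
  · rw [card_tableLevel]
    simp [mult]
  · intro l hl
    rw [card_tableLevel, card_tableLevel, mult, if_neg (show ¬ m + 2 = 1 by omega),
      show m + 2 - 1 = m + 1 by omega]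
    match l, hl with
    | 0, _ => simp; omega
    | 1, _ => simp; omega
    | l + 2, hl =>
      -- This makes the truncated subtraction in `mult` a genuine one in the range of nonnegative
      -- weights.
      have := choose_le_choose_of_add_le (n := m + 1) (i := l) (j := l + 2 + 1) (by omega) (by omega)
      rw [if_neg (by omega : ¬ l + 2 + 1 ≤ 2)]
      simp only [show l + 2 + 1 - 1 = l + 2 by omega, show l + 2 + 1 - 2 = l + 1 by omega,
        show l + 2 - 1 = l + 1 by omega, show l + 2 - 2 = l by omega,
        show l + 2 + 1 - 3 = l by omega, show 1 ≤ l + 2 + 1 by omega, show 2 ≤ l + 2 + 1 by omega,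
        show 1 ≤ l + 2 by omega, show 2 ≤ l + 2 by omega, if_true]
      omega

/-- The rotation argument needs nonempty words for `u`. In degree one `u` lives on the empty word,
and the two terms of the coboundary cancel. -/
lemma hhTable_one_bijective : Function.Bijective (hhTable 1) := by
  refine ⟨?_, hhTable_surjective 0⟩
  rw [← LinearMap.ker_eq_bot, LinearMap.ker_eq_bot']
  intro g hg
  obtain ⟨u, hu⟩ := (hhTable_eq_zero_iff g).1 hg
  funext w
  rw [hu, Subsingleton.elim (Fin.tail w) (Fin.init w), ← Fin.last_zero]
  simp [-Fin.last_zero]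

/-- The basis of `HH¹(A)` given by the matrix units. -/
def tableBasisOne : Basis (Σ _ : Fin 1 → Fin 2, Fin 2) ℂ (HH ℂ TwoLoopsAlgebra 1) :=
  (Pi.basis fun _ => Pi.basisFun ℂ (Fin 2)).map (LinearEquiv.ofBijective _ hhTable_one_bijective)

lemma lie_tableBasisOne (p : Σ _ : Fin 1 → Fin 2, Fin 2) :
    ⁅hhOneEquiv.symm (slH, 0), tableBasisOne p⁆ =
      (((1 + 1 : ℕ) : ℂ) - 2 * ((p.2 : ℕ) + zeroCount p.1 : ℕ)) • tableBasisOne p := by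
  obtain ⟨w, s⟩ := p
  have h : tableBasisOne ⟨w, s⟩ = hhTable 1 (Pi.single w (Pi.single s 1)) := by
    rw [tableBasisOne, Basis.map_apply, Pi.basis_apply, Pi.basisFun_apply]
    rfl
  rw [h, lie_symm_hhTable _ _ _ slH_eq_diagonal, ← map_smul]
  congr 1
  funext v r
  rw [Pi.smul_apply, Pi.smul_apply, smul_eq_mul, sum_slWeight]
  by_cases hv : v = w
  · subst hv
    by_cases hr : r = s
    · subst hr
      congr 1
      fin_cases r <;> simp [slWeight] <;> ring
    · simp [hr]
  · simp [hv]

lemma exists_equiv_decomp_one :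
    ∃ e : HH ℂ TwoLoopsAlgebra 1 ≃ₗ[ℂ] decomp 1,
      ∀ x y : HH ℂ TwoLoopsAlgebra 1, e ⁅x, y⁆ = ⁅hhOneEquiv x, e y⁆ := by
  refine exists_equiv_decomp le_rfl tableBasisOne (fun p => (p.2 : ℕ) + zeroCount p.1)
    lie_tableBasisOne ?_ ?_
  -- The four matrix units have levels 0, 1, 1, 2, so the multiplicities at levels 0 and 1 are both
  -- one.
  · decide
  · intro l hl
    obtain rfl : l = 0 := by omega
    decide

end RadSq

end

open Hochschild RadSq in
theorem mainTheorem9 :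
    (∀ t : ℕ, LieModule.IsIrreducible ℂ Sl2 (V t) ∧ Module.finrank ℂ (V t) = t + 1) ∧
    ∃ φ : HH ℂ TwoLoopsAlgebra 1 ≃ₗ⁅ℂ⁆ Sl2 × ℂ,
      (∀ (D : Z ℂ TwoLoopsAlgebra 1) (j : Fin 2),
        D.1 (fun _ => loop j) =
          ∑ i, (φ (HH.mk ℂ TwoLoopsAlgebra 1 D)).1.1 i j • loop i +
            (φ (HH.mk ℂ TwoLoopsAlgebra 1 D)).2 • loop j) ∧
      ∀ n : ℕ, 1 ≤ n →
        (∀ m : HH ℂ TwoLoopsAlgebra n, ⁅φ.symm (0, 1), m⁆ = (1 - (n : ℂ)) • m) ∧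
        ∃ e : HH ℂ TwoLoopsAlgebra n ≃ₗ[ℂ] decomp n,
          ∀ (x : HH ℂ TwoLoopsAlgebra 1) (m : HH ℂ TwoLoopsAlgebra n),
            e ⁅x, m⁆ = ⁅φ x, e m⁆ := by
  refine ⟨fun t => ⟨V.isIrreducible t, V.finrank_eq t⟩, hhOneEquiv, apply_loop_eq, fun n hn =>
    ⟨lie_euler hn, ?_⟩⟩
  match n, hn with
  | 1, _ => exact exists_equiv_decomp_one
  | m + 2, _ => exact exists_equiv_decomp_add_two m
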